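/- **Setting.** Fix $n$ and real weights $\eta_1\le\dots\le\eta_n$ with $\eta_1+\dots+\eta_n=0$. Let $g_t=\exp(t\,\mathrm{diag}(\eta_1,\dots,\eta_n))$, let $\mathcal E$ be the multiset $\{\eta_1,\dots,\eta_n\}$, and for $0\le l\le n$ let $\mathcal I_l$ be the set of sub-multisets of $\mathcal E$ of size $l$. For $E\in\mathcal I_l$ put $\eta_E=\sum_{\eta\in E}\eta$. For $E_1,E_2\in\mathcal I_l$ write $E_1\preceq E_2$ if $\#\{x\in E_1:x>r\}\le\#\{x\in E_2:x>r\}$ for every $r\in\mathbb R$. Let $X_n$ be the space of lattices of rank $n$ and covolume $1$ in $\mathbb R^n$. **Grassmannians.** Let $\mathrm{Gr}(l,n)$ be the space of $l$-dimensional subspaces of $\mathbb R^n$ with the path metric $d$ of an $O(n)$-invariant Riemannian metric (normalized by the embedding that sends a subspace to its orthogonal projection matrix, with the Frobenius norm). For $E\in\mathcal I_l$ let $\mathrm{Gr}^g_E\subseteq\mathrm{Gr}(l,n)$ be the set of $V$ that are invariant under all $g_t$ and such that the eigenvalues of $g_t|_V$ are $e^{t\eta}$, $\eta\in E$, with multiplicity.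 Let $U_\varepsilon(\mathrm{Gr}^g_E)$ be its open $\varepsilon$-neighbourhood, and let $$\varepsilon_0=\tfrac12\min_{1\le l\le n-1}\ \min_{E_1\ne E_2\in\mathcal I_l}d(\mathrm{Gr}^g_{E_1},\mathrm{Gr}^g_{E_2})$$ ($\varepsilon_0=\infty$ if there are no such pairs). **Harder–Narasimhan filtration.** For a discrete subgroup $\Gamma\subset\mathbb R^n$ let $\mathrm{cov}\,\Gamma$ be the Euclidean volume of $\mathrm{span}\,\Gamma/\Gamma$ ($\mathrm{cov}\{0\}=1$), and $p_\Gamma=(\mathrm{rk}\,\Gamma,\log\mathrm{cov}\,\Gamma)\in\mathbb R^2$. For a lattice $\Lambda$, the filtration $\mathrm{HN}(\Lambda)$ consists of the subgroups $\Gamma\subseteq\Lambda$ for which $p_\Gamma$ is an extreme point of the convex hull of $S_\Lambda=\{p_\Gamma:\Gamma\subseteq\Lambda\}$; it has at most one member $\Gamma_l$ of each rank $l$. If this member exists, $\mathrm{HN}(\Lambda)_{V,l}=\mathrm{span}\,\Gamma_l$. The height $\mathrm{HN}(\Lambda)_{H,l}$, $0\le l\le n$, is the value at $l$ of the lower boundary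 of this convex hull, i.e. $\log\mathrm{cov}\,\Gamma_l$ if $\Gamma_l$ exists, and linearly interpolated in between. **Templates.** A *height sequence* is a sequence $0=a_0,a_1,\dots,a_n=0$ with $\partial^2a_l:=a_{l-1}-2a_l+a_{l+1}\ge0$ for $1\le l\le n-1$. A *direction filtration* is a family $(E_l)_{0\le l\le n}$ where each $E_l$ is an element of $\mathcal I_l$ or a null symbol $*$, with $E_0=\emptyset$, $E_n=\mathcal E$, and $E_l\subseteq E_{l'}$ whenever $l\le l'$ and both are multisets. A *$g$-template* $f$ on $\mathbb R$ consists of * a *category flow* $f_{E,\bullet}$: a locally constant map from $\mathbb R\setminus T$ to direction filtrations, where $T\subset\mathbb R$ is locally finite, together with, for every $t\in T$ and $0\le l\le n$, an arrow from the left limit $f_{E,l}(t^-)$ to the right limit $f_{E,l}(t^+)$. An arrow is either a *transition arrow* $E\to E'$ between multisets with $E\preceq E'$, or a *null arrow*, which is allowed between any two objects (including $*$) when $1\le l\le n-1$. The identity arrows are the transition arrows $E\to E$ and the null arrow $*\to *$. For $l\in\{0,n\}$ the arrow is the identity; for every $t\in T$ at least one of the arrows is not the identity. A time $t$ is *regular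 for $f_{E,l}$* if $t\notin T$ or the $l$-th arrow at $t$ is the identity (then $f_{E,l}(t)$ denotes the common value near $t$). A time is a *null point* of $f_{E,l}$ if it is regular with $f_{E,l}(t)=*$ or irregular with a null arrow, and *nontrivial* otherwise; * a continuous map $t\mapsto f_{H,\bullet}(t)$ to height sequences, such that for every $1\le l\le n-1$ and $t\in\mathbb R$: (1) $\partial^2f_{H,l}(t)>0$ if and only if $t$ is a nontrivial point of $f_{E,l}$; (2) if $t$ is regular and nontrivial for $f_{E,l}$, then $f_{H,l}$ is differentiable at $t$ with $\frac{d}{dt}f_{H,l}(t)=\eta_{f_{E,l}(t)}$. **Matching.** For $\varepsilon,C>0$, a lattice $\Lambda\in X_n$ *$(\varepsilon,C)$-matches* $f$ on $\mathbb R$ if 1. $|\mathrm{HN}(g_t\Lambda)_{H,l}-f_{H,l}(t)|<C$ for all $t\in\mathbb R$ and $1\le l\le n-1$; 2. for all $1\le l\le n-1$, all $E\in\mathcal I_l$ and every interval $[a,b]$ such that every $t\in[a,b]$ is regular for $f_{E,l}$ with $f_{E,l}(t)=E$ and $\partial^2f_{H,l}(t)\ge C$: for every $t\in[a+C,b-C]$,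 the space $\mathrm{HN}(g_t\Lambda)_{V,l}$ exists and lies in $U_\varepsilon(\mathrm{Gr}^g_E)$. **Theorem (Existence of Templates).** For every $0<\varepsilon<\varepsilon_0$ there is $C>0$ such that every $\Lambda\in X_n$ $(\varepsilon,C)$-matches some $g$-template $f$ on $\mathbb R$. -/

import Mathlib

open scoped ENNReal Topology

noncomputable section

namespace GTemplate

/-! ### The flow -/

/-- The element `g_t = exp (t diag (η_1, …, η_n))` acting on Euclidean space. -/
def gFlow {n : ℕ} (η : Fin n → ℝ) (t : ℝ) :
    EuclideanSpace ℝ (Fin n) →ₗ[ℝ] EuclideanSpace ℝ (Fin n) :=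
  Matrix.toEuclideanLin (Matrix.diagonal fun i => Real.exp (t * η i))

/-- The subgroup `g_t Λ`. -/
def flowLattice {n : ℕ} (η : Fin n → ℝ) (t : ℝ) (Λ : Submodule ℤ (EuclideanSpace ℝ (Fin n))) :
    Submodule ℤ (EuclideanSpace ℝ (Fin n)) :=
  Λ.map ((gFlow η t).restrictScalars ℤ)

/-! ### The Harder-Narasimhan filtration -/

/-- The Euclidean volume of the torus `span Γ / Γ`, where `span Γ` carries the Lebesgue measure
of the restricted inner product. It is `1` for the zero group. -/
def cov {n : ℕ} (Γ : Submodule ℤ (EuclideanSpace ℝ (Fin n))) : ℝ :=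
  ZLattice.covolume
    (ZLattice.comap ℝ Γ (Submodule.span ℝ (Γ : Set (EuclideanSpace ℝ (Fin n)))).subtype)
    measureSpaceOfInnerProductSpace.volume

/-- The point `p_Γ = (rank Γ, log cov Γ)`. -/
def latticePoint {n : ℕ} (Γ : Submodule ℤ (EuclideanSpace ℝ (Fin n))) : ℝ × ℝ :=
  ((Module.finrank ℤ Γ : ℝ), Real.log (cov Γ))

/-- The convex hull of `S_Λ = {p_Γ : Γ ⊆ Λ}`. -/
def hnHull {n : ℕ} (Λ : Submodule ℤ (EuclideanSpace ℝ (Fin n))) : Set (ℝ × ℝ) :=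
  convexHull ℝ {p | ∃ Γ : Submodule ℤ (EuclideanSpace ℝ (Fin n)), Γ ≤ Λ ∧ p = latticePoint Γ}

/-- `Γ` is a member of the Harder-Narasimhan filtration of `Λ`: the point `p_Γ` is an extreme
point of the convex hull of `S_Λ`. -/
def IsHN {n : ℕ} (Λ Γ : Submodule ℤ (EuclideanSpace ℝ (Fin n))) : Prop :=
  Γ ≤ Λ ∧ latticePoint Γ ∈ (hnHull Λ).extremePoints ℝ

/-- The height `HN(Λ)_{H,l}`: the value at `l` of the lower boundary of the convex hull of `S_Λ`.
This boundary is the piecewise linear function which interpolates the extreme points, that is,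
the values `log cov Γ_l` of the members `Γ_l` of the filtration. -/
def hnHeight {n : ℕ} (Λ : Submodule ℤ (EuclideanSpace ℝ (Fin n))) (l : ℕ) : ℝ :=
  sInf {y : ℝ | ((l : ℝ), y) ∈ hnHull Λ}

/-! ### Grassmannians -/

/-- The Grassmannian of `l`-dimensional subspaces of `ℝⁿ`. -/
def Gr (n l : ℕ) : Type :=
  {V : Submodule ℝ (EuclideanSpace ℝ (Fin n)) // Module.finrank ℝ V = l}

/-- The matrix of the orthogonal projection to `V`, in the space of matrices with the Frobenius
norm. This is the standard `O(n)`-equivariant embedding of the Grassmannian. -/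
def projMatrix {n l : ℕ} (V : Gr n l) : EuclideanSpace ℝ (Fin n × Fin n) :=
  WithLp.toLp 2 fun p => (V.1.starProjection (EuclideanSpace.single p.2 (1 : ℝ))) p.1

/-- The path metric on the Grassmannian of the orthogonally invariant Riemannian metric: the
infimum of the lengths of continuous paths from `V` to `W`, where lengths are measured in the
`O(n)`-equivariant embedding `projMatrix`. (The invariant Riemannian metric is unique up to a
scalar factor.) -/
def dGr {n l : ℕ} (V W : Gr n l) : ℝ≥0∞ :=
  ⨅ (γ : ℝ → Gr n l) (_ : γ 0 = V ∧ γ 1 = W ∧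
      ContinuousOn (fun s => projMatrix (γ s)) (Set.Icc 0 1)),
    eVariationOn (fun s => projMatrix (γ s)) (Set.Icc 0 1)

/-- The open `ε`-neighbourhood of a set of subspaces. -/
def nhd {n l : ℕ} (ε : ℝ) (A : Set (Gr n l)) : Set (Gr n l) :=
  {V | ∃ W ∈ A, dGr V W < ENNReal.ofReal ε}

/-! ### Multisets of weights -/

/-- The multiset of all weights. -/
def Eall {n : ℕ} (η : Fin n → ℝ) : Multiset ℝ := Finset.univ.val.map η

/-- The set `I_l` of sub-multisets of size `l` of the multiset of all weights. -/
def weightSets {n : ℕ} (η : Fin n → ℝ) (l : ℕ) : Set (Multiset ℝ) :=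
  {E | E ≤ Eall η ∧ E.card = l}

/-- The partial order on `I_l`: `E₂` is obtained from `E₁` by increasing elements. -/
def Dominated (E₁ E₂ : Multiset ℝ) : Prop :=
  ∀ r : ℝ, (E₁.filter fun x => r < x).card ≤ (E₂.filter fun x => r < x).card

/-- The set of `g_t`-invariant `l`-dimensional subspaces `V` such that the eigenvalues of `g_t`
on `V` are `exp (t x)`, `x ∈ E`, with multiplicities. -/
def invGr {n : ℕ} (η : Fin n → ℝ) (l : ℕ) (E : Multiset ℝ) : Set (Gr n l) :=
  {V | (∀ t : ℝ, V.1.map (gFlow η t) = V.1) ∧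
    ∀ x : ℝ, Module.finrank ℝ
      (V.1 ⊓ Module.End.eigenspace (gFlow η 1) (Real.exp x) :
        Submodule ℝ (EuclideanSpace ℝ (Fin n))) = E.count x}

/-- Half of the minimal distance between two different components of invariant subspaces
(`⊤` if there are no two different components). -/
def eps0 {n : ℕ} (η : Fin n → ℝ) : ℝ≥0∞ :=
  ⨅ (l : ℕ) (_ : 1 ≤ l ∧ l < n) (E₁ ∈ weightSets η l) (E₂ ∈ weightSets η l) (_ : E₁ ≠ E₂)
    (V₁ ∈ invGr η l E₁) (V₂ ∈ invGr η l E₂), dGr V₁ V₂ / 2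

/-! ### Category flows -/

/-- Objects of `I_l^*`: multisets, and the null object `*`, which is `none`. -/
abbrev StarObj : Type := Option (Multiset ℝ)

/-- The two types of arrows of `I_l^*`. -/
inductive ArrowType
  | transition
  | null

/-- `a → b` is an arrow of the given type in `I_l^*`. A transition arrow exists between comparable
multisets; a null arrow exists between any two objects, except that for `l = 0, n` the only arrow
is the identity (transition) arrow. Arrows are determined by source, target and type. -/
def IsArrow (n l : ℕ) : StarObj → ArrowType → StarObj → Prop
  | some E, .transition, some E' => Dominated E E'
  | none, .transition, _ => False
  | some _, .transition, none => False
  | _, .null, _ => 0 < l ∧ l < n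

/-- The arrow is an identity: the transition arrow from a multiset to itself, or the null arrow
from `*` to itself. -/
def IsIdArrow : StarObj → ArrowType → StarObj → Prop
  | some E, .transition, some E' => E = E'
  | none, .null, none => True
  | _, _, _ => False

/-- A direction filtration `∅ = E_0 ⊂ E_{l_1} ⊂ … ⊂ E_{l_k} = Eall` with `E_{l_i} ∈ I_{l_i}`,
extended by `*` at the other indices (only the indices `l ≤ n` matter). -/
def IsDirectionFiltration {n : ℕ} (η : Fin n → ℝ) (E : ℕ → StarObj) : Prop :=
  E 0 = some 0 ∧ E n = some (Eall η) ∧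
  (∀ l ≤ n, ∀ S, E l = some S → S ∈ weightSets η l) ∧
  ∀ l l', l ≤ l' → l' ≤ n → ∀ S S', E l = some S → E l' = some S' → S ≤ S'

/-- The second difference `∂² a_l` (used for `1 ≤ l`). -/
def secondDiff (a : ℕ → ℝ) (l : ℕ) : ℝ := a (l - 1) - 2 * a l + a (l + 1)

/-- A height sequence `0 = a_0, a_1, …, a_n = 0` (only the indices `l ≤ n` matter). -/
def IsHeightSequence (n : ℕ) (a : ℕ → ℝ) : Prop :=
  a 0 = 0 ∧ a n = 0 ∧ ∀ l, 1 ≤ l → l < n → 0 ≤ secondDiff a l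

/-- A category flow on `ℝ` with values in `I_•^*`. For every time `t` and index `l ≤ n` it records
the one-sided limits and the arrow between them. The arrow is an identity at regular times, at
which `obj` is the value of the flow; at irregular times `obj` has no meaning. -/
structure CategoryFlow {n : ℕ} (η : Fin n → ℝ) where
  /-- the value `f_{E,l}(t)` at regular times -/
  obj : ℝ → ℕ → StarObj
  /-- the limit from the left -/
  left : ℝ → ℕ → StarObj
  /-- the limit from the right -/
  right : ℝ → ℕ → StarObj
  /-- the type of the arrow from the left limit to the right limit -/
  arrow : ℝ → ℕ → ArrowType
  isArrow : ∀ t, ∀ l ≤ n, IsArrow n l (left t l) (arrow t l) (right t l)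
  eventually_left : ∀ t, ∀ l ≤ n, ∀ᶠ s in 𝓝[<] t,
    IsIdArrow (left s l) (arrow s l) (right s l) ∧ obj s l = left t l
  eventually_right : ∀ t, ∀ l ≤ n, ∀ᶠ s in 𝓝[>] t,
    IsIdArrow (left s l) (arrow s l) (right s l) ∧ obj s l = right t l
  obj_eq : ∀ t, ∀ l ≤ n, IsIdArrow (left t l) (arrow t l) (right t l) → obj t l = left t l
  isDirectionFiltration : ∀ t, (∀ l ≤ n, IsIdArrow (left t l) (arrow t l) (right t l)) →
    IsDirectionFiltration η (obj t)

namespace CategoryFlow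

variable {n : ℕ} {η : Fin n → ℝ}

/-- `t` is a regular point of the `l`-th entry of the flow. -/
def RegularAt (f : CategoryFlow η) (t : ℝ) (l : ℕ) : Prop :=
  IsIdArrow (f.left t l) (f.arrow t l) (f.right t l)

/-- `t` is a null point of the `l`-th entry: an irregular point with a null arrow, or a regular
point at which the value is `*`. -/
def NullAt (f : CategoryFlow η) (t : ℝ) (l : ℕ) : Prop :=
  (¬ f.RegularAt t l ∧ f.arrow t l = .null) ∨ (f.RegularAt t l ∧ f.obj t l = none)

end CategoryFlow

/-- A `g`-template on `ℝ`. -/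
structure Template {n : ℕ} (η : Fin n → ℝ) where
  /-- the category flow `f_{E,•}` -/
  flow : CategoryFlow η
  /-- the heights `f_{H,l}(t)`, for `l ≤ n` -/
  height : ℝ → ℕ → ℝ
  isHeightSequence : ∀ t, IsHeightSequence n (height t)
  continuous_height : ∀ l ≤ n, Continuous fun t => height t l
  /-- The nontrivial places of the heights are the nontrivial indices of the flow. At regular
  times this says that the direction filtration and the heights have the same index set. -/
  compatible : ∀ t l, 1 ≤ l → l < n → (0 < secondDiff (height t) l ↔ ¬ flow.NullAt t l)
  hasDerivAt : ∀ t l, 1 ≤ l → l < n → flow.RegularAt t l → ∀ E : Multiset ℝ,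
    flow.obj t l = some E → HasDerivAt (fun s => height s l) E.sum t

/-! ### Matching -/

/-- The lattice `Λ` `(ε, C)`-matches the template `f` on `ℝ`. -/
def Matches {n : ℕ} (η : Fin n → ℝ) (ε C : ℝ) (Λ : Submodule ℤ (EuclideanSpace ℝ (Fin n)))
    (f : Template η) : Prop :=
  (∀ (t : ℝ) (l : ℕ), 1 ≤ l → l < n → |hnHeight (flowLattice η t Λ) l - f.height t l| < C) ∧
  ∀ (l : ℕ), 1 ≤ l → l < n → ∀ (E : Multiset ℝ) (a b : ℝ),
    (∀ t ∈ Set.Icc a b, f.flow.RegularAt t l ∧ f.flow.obj t l = some E ∧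
      C ≤ secondDiff (f.height t) l) →
    ∀ t ∈ Set.Icc (a + C) (b - C),
      ∃ Γ : Submodule ℤ (EuclideanSpace ℝ (Fin n)),
        IsHN (flowLattice η t Λ) Γ ∧ Module.finrank ℤ Γ = l ∧
        ∃ V ∈ nhd ε (invGr η l E),
          V.1 = Submodule.span ℝ (Γ : Set (EuclideanSpace ℝ (Fin n)))

end GTemplate

end

/-! For a primitive subgroup Γ of Λ put ψ_Γ(t) = log cov(g_t Γ), and let P(t) be the orthogonal
projection to the span of g_t Γ. Then ψ_Γ' = tr(diag(η) P), called the slope, and the slope has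
derivative Σ (η_i - η_j)² P_ij² ≥ 0 (`hasDerivAt_log_det_gram`, `IsFlowProj.hasDerivAt_slope`). So
ψ_Γ is convex with uniformly bounded slope, and the off-diagonal sum, which measures how far the
span is from being invariant, has bounded total integral. At each time it is moreover at most a
constant times the growth of the slope over the next unit of time (`IsFlowProj.offBlock_le`). Where
it is small, the mass of P at each weight is nearly an integer, and rounding yields a multiset of
weights, the type. Its sum approximates the slope; types increase with Γ for inclusion and with t
for ≼.

Time is cut into windows of a fixed length, and each window gets one sample time. Replacing the
slope in a window by the sum of the type at the sample time, and integrating, gives a piecewise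
linear function φ_Γ. The error of the slope is bounded by increments of a monotone bounded function,
so |φ_Γ - ψ_Γ| is bounded uniformly in Γ, Λ and t (`FlowSystem.abs_φ_sub_ψ_le`).

The heights of the template are the lower convex hull of the points (rk Γ, φ_Γ + corr(rk Γ)), where
corr is a large multiple of the concave function r(n - r). By submodularity of covolumes
(`cov_submodular`) and strict concavity of corr, the subgroups lying near this hull form a chain, so
there is at most one in each rank (`FlowSystem.IsRelevant.le`). Consequently at most n + 1 subgroups
matter in a window, and by pigeonhole the sample time can be chosen so that the slopes of all of
them hardly grow there; their types then have the right cardinality and are nested. The vertex of a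
given rank cannot change during nearby times, so at a vertex the height is locally φ_Γ of one fixed
Γ plus a constant, with slope the sum of its type. This gives the template.

Matching: φ and the bounded correction change the heights only boundedly. If ∂² is large at l, the
vertex is strictly below a line through all other points, hence a member of the Harder-Narasimhan
filtration. If its type is E both before and after t, the slope is squeezed near the sum of E, so
the off-diagonal sum is small at t, the type at t is E by antisymmetry of ≼, and compactness of the
set of projection matrices puts the span near an invariant subspace of type E
(`exists_mem_nhd_invGr`). -/

open scoped ENNReal Topology

noncomputable section

namespace GTemplate

open Matrix

/-! ### The flow on projection matrices -/

section FlowMatrix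

set_option linter.unusedSectionVars false

variable {n : ℕ} {κ : Type*} [Fintype κ] [DecidableEq κ]

/-- The derivative of the determinant of a matrix valued function. -/
theorem hasDerivAt_det {A : ℝ → Matrix κ κ ℝ} {A' : Matrix κ κ ℝ} {t : ℝ}
    (hA : ∀ i j, HasDerivAt (fun s => A s i j) (A' i j) t) :
    HasDerivAt (fun s => (A s).det) ((adjugate (A t) * A').trace) t := by
  have h1 : HasDerivAt (fun s => (A s).det)
      (∑ σ : Equiv.Perm κ, ((Equiv.Perm.sign σ : ℤ) : ℝ) *
        ∑ i, (∏ j ∈ Finset.univ.erase i, A t (σ j) j) • A' (σ i) i) t := by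
    simp only [det_apply']
    refine HasDerivAt.fun_sum fun σ _ => ?_
    refine HasDerivAt.const_mul _ ?_
    exact HasDerivAt.fun_finsetProd fun i _ => hA _ _
  convert h1 using 1
  have h2 : ∀ i, (adjugate (A t) * A') i i =
      ∑ σ : Equiv.Perm κ, ((Equiv.Perm.sign σ : ℤ) : ℝ) *
        ((∏ j ∈ Finset.univ.erase i, A t (σ j) j) • A' (σ i) i) := by
    intro i
    -- Cramer's rule: the diagonal entry is the determinant of A with its i-th column replaced by
    -- that of A', which is the i-th term of the Leibniz expansion of the derivative.
    have h3 : (adjugate (A t) * A') i i = ((A t).updateCol i fun k => A' k i).det := by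
      rw [← cramer_apply, cramer_eq_adjugate_mulVec]
      rfl
    rw [h3, det_apply']
    refine Finset.sum_congr rfl fun σ _ => ?_
    rw [← Finset.mul_prod_erase Finset.univ _ (Finset.mem_univ i)]
    rw [updateCol_self, smul_eq_mul, mul_comm (A' _ _)]
    congr 2
    refine Finset.prod_congr rfl fun j hj => ?_
    rw [updateCol_ne (Finset.ne_of_mem_erase hj)]
  rw [trace]
  simp only [diag_apply, h2]
  rw [Finset.sum_comm]
  simp only [Finset.mul_sum]

/-- The derivative of the inverse of a matrix valued function. -/
theorem hasDerivAt_inv {A : ℝ → Matrix κ κ ℝ} {A' : Matrix κ κ ℝ} {t : ℝ}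
    (hA : ∀ i j, HasDerivAt (fun s => A s i j) (A' i j) t) (hu : (A t).det ≠ 0) (i j : κ) :
    HasDerivAt (fun s => (A s)⁻¹ i j) ((-((A t)⁻¹ * A' * (A t)⁻¹)) i j) t := by
  have hdet := hasDerivAt_det hA
  have hadj : ∀ i j, ∃ d, HasDerivAt (fun s => adjugate (A s) i j) d t := by
    intro i j
    simp only [adjugate_apply]
    refine ⟨_, hasDerivAt_det (A' := updateRow A' j 0) fun a b => ?_⟩
    by_cases h : a = j
    · subst h
      simpa using hasDerivAt_const t _
    · simpa [updateRow_ne h] using hA a b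
  -- The formula adj / det only serves to show that some derivative exists; its value then comes
  -- from differentiating A⁻¹ A = 1, valid near t.
  have hinv : ∀ i j, ∃ d, HasDerivAt (fun s => (A s)⁻¹ i j) d t := by
    intro i j
    obtain ⟨d, hd⟩ := hadj i j
    refine ⟨_, ((hdet.inv hu).mul hd).congr_of_eventuallyEq ?_⟩
    refine Filter.Eventually.of_forall fun s => ?_
    simp [inv_def, Ring.inverse_eq_inv']
  choose X hX using hinv
  have hX' : (of X : Matrix κ κ ℝ) * A t + (A t)⁻¹ * A' = 0 := by
    ext a b
    have h1 := HasDerivAt.fun_sum (u := Finset.univ) fun c _ => (hX a c).mul (hA c b)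
    have h2 : HasDerivAt (fun s => ∑ c, (A s)⁻¹ a c * A s c b) 0 t := by
      refine (hasDerivAt_const t ((1 : Matrix κ κ ℝ) a b)).congr_of_eventuallyEq ?_
      filter_upwards [hdet.continuousAt.eventually_ne hu] with s hs
      rw [← mul_apply, nonsing_inv_mul _ hs.isUnit]
    have h3 := h1.unique h2
    rw [Finset.sum_add_distrib] at h3
    exact h3
  have hX2 : (of X : Matrix κ κ ℝ) = -((A t)⁻¹ * A' * (A t)⁻¹) := by
    calc (of X : Matrix κ κ ℝ) = of X * A t * (A t)⁻¹ := by
          rw [Matrix.mul_assoc, mul_nonsing_inv _ hu.isUnit, Matrix.mul_one]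
      _ = _ := by rw [eq_neg_of_add_eq_zero_left hX', neg_mul]
  rw [← hX2]
  exact hX i j

/-- The matrix `g_t B`. -/
def flowMat (η : Fin n → ℝ) (B : Matrix (Fin n) κ ℝ) (t : ℝ) : Matrix (Fin n) κ ℝ :=
  diagonal (fun i => Real.exp (t * η i)) * B

/-- The matrix of the orthogonal projection to the column space. -/
def colProj (M : Matrix (Fin n) κ ℝ) : Matrix (Fin n) (Fin n) ℝ :=
  M * (Mᵀ * M)⁻¹ * Mᵀ

theorem gram_posDef {M : Matrix (Fin n) κ ℝ} (hM : Function.Injective M.mulVec) :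
    (Mᵀ * M).PosDef := by
  have := PosDef.conjTranspose_mul_self M hM
  rwa [conjTranspose_eq_transpose_of_trivial] at this

theorem flowMat_injective (η : Fin n → ℝ) {B : Matrix (Fin n) κ ℝ}
    (hB : Function.Injective B.mulVec) (t : ℝ) : Function.Injective (flowMat η B t).mulVec := by
  intro x y hxy
  apply hB
  simp only [flowMat, ← mulVec_mulVec] at hxy
  ext i
  have := congrFun hxy i
  simp only [mulVec_diagonal] at this
  exact mul_left_cancel₀ (Real.exp_pos _).ne' this

theorem colProj_mul_self {M : Matrix (Fin n) κ ℝ} (hM : Function.Injective M.mulVec) :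
    colProj M * colProj M = colProj M := by
  have h := (gram_posDef hM).isUnit
  rw [isUnit_iff_isUnit_det] at h
  calc colProj M * colProj M = M * ((Mᵀ * M)⁻¹ * (Mᵀ * M)) * (Mᵀ * M)⁻¹ * Mᵀ := by
        simp only [colProj, Matrix.mul_assoc]
    _ = colProj M := by rw [nonsing_inv_mul _ h, Matrix.mul_one, colProj]

theorem colProj_transpose (M : Matrix (Fin n) κ ℝ) : (colProj M)ᵀ = colProj M := by
  simp [colProj, transpose_mul, transpose_nonsing_inv, Matrix.mul_assoc]

theorem colProj_mul {M : Matrix (Fin n) κ ℝ} (hM : Function.Injective M.mulVec) :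
    colProj M * M = M := by
  have h := (gram_posDef hM).isUnit
  rw [isUnit_iff_isUnit_det] at h
  rw [colProj, Matrix.mul_assoc, Matrix.mul_assoc, nonsing_inv_mul _ h, Matrix.mul_one]

theorem hasDerivAt_gram (η : Fin n → ℝ) (B : Matrix (Fin n) κ ℝ) (t : ℝ) (a b : κ) :
    HasDerivAt (fun s => ((flowMat η B s)ᵀ * flowMat η B s) a b)
      (((2 : ℝ) • ((flowMat η B t)ᵀ * diagonal η * flowMat η B t) : Matrix κ κ ℝ) a b) t := by
  have h1 : ∀ s, ((flowMat η B s)ᵀ * flowMat η B s) a b =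
      ∑ i, Real.exp (s * η i) * B i a * (Real.exp (s * η i) * B i b) := by
    intro s
    rw [mul_apply]
    simp only [flowMat, transpose_apply, diagonal_mul]
  simp only [h1]
  have h2 : ((2 : ℝ) • ((flowMat η B t)ᵀ * diagonal η * flowMat η B t) : Matrix κ κ ℝ) a b =
      ∑ i, ((Real.exp (t * η i) * η i) * B i a * (Real.exp (t * η i) * B i b) +
        Real.exp (t * η i) * B i a * ((Real.exp (t * η i) * η i) * B i b)) := by
    rw [Matrix.smul_apply, Matrix.mul_assoc, mul_apply, Finset.smul_sum]
    refine Finset.sum_congr rfl fun i _ => ?_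
    simp [flowMat, diagonal_mul]
    ring
  rw [h2]
  refine HasDerivAt.fun_sum fun i _ => ?_
  have h3 : HasDerivAt (fun s => Real.exp (s * η i)) (Real.exp (t * η i) * η i) t := by
    simpa using ((hasDerivAt_id t).mul_const (η i)).exp
  exact (h3.mul_const _).mul (h3.mul_const _)

/-- Jacobi's formula for the Gram matrix G = MᵀM with G' = 2 Mᵀ diag(η) M; cyclicity of the trace
turns tr(G⁻¹ G')/2 into tr(diag(η) P). This is the first derivative of a logarithmic covolume. -/
theorem hasDerivAt_log_det_gram (η : Fin n → ℝ) {B : Matrix (Fin n) κ ℝ}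
    (hB : Function.Injective B.mulVec) (t : ℝ) :
    HasDerivAt (fun s => Real.log ((flowMat η B s)ᵀ * flowMat η B s).det / 2)
      (∑ i, η i * colProj (flowMat η B t) i i) t := by
  have hM := flowMat_injective η hB t
  have h := hasDerivAt_det (hasDerivAt_gram η B t)
  have hd := (gram_posDef hM).det_pos
  have h2 := (h.log hd.ne').div_const 2
  refine h2.congr_deriv ?_
  set M := flowMat η B t
  have hu : IsUnit (Mᵀ * M).det := hd.ne'.isUnit
  have h3 : adjugate (Mᵀ * M) = (Mᵀ * M).det • (Mᵀ * M)⁻¹ := by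
    rw [inv_def, smul_smul, Ring.mul_inverse_cancel _ hu, one_smul]
  rw [h3, Matrix.smul_mul, trace_smul, Matrix.mul_smul, trace_smul]
  have h4 : ((Mᵀ * M)⁻¹ * (Mᵀ * diagonal η * M)).trace = ∑ i, η i * colProj M i i := by
    calc _ = (((Mᵀ * M)⁻¹ * Mᵀ) * (diagonal η * M)).trace := by simp only [Matrix.mul_assoc]
      _ = (diagonal η * colProj M).trace := by
        rw [trace_mul_comm]; simp only [colProj, Matrix.mul_assoc]
      _ = _ := by simp [trace, diagonal_mul]
  rw [h4]
  simp only [smul_eq_mul]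
  field_simp

/-- The Riccati equation P' = ηP + Pη - 2PηP, from the product rule for M G⁻¹ Mᵀ with M' = ηM. All
later statements about moving subspaces use only this equation. -/
theorem hasDerivAt_colProj (η : Fin n → ℝ) {B : Matrix (Fin n) κ ℝ}
    (hB : Function.Injective B.mulVec) (t : ℝ) (i j : Fin n) :
    HasDerivAt (fun s => colProj (flowMat η B s) i j)
      ((η i + η j) * colProj (flowMat η B t) i j -
        2 * ∑ k, η k * colProj (flowMat η B t) i k * colProj (flowMat η B t) k j) t := by
  have hM := flowMat_injective η hB t
  have hinv := hasDerivAt_inv (hasDerivAt_gram η B t) (gram_posDef hM).det_pos.ne'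
  have h1 : ∀ s, colProj (flowMat η B s) i j =
      ∑ b, (∑ a, Real.exp (s * η i) * B i a * ((flowMat η B s)ᵀ * flowMat η B s)⁻¹ a b) *
        (Real.exp (s * η j) * B j b) := by
    intro s
    rw [colProj, mul_apply]
    refine Finset.sum_congr rfl fun b _ => ?_
    rw [mul_apply]
    simp only [flowMat, diagonal_mul, transpose_apply]
  simp only [h1]
  have h3 : ∀ i, HasDerivAt (fun s => Real.exp (s * η i)) (Real.exp (t * η i) * η i) t := by
    intro i
    simpa using ((hasDerivAt_id t).mul_const (η i)).exp
  have h4 := HasDerivAt.fun_sum (u := Finset.univ) fun b _ =>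
    (HasDerivAt.fun_sum (u := Finset.univ) fun a _ =>
      ((h3 i).mul_const (B i a)).mul (hinv a b)).mul ((h3 j).mul_const (B j b))
  refine h4.congr_deriv ?_
  symm
  set M := flowMat η B t with hMdef
  have hMe : ∀ i a, Real.exp (t * η i) * B i a = M i a := by
    intro i a; simp [hMdef, flowMat, diagonal_mul]
  have hMe' : ∀ i a, Real.exp (t * η i) * η i * B i a = η i * M i a := by
    intro i a; rw [← hMe]; ring
  simp only [Pi.mul_apply, hMe, hMe']
  have h5 : ∑ k, η k * colProj M i k * colProj M k j = (colProj M * diagonal η * colProj M) i j := by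
    rw [mul_apply]
    refine Finset.sum_congr rfl fun k _ => ?_
    rw [mul_diagonal]; ring
  have h6 : colProj M * diagonal η * colProj M =
      M * ((Mᵀ * M)⁻¹ * (Mᵀ * diagonal η * M) * (Mᵀ * M)⁻¹) * Mᵀ := by
    simp only [colProj, Matrix.mul_assoc]
  have h7 : ∀ N : Matrix κ κ ℝ, (M * N * Mᵀ) i j = ∑ b, (∑ a, M i a * N a b) * M j b := by
    intro N
    simp only [mul_apply, transpose_apply]
  rw [h5, h6, h7]
  rw [Finset.mul_sum, Finset.mul_sum, ← Finset.sum_sub_distrib]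
  refine Finset.sum_congr rfl fun b _ => ?_
  simp only [Matrix.mul_smul, Matrix.smul_mul, Matrix.smul_apply, smul_eq_mul, mul_neg,
    Finset.sum_add_distrib, Finset.sum_neg_distrib, add_mul, neg_mul, mul_assoc,
    ← Finset.mul_sum, Matrix.neg_apply, mul_left_comm _ (2 : ℝ)]
  ring

end FlowMatrix

end GTemplate

namespace GTemplate

open Matrix

/-! ### Traces of blocks of projection matrices -/

section Rounding

theorem trace_mul_self_eq_sum_eigenvalues {ι : Type*} [Fintype ι] [DecidableEq ι]
    {A : Matrix ι ι ℝ} (hA : A.IsHermitian) : (A * A).trace = ∑ i, hA.eigenvalues i ^ 2 := by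
  conv_lhs => rw [hA.spectral_theorem]
  rw [← map_mul, Unitary.conjStarAlgAut_apply, trace_mul_cycle, Unitary.coe_star_mul_self, one_mul,
    diagonal_mul_diagonal, trace_diagonal]
  refine Finset.sum_congr rfl fun i _ => ?_
  simp [sq]

/-- The hypothesis forces x into [0, 1], where the distance to the nearer endpoint is at most 2x(1 -
x), the other factor being at least 1/2. -/
theorem abs_sub_round_le_two_mul {x : ℝ} (h : 0 ≤ x - x ^ 2) :
    |x - round x| ≤ 2 * (x - x ^ 2) := by
  have h0 : 0 ≤ x := by nlinarith
  have h1 : x ≤ 1 := by nlinarith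
  rcases le_total x (1 / 2) with h2 | h2
  · have := round_le x 0
    rw [Int.cast_zero, sub_zero, abs_of_nonneg h0] at this
    nlinarith
  · have := round_le x 1
    rw [Int.cast_one, abs_sub_comm x 1, abs_of_nonneg (sub_nonneg.2 h1)] at this
    nlinarith

/-- The trace of a diagonal block of a projection matrix is close to an integer if the
corresponding off-diagonal block is small. -/
theorem abs_blockTrace_sub_round_le {n : ℕ} {P : Matrix (Fin n) (Fin n) ℝ} (h1 : P * P = P)
    (h2 : Pᵀ = P) (s : Finset (Fin n)) :
    |(∑ i ∈ s, P i i) - round (∑ i ∈ s, P i i)| ≤ 2 * ∑ i ∈ s, ∑ j ∈ sᶜ, P i j ^ 2 := by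
  classical
  have hsymm : ∀ i j, P i j = P j i := fun i j => congrFun (congrFun h2 j) i
  have hPP : ∀ i j, P i j = ∑ k, P i k * P k j := by
    intro i j
    conv_lhs => rw [← h1]
    rw [mul_apply]
  let A : Matrix s s ℝ := P.submatrix (↑) (↑)
  let B : Matrix s (sᶜ : Finset (Fin n)) ℝ := P.submatrix (↑) (↑)
  have hA : A.IsHermitian := by
    ext i j
    simp only [A, conjTranspose_apply, submatrix_apply, star_trivial]
    exact hsymm _ _
  -- The diagonal block of the identity P = P². It shows that every eigenvalue λ of A has λ - λ² ≥ 0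
  -- and that these defects add up to the squared norm of the off-diagonal block.
  have hAB : A - A * A = B * Bᴴ := by
    ext i j
    simp only [Matrix.sub_apply, mul_apply, A, B, conjTranspose_apply, submatrix_apply, star_trivial]
    rw [hPP, Finset.sum_coe_sort s (fun k => P i k * P k j),
      Finset.sum_coe_sort sᶜ (fun k => P i k * P j k), ← Finset.sum_add_sum_compl s]
    simp only [hsymm j]
    ring
  have hlam : ∀ a, 0 ≤ hA.eigenvalues a - hA.eigenvalues a ^ 2 := by
    intro a
    have hps := posSemidef_self_mul_conjTranspose B
    rw [← hAB] at hps
    set v : s → ℝ := (hA.eigenvectorBasis a).ofLp with hv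
    have hev : A *ᵥ v = hA.eigenvalues a • v := hA.mulVec_eigenvectorBasis a
    have h3 := hps.dotProduct_mulVec_nonneg v
    have h4 : (A - A * A) *ᵥ v = (hA.eigenvalues a - hA.eigenvalues a ^ 2) • v := by
      rw [sub_mulVec, ← mulVec_mulVec, hev, mulVec_smul, hev, smul_smul, sub_smul, sq]
    rw [h4, dotProduct_smul, smul_eq_mul] at h3
    have h5 : 0 < star v ⬝ᵥ v := by
      rw [dotProduct_star_self_pos_iff]
      intro h0
      have := hA.eigenvectorBasis.orthonormal.ne_zero a
      apply this
      ext i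
      exact congrFun h0 i
    exact nonneg_of_mul_nonneg_left h3 h5
  have htr : ∑ i ∈ s, P i i = ∑ a, hA.eigenvalues a := by
    have h3 := hA.trace_eq_sum_eigenvalues
    simp only [RCLike.ofReal_real_eq_id, id] at h3
    rw [← h3, trace]
    exact (Finset.sum_coe_sort s fun i => P i i).symm
  have hoff : ∑ i ∈ s, ∑ j ∈ sᶜ, P i j ^ 2 =
      ∑ a, (hA.eigenvalues a - hA.eigenvalues a ^ 2) := by
    rw [Finset.sum_sub_distrib, ← htr, ← trace_mul_self_eq_sum_eigenvalues hA]
    have h3 : (A - A * A).trace = (B * Bᴴ).trace := by rw [hAB]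
    have h4 : A.trace = ∑ i ∈ s, P i i := Finset.sum_coe_sort s fun i => P i i
    rw [trace_sub, h4] at h3
    rw [h3, trace]
    rw [← Finset.sum_coe_sort s]
    refine Finset.sum_congr rfl fun i _ => ?_
    rw [← Finset.sum_coe_sort sᶜ, diag_apply, mul_apply]
    refine Finset.sum_congr rfl fun j _ => ?_
    simp [B, sq]
  rw [hoff]
  -- The nearest integer to the trace is at least as near as the sum of the rounded eigenvalues,
  -- which reduces the claim to single eigenvalues.
  calc _ ≤ |(∑ i ∈ s, P i i) - ((∑ a, round (hA.eigenvalues a) : ℤ) : ℝ)| := round_le _ _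
    _ = |∑ a, (hA.eigenvalues a - round (hA.eigenvalues a))| := by
        rw [htr, Finset.sum_sub_distrib]; push_cast; rfl
    _ ≤ ∑ a, |hA.eigenvalues a - round (hA.eigenvalues a)| := Finset.abs_sum_le_sum_abs _ _
    _ ≤ ∑ a, 2 * (hA.eigenvalues a - hA.eigenvalues a ^ 2) :=
        Finset.sum_le_sum fun a _ => abs_sub_round_le_two_mul (hlam a)
    _ = _ := by rw [Finset.mul_sum]

end Rounding

/-! ### The type of a projection matrix -/

section ProjType

variable {n : ℕ} (η : Fin n → ℝ)

/-- The matrix of an orthogonal projection. -/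
structure IsProjMat (P : Matrix (Fin n) (Fin n) ℝ) : Prop where
  mul_self : P * P = P
  transpose : Pᵀ = P

variable {η} in
theorem IsProjMat.symm {P : Matrix (Fin n) (Fin n) ℝ} (h : IsProjMat P) (i j : Fin n) :
    P i j = P j i := congrFun (congrFun h.transpose j) i

theorem IsProjMat.apply {P : Matrix (Fin n) (Fin n) ℝ} (h : IsProjMat P) (i j : Fin n) :
    P i j = ∑ k, P i k * P k j := by
  conv_lhs => rw [← h.mul_self]
  rw [mul_apply]

theorem IsProjMat.diag_eq {P : Matrix (Fin n) (Fin n) ℝ} (h : IsProjMat P) (i : Fin n) :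
    P i i = ∑ k, P i k ^ 2 := by
  rw [h.apply]
  refine Finset.sum_congr rfl fun k _ => ?_
  rw [h.symm k i, sq]

theorem IsProjMat.diag_nonneg {P : Matrix (Fin n) (Fin n) ℝ} (h : IsProjMat P) (i : Fin n) :
    0 ≤ P i i := by
  rw [h.diag_eq]; positivity

theorem IsProjMat.sq_le_diag {P : Matrix (Fin n) (Fin n) ℝ} (h : IsProjMat P) (i j : Fin n) :
    P i j ^ 2 ≤ P i i := by
  rw [h.diag_eq i]
  exact Finset.single_le_sum (f := fun k => P i k ^ 2) (fun k _ => sq_nonneg _) (Finset.mem_univ j)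

theorem IsProjMat.diag_le_one {P : Matrix (Fin n) (Fin n) ℝ} (h : IsProjMat P) (i : Fin n) :
    P i i ≤ 1 := by
  nlinarith [h.sq_le_diag i i]

theorem IsProjMat.abs_le_one {P : Matrix (Fin n) (Fin n) ℝ} (h : IsProjMat P) (i j : Fin n) :
    |P i j| ≤ 1 := by
  rw [← sq_le_one_iff_abs_le_one]
  exact (h.sq_le_diag i j).trans (h.diag_le_one i)

/-- The mass of the diagonal at the weight `x`. -/
def massAt (P : Matrix (Fin n) (Fin n) ℝ) (x : ℝ) : ℝ :=
  ∑ i with η i = x, P i i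

/-- The weighted size of the off-diagonal blocks. -/
def offBlock (P : Matrix (Fin n) (Fin n) ℝ) : ℝ :=
  ∑ i, ∑ j, (η i - η j) ^ 2 * P i j ^ 2

/-- The multiset of weights obtained by rounding the masses. -/
def projType (P : Matrix (Fin n) (Fin n) ℝ) : Multiset ℝ :=
  ∑ x ∈ Finset.univ.image η, Multiset.replicate (round (massAt η P x)).toNat x

theorem offBlock_nonneg (P : Matrix (Fin n) (Fin n) ℝ) : 0 ≤ offBlock η P :=
  Finset.sum_nonneg fun _ _ => Finset.sum_nonneg fun _ _ => by positivity

theorem massAt_eq_zero (P : Matrix (Fin n) (Fin n) ℝ) {x : ℝ}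
    (hx : x ∉ Finset.univ.image η) : massAt η P x = 0 := by
  refine Finset.sum_eq_zero fun i hi => ?_
  simp only [Finset.mem_filter, Finset.mem_univ, true_and] at hi
  exact absurd (Finset.mem_image.2 ⟨i, Finset.mem_univ _, hi⟩) hx

theorem count_projType (P : Matrix (Fin n) (Fin n) ℝ) (x : ℝ) :
    (projType η P).count x = (round (massAt η P x)).toNat := by
  rw [projType, Multiset.count_sum']
  simp only [Multiset.count_replicate]
  by_cases hx : x ∈ Finset.univ.image η
  · rw [Finset.sum_eq_single_of_mem x hx]
    · simp
    · intro y _ hy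
      rw [if_neg hy]
  · rw [massAt_eq_zero η P hx, Finset.sum_eq_zero]
    · simp
    · intro y hy
      rw [if_neg]
      rintro rfl
      exact hx hy

variable {η}

theorem massAt_nonneg {P : Matrix (Fin n) (Fin n) ℝ} (hP : IsProjMat P) (x : ℝ) :
    0 ≤ massAt η P x := Finset.sum_nonneg fun i _ => hP.diag_nonneg i

theorem round_massAt_nonneg {P : Matrix (Fin n) (Fin n) ℝ} (hP : IsProjMat P) (x : ℝ) :
    0 ≤ round (massAt η P x) := by
  rw [round_eq]
  exact Int.floor_nonneg.2 (by have := massAt_nonneg (η := η) hP x; linarith)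

theorem cast_count_projType {P : Matrix (Fin n) (Fin n) ℝ} (hP : IsProjMat P) (x : ℝ) :
    ((projType η P).count x : ℝ) = (round (massAt η P x) : ℝ) := by
  rw [count_projType, ← Int.cast_natCast, Int.toNat_of_nonneg (round_massAt_nonneg hP x)]

theorem round_mono {x y : ℝ} (h : x ≤ y) : round x ≤ round y := by
  rw [round_eq, round_eq]
  exact Int.floor_mono (by linarith)

/-- Rounding is monotone, so only diagonal entries need to be compared. For nested subspaces this
makes the types nested, with no smallness assumption. -/
theorem projType_mono {P Q : Matrix (Fin n) (Fin n) ℝ} (h : ∀ i, P i i ≤ Q i i) :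
    projType η P ≤ projType η Q := by
  rw [Multiset.le_iff_count]
  intro x
  rw [count_projType, count_projType]
  exact Int.toNat_le_toNat (round_mono (Finset.sum_le_sum fun i _ => h i))

theorem projType_one : projType η (1 : Matrix (Fin n) (Fin n) ℝ) = Eall η := by
  ext x
  rw [count_projType, Eall, Multiset.count_map, massAt]
  simp only [one_apply_eq, Finset.sum_const, nsmul_eq_mul, mul_one, round_natCast, Int.toNat_natCast]
  rw [← Finset.filter_val, Finset.card]
  simp only [eq_comm]

theorem projType_zero : projType η (0 : Matrix (Fin n) (Fin n) ℝ) = 0 := by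
  ext x
  simp [count_projType, massAt]

theorem projType_le_Eall {P : Matrix (Fin n) (Fin n) ℝ} (hP : IsProjMat P) :
    projType η P ≤ Eall η := by
  rw [← projType_one]
  exact projType_mono fun i => by simpa using hP.diag_le_one i

/-- The total rounding error is controlled by the off-diagonal blocks. -/
theorem sum_abs_massAt_sub_count_le {g : ℝ} (hg : 0 < g)
    (hgap : ∀ i j, η i ≠ η j → g ≤ |η i - η j|) {P : Matrix (Fin n) (Fin n) ℝ}
    (hP : IsProjMat P) :
    ∑ x ∈ Finset.univ.image η, |massAt η P x - (projType η P).count x| ≤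
      2 / g ^ 2 * offBlock η P := by
  have h1 : ∀ x ∈ Finset.univ.image η, |massAt η P x - (projType η P).count x| ≤
      2 / g ^ 2 * ∑ i with η i = x, ∑ j, (η i - η j) ^ 2 * P i j ^ 2 := by
    intro x _
    rw [cast_count_projType hP]
    refine (abs_blockTrace_sub_round_le hP.mul_self hP.transpose _).trans ?_
    rw [div_mul_eq_mul_div, mul_div_assoc]
    refine mul_le_mul_of_nonneg_left ?_ (by norm_num)
    rw [le_div_iff₀ (by positivity), Finset.sum_mul]
    refine Finset.sum_le_sum fun i hi => ?_
    rw [Finset.sum_mul]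
    refine (Finset.sum_le_sum (g := fun j => (η i - η j) ^ 2 * P i j ^ 2) fun j hj => ?_).trans
      (Finset.sum_le_sum_of_subset_of_nonneg (Finset.subset_univ _) fun j _ _ => by positivity)
    simp only [Finset.mem_filter, Finset.mem_univ, true_and, Finset.mem_compl] at hi hj
    have h2 := hgap i j (by rw [hi]; exact fun h => hj h.symm)
    have h3 : g ^ 2 ≤ (η i - η j) ^ 2 := by
      rw [← sq_abs (η i - η j)]; gcongr
    rw [mul_comm]
    gcongr
  refine (Finset.sum_le_sum h1).trans ?_
  rw [← Finset.mul_sum, offBlock, Finset.sum_fiberwise_of_maps_to]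
  intro i hi
  exact Finset.mem_image_of_mem _ hi

theorem sum_massAt (P : Matrix (Fin n) (Fin n) ℝ) (p : ℝ → Prop) [DecidablePred p] (w : ℝ → ℝ) :
    ∑ x ∈ Finset.univ.image η with p x, w x * massAt η P x = ∑ i with p (η i), w (η i) * P i i := by
  classical
  rw [← Finset.sum_fiberwise_of_maps_to (s := Finset.univ.filter fun i => p (η i))
    (t := (Finset.univ.image η).filter p) (g := η)]
  · refine Finset.sum_congr rfl fun x hx => ?_
    rw [massAt, Finset.mul_sum]
    simp only [Finset.mem_filter] at hx
    refine Finset.sum_congr ?_ ?_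
    · ext i
      simp only [Finset.mem_filter, Finset.mem_univ, true_and]
      exact ⟨fun h => ⟨h ▸ hx.2, h⟩, fun h => h.2⟩
    · intro i hi
      simp only [Finset.mem_filter, Finset.mem_univ, true_and] at hi
      rw [hi.2]
  · intro i hi
    simp only [Finset.mem_filter, Finset.mem_univ, true_and] at hi ⊢
    exact ⟨Finset.mem_image_of_mem _ (Finset.mem_univ _), hi⟩

theorem sum_projType (P : Matrix (Fin n) (Fin n) ℝ) :
    (projType η P).sum = ∑ x ∈ Finset.univ.image η, x * ((projType η P).count x : ℝ) := by
  rw [Finset.sum_multiset_count_of_subset _ (Finset.univ.image η)]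
  · simp [mul_comm]
  · intro x hx
    by_contra h
    rw [Multiset.mem_toFinset, ← Multiset.count_pos, count_projType, massAt_eq_zero η P h] at hx
    simp at hx

theorem card_filter_projType (P : Matrix (Fin n) (Fin n) ℝ) (p : ℝ → Prop) [DecidablePred p] :
    (((projType η P).filter p).card : ℝ) =
      ∑ x ∈ Finset.univ.image η with p x, ((projType η P).count x : ℝ) := by
  rw [← Multiset.sum_count_eq_card (s := (Finset.univ.image η).filter p)]
  · push_cast
    refine Finset.sum_congr rfl fun x hx => ?_
    rw [Multiset.count_filter_of_pos (Finset.mem_filter.1 hx).2]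
  · intro x hx
    rw [Multiset.mem_filter] at hx
    refine Finset.mem_filter.2 ⟨?_, hx.2⟩
    by_contra h
    have h1 := hx.1
    rw [← Multiset.count_pos, count_projType, massAt_eq_zero η P h] at h1
    simp at h1

theorem abs_sum_filter_sub_card_le {g : ℝ} (hg : 0 < g)
    (hgap : ∀ i j, η i ≠ η j → g ≤ |η i - η j|) {P : Matrix (Fin n) (Fin n) ℝ}
    (hP : IsProjMat P) (p : ℝ → Prop) [DecidablePred p] :
    |∑ i with p (η i), P i i - (((projType η P).filter p).card : ℝ)| ≤
      2 / g ^ 2 * offBlock η P := by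
  have h := sum_massAt (η := η) P p fun _ => 1
  simp only [one_mul] at h
  rw [← h, card_filter_projType, ← Finset.sum_sub_distrib]
  refine (Finset.abs_sum_le_sum_abs _ _).trans ?_
  refine le_trans ?_ (sum_abs_massAt_sub_count_le hg hgap hP)
  exact Finset.sum_le_sum_of_subset_of_nonneg (Finset.filter_subset _ _) fun _ _ _ => abs_nonneg _

theorem abs_sub_sum_projType_le {g M : ℝ} (hg : 0 < g)
    (hgap : ∀ i j, η i ≠ η j → g ≤ |η i - η j|) (hM : ∀ i, |η i| ≤ M)
    {P : Matrix (Fin n) (Fin n) ℝ} (hP : IsProjMat P) :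
    |∑ i, η i * P i i - (projType η P).sum| ≤ M * (2 / g ^ 2 * offBlock η P) := by
  have h := sum_massAt (η := η) P (fun _ => True) fun x => x
  simp only [Finset.filter_true] at h
  rw [← h, sum_projType, ← Finset.sum_sub_distrib]
  refine (Finset.abs_sum_le_sum_abs _ _).trans ?_
  rcases Nat.eq_zero_or_pos n with rfl | hn
  · simp [offBlock]
  have hM0 : 0 ≤ M := (abs_nonneg _).trans (hM ⟨0, hn⟩)
  refine le_trans ?_ (mul_le_mul_of_nonneg_left (sum_abs_massAt_sub_count_le hg hgap hP) hM0)
  rw [Finset.mul_sum]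
  refine Finset.sum_le_sum fun x hx => ?_
  obtain ⟨i, _, rfl⟩ := Finset.mem_image.1 hx
  rw [← mul_sub, abs_mul]
  exact mul_le_mul_of_nonneg_right (hM i) (abs_nonneg _)

/-- The total mass is the trace, an integer, and the total rounding error is below 1. -/
theorem card_projType {g : ℝ} (hg : 0 < g)
    (hgap : ∀ i j, η i ≠ η j → g ≤ |η i - η j|) {P : Matrix (Fin n) (Fin n) ℝ}
    (hP : IsProjMat P) {l : ℕ} (hl : P.trace = l) (hoff : 2 / g ^ 2 * offBlock η P < 1) :
    (projType η P).card = l := by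
  have h := abs_sum_filter_sub_card_le hg hgap hP fun _ => True
  simp only [Finset.filter_true, Multiset.filter_true] at h
  have h2 : ∑ i, P i i = l := hl
  rw [h2] at h
  have h3 := abs_lt.1 (h.trans_lt hoff)
  have h4 : ((projType η P).card : ℤ) = l := by
    have h5 : ((l : ℤ) : ℝ) - ((projType η P).card : ℤ) < 1 := by push_cast; linarith
    have h6 : -1 < ((l : ℤ) : ℝ) - ((projType η P).card : ℤ) := by push_cast; linarith
    rw [← Int.cast_sub] at h5 h6
    have h7 : (l : ℤ) - (projType η P).card < 1 := by exact_mod_cast h5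
    have h8 : -1 < (l : ℤ) - (projType η P).card := by exact_mod_cast h6
    omega
  exact_mod_cast h4

/-- Each count above r differs from the mass above r by less than 1/2, so the counts are ordered up
to an error below 1, hence ordered. -/
theorem dominated_projType {g : ℝ} (hg : 0 < g)
    (hgap : ∀ i j, η i ≠ η j → g ≤ |η i - η j|) {P Q : Matrix (Fin n) (Fin n) ℝ}
    (hP : IsProjMat P) (hQ : IsProjMat Q)
    (h : ∀ r, ∑ i with r < η i, P i i ≤ ∑ i with r < η i, Q i i)
    (h1 : 2 / g ^ 2 * offBlock η P < 1 / 2) (h2 : 2 / g ^ 2 * offBlock η Q < 1 / 2) :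
    Dominated (projType η P) (projType η Q) := by
  intro r
  have h3 := abs_le.1 (abs_sum_filter_sub_card_le hg hgap hP fun x => r < x)
  have h4 := abs_le.1 (abs_sum_filter_sub_card_le hg hgap hQ fun x => r < x)
  have h5 := h r
  have h6 : (((projType η P).filter fun x => r < x).card : ℝ) <
      ((projType η Q).filter fun x => r < x).card + 1 := by linarith
  have h7 : ((projType η P).filter fun x => r < x).card <
      ((projType η Q).filter fun x => r < x).card + 1 := by exact_mod_cast h6
  omega

theorem exists_gap (η : Fin n → ℝ) : ∃ g : ℝ, 0 < g ∧ ∀ i j, η i ≠ η j → g ≤ |η i - η j| := by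
  classical
  let S := (Finset.univ.filter fun p : Fin n × Fin n => η p.1 ≠ η p.2)
  rcases S.eq_empty_or_nonempty with h | h
  · refine ⟨1, one_pos, fun i j hij => ?_⟩
    have : (i, j) ∈ S := by simp [S, hij]
    simp [h] at this
  · obtain ⟨p, hp, hmin⟩ := S.exists_min_image (fun p => |η p.1 - η p.2|) h
    refine ⟨|η p.1 - η p.2|, ?_, fun i j hij => hmin (i, j) (by simp [S, hij])⟩
    simp only [S, Finset.mem_filter, Finset.mem_univ, true_and] at hp
    exact abs_pos.2 (sub_ne_zero.2 hp)

end ProjType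

end GTemplate

namespace GTemplate

open Matrix

/-! ### Monotonicity along the flow -/

section FlowProj

variable {n : ℕ} {η : Fin n → ℝ}

/-- A family of projection matrices which moves along the flow. -/
structure IsFlowProj (η : Fin n → ℝ) (P : ℝ → Matrix (Fin n) (Fin n) ℝ) : Prop where
  proj : ∀ t, IsProjMat (P t)
  hasDerivAt : ∀ t i j, HasDerivAt (fun s => P s i j)
    ((η i + η j) * P t i j - 2 * ∑ k, η k * P t i k * P t k j) t

theorem isFlowProj_colProj {κ : Type*} [Fintype κ] [DecidableEq κ] (η : Fin n → ℝ)
    {B : Matrix (Fin n) κ ℝ} (hB : Function.Injective B.mulVec) :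
    IsFlowProj η fun t => colProj (flowMat η B t) where
  proj t := ⟨colProj_mul_self (flowMat_injective η hB t), colProj_transpose _⟩
  hasDerivAt := hasDerivAt_colProj η hB

variable {P : ℝ → Matrix (Fin n) (Fin n) ℝ}

theorem IsFlowProj.hasDerivAt_diag (h : IsFlowProj η P) (t : ℝ) (i : Fin n) :
    HasDerivAt (fun s => P s i i) (2 * ∑ k, (η i - η k) * P t i k ^ 2) t := by
  refine (h.hasDerivAt t i i).congr_deriv ?_
  have h1 := (h.proj t).diag_eq i
  have h2 : ∑ k, η k * P t i k * P t k i = ∑ k, η k * P t i k ^ 2 :=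
    Finset.sum_congr rfl fun k _ => by rw [(h.proj t).symm k i]; ring
  rw [h2, h1]
  simp only [sub_mul, Finset.sum_sub_distrib, ← Finset.mul_sum]
  ring

/-- The average weight of a projection matrix. -/
def slope (η : Fin n → ℝ) (P : Matrix (Fin n) (Fin n) ℝ) : ℝ := ∑ i, η i * P i i

theorem abs_slope_le {Q : Matrix (Fin n) (Fin n) ℝ} (hQ : IsProjMat Q) :
    |slope η Q| ≤ ∑ i, |η i| := by
  refine (Finset.abs_sum_le_sum_abs _ _).trans (Finset.sum_le_sum fun i _ => ?_)
  rw [abs_mul]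
  exact mul_le_of_le_one_right (abs_nonneg _) (hQ.abs_le_one i i)

/-- Symmetrizing 2 Σ η_i (η_i - η_k) P_ik² in i and k produces the square (η_i - η_k)². Thus log
covolumes are convex, and growth of the slope measures exactly the failure of invariance. -/
theorem IsFlowProj.hasDerivAt_slope (h : IsFlowProj η P) (t : ℝ) :
    HasDerivAt (fun s => slope η (P s)) (offBlock η (P t)) t := by
  have h1 := HasDerivAt.fun_sum (u := Finset.univ) fun i _ =>
    (h.hasDerivAt_diag t i).const_mul (η i)
  refine h1.congr_deriv ?_
  have h2 : ∑ i, ∑ k, (η i * (η i - η k)) * P t i k ^ 2 =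
      ∑ i, ∑ k, (η k * (η k - η i)) * P t i k ^ 2 := by
    rw [Finset.sum_comm]
    refine Finset.sum_congr rfl fun i _ => Finset.sum_congr rfl fun k _ => ?_
    rw [(h.proj t).symm]
  have h3 : offBlock η (P t) = ∑ i, ∑ k, (η i * (η i - η k)) * P t i k ^ 2 +
      ∑ i, ∑ k, (η k * (η k - η i)) * P t i k ^ 2 := by
    rw [offBlock, ← Finset.sum_add_distrib]
    refine Finset.sum_congr rfl fun i _ => ?_
    rw [← Finset.sum_add_distrib]
    refine Finset.sum_congr rfl fun k _ => by ring
  rw [h3, ← h2, ← two_mul, Finset.mul_sum]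
  refine Finset.sum_congr rfl fun i _ => ?_
  simp only [Finset.mul_sum]
  refine Finset.sum_congr rfl fun k _ => by ring

theorem IsFlowProj.monotone_slope (h : IsFlowProj η P) : Monotone fun s => slope η (P s) :=
  monotone_of_deriv_nonneg (fun t => (h.hasDerivAt_slope t).differentiableAt) fun t => by
    rw [(h.hasDerivAt_slope t).deriv]; exact offBlock_nonneg η _

/-- In the derivative the terms with both indices above r cancel by antisymmetry, and the remaining
ones have η_i > r ≥ η_k. This is the source of the relation ≼ along transition arrows. -/
theorem IsFlowProj.monotone_sum_filter (h : IsFlowProj η P) (r : ℝ) :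
    Monotone fun s => ∑ i with r < η i, P s i i := by
  have hd : ∀ t, HasDerivAt (fun s => ∑ i with r < η i, P s i i)
      (∑ i with r < η i, 2 * ∑ k, (η i - η k) * P t i k ^ 2) t := fun t =>
    HasDerivAt.fun_sum fun i _ => h.hasDerivAt_diag t i
  refine monotone_of_deriv_nonneg (fun t => (hd t).differentiableAt) fun t => ?_
  rw [(hd t).deriv, ← Finset.mul_sum]
  refine mul_nonneg zero_le_two ?_
  set s := Finset.univ.filter fun i => r < η i with hs
  have h1 : ∑ i ∈ s, ∑ k, (η i - η k) * P t i k ^ 2 =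
      ∑ i ∈ s, ∑ k ∈ s, (η i - η k) * P t i k ^ 2 +
      ∑ i ∈ s, ∑ k ∈ sᶜ, (η i - η k) * P t i k ^ 2 := by
    rw [← Finset.sum_add_distrib]
    refine Finset.sum_congr rfl fun i _ => ?_
    rw [Finset.sum_add_sum_compl]
  have h2 : ∑ i ∈ s, ∑ k ∈ s, (η i - η k) * P t i k ^ 2 = 0 := by
    have h3 : ∑ i ∈ s, ∑ k ∈ s, (η i - η k) * P t i k ^ 2 =
        -∑ i ∈ s, ∑ k ∈ s, (η i - η k) * P t i k ^ 2 := by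
      conv_lhs => rw [Finset.sum_comm]
      simp only [← Finset.sum_neg_distrib]
      refine Finset.sum_congr rfl fun i _ => Finset.sum_congr rfl fun k _ => ?_
      rw [(h.proj t).symm k i]; ring
    linarith
  rw [h1, h2, zero_add]
  refine Finset.sum_nonneg fun i hi => Finset.sum_nonneg fun k hk => ?_
  simp only [hs, Finset.mem_filter, Finset.mem_univ, true_and, Finset.mem_compl, not_lt] at hi hk
  exact mul_nonneg (by linarith) (sq_nonneg _)

/-- The off-diagonal sum cannot decay faster than exponentially. Writing P_ij = Σ P_ik P_kj in the
Riccati equation produces the factor η_i + η_j - 2η_k = (η_i - η_k) + (η_j - η_k), so every cubic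
term is bounded by products of two off-diagonal quantities. -/
theorem IsFlowProj.exists_hasDerivAt_offBlock (h : IsFlowProj η P) {W : ℝ}
    (hW : ∀ i j, |η i - η j| ≤ W) (t : ℝ) :
    ∃ d, HasDerivAt (fun s => offBlock η (P s)) d t ∧ -(4 * n * W * offBlock η (P t)) ≤ d := by
  have hp := h.proj t
  have h1 : ∀ i j, HasDerivAt (fun s => (η i - η j) ^ 2 * P s i j ^ 2)
      (∑ k, 2 * ((η i - η j) ^ 2 * P t i j * ((η i + η j - 2 * η k) * P t i k * P t k j))) t := by
    intro i j
    refine (((h.hasDerivAt t i j).pow 2).const_mul _).congr_deriv ?_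
    have h2 : (η i + η j) * P t i j - 2 * ∑ k, η k * P t i k * P t k j =
        ∑ k, (η i + η j - 2 * η k) * P t i k * P t k j := by
      rw [hp.apply i j, Finset.mul_sum, Finset.mul_sum, ← Finset.sum_sub_distrib]
      exact Finset.sum_congr rfl fun k _ => by ring
    rw [h2]
    simp only [Nat.cast_ofNat, Nat.add_one_sub_one, pow_one, Finset.mul_sum]
    exact Finset.sum_congr rfl fun k _ => by ring
  refine ⟨_, HasDerivAt.fun_sum fun i _ => HasDerivAt.fun_sum fun j _ => h1 i j, ?_⟩
  set a : Fin n → Fin n → ℝ := fun i j => (η i - η j) ^ 2 * P t i j ^ 2 with ha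
  have hterm : ∀ i j k, -(W * (2 * a i j + a i k + a k j)) ≤
      2 * ((η i - η j) ^ 2 * P t i j * ((η i + η j - 2 * η k) * P t i k * P t k j)) := by
    intro i j k
    refine neg_le_of_abs_le ?_
    have hW0 : 0 ≤ W := (abs_nonneg _).trans (hW i j)
    have e1 : |2 * ((η i - η j) ^ 2 * P t i j * ((η i + η j - 2 * η k) * P t i k * P t k j))| =
        2 * |η i - η j| * (|η i - η j| * |P t i j|) *
          (|η i + η j - 2 * η k| * |P t i k| * |P t k j|) := by
      simp only [abs_mul, abs_pow, abs_two]; ring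
    rw [e1]
    have e2 : |η i + η j - 2 * η k| ≤ |η i - η k| + |η k - η j| := by
      rw [abs_sub_comm (η k)]
      calc _ = |(η i - η k) + (η j - η k)| := by ring_nf
        _ ≤ _ := abs_add_le _ _
    have e3 : |η i + η j - 2 * η k| * |P t i k| * |P t k j| ≤
        |η i - η k| * |P t i k| + |η k - η j| * |P t k j| := by
      have q1 := hp.abs_le_one i k
      have q2 := hp.abs_le_one k j
      calc _ ≤ (|η i - η k| + |η k - η j|) * |P t i k| * |P t k j| := by gcongr
        _ = |η i - η k| * |P t i k| * |P t k j| + |η k - η j| * |P t k j| * |P t i k| := by ring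
        _ ≤ |η i - η k| * |P t i k| * 1 + |η k - η j| * |P t k j| * 1 := by gcongr
        _ = _ := by ring
    have hsq : ∀ i j, a i j = (|η i - η j| * |P t i j|) ^ 2 := by
      intro i j; rw [mul_pow, sq_abs, sq_abs]
    calc _ ≤ 2 * W * (|η i - η j| * |P t i j|) *
          (|η i - η k| * |P t i k| + |η k - η j| * |P t k j|) := by
          have := hW i j
          gcongr
      _ ≤ _ := by
          rw [hsq, hsq, hsq]
          set x := |η i - η j| * |P t i j|
          set y := |η i - η k| * |P t i k|
          set z := |η k - η j| * |P t k j|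
          -- Completing squares: 2x(y + z) ≤ 2x² + y² + z².
          have : W * (2 * x ^ 2 + y ^ 2 + z ^ 2) - 2 * W * x * (y + z) =
            W * ((x - y) ^ 2 + (x - z) ^ 2) := by ring
          have h0 : 0 ≤ W * ((x - y) ^ 2 + (x - z) ^ 2) := by positivity
          linarith
  have hsum : ∑ i : Fin n, ∑ j : Fin n, ∑ k : Fin n, (W * (2 * a i j + a i k + a k j)) =
      4 * n * W * offBlock η (P t) := by
    have ho : offBlock η (P t) = ∑ i, ∑ j, a i j := rfl
    have s1 : ∑ i : Fin n, ∑ j : Fin n, ∑ k : Fin n, a i k = n * offBlock η (P t) := by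
      simp [ho, Finset.mul_sum]
    have s2 : ∑ i : Fin n, ∑ j : Fin n, ∑ k : Fin n, a k j = n * offBlock η (P t) := by
      simp only [Finset.sum_const, Finset.card_univ, Fintype.card_fin, nsmul_eq_mul, ho]
      rw [Finset.sum_comm (f := fun i j => a i j)]
    have s3 : ∑ i : Fin n, ∑ j : Fin n, ∑ k : Fin n, a i j = n * offBlock η (P t) := by
      simp [ho, Finset.mul_sum]
    simp only [← Finset.mul_sum, Finset.sum_add_distrib]
    rw [s1, s2, s3]; ring
  rw [← hsum]
  simp only [← Finset.sum_neg_distrib]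
  exact Finset.sum_le_sum fun i _ => Finset.sum_le_sum fun j _ => Finset.sum_le_sum fun k _ =>
    hterm i j k

/-- By the mean value theorem the increment of the slope over [t, t + 1] is the off-diagonal sum at
some intermediate time; limited exponential decay transfers this to a bound at t itself. -/
theorem IsFlowProj.offBlock_le (h : IsFlowProj η P) {W : ℝ} (hW0 : 0 ≤ W)
    (hW : ∀ i j, |η i - η j| ≤ W) (t : ℝ) :
    offBlock η (P t) ≤
      Real.exp (4 * n * W) * (slope η (P (t + 1)) - slope η (P t)) := by
  set c : ℝ := 4 * n * W with hc
  have hc0 : 0 ≤ c := by positivity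
  choose d hd hd' using h.exists_hasDerivAt_offBlock hW
  have hmono : Monotone fun s => Real.exp (c * s) * offBlock η (P s) := by
    have hder : ∀ s, HasDerivAt (fun s => Real.exp (c * s) * offBlock η (P s))
        (Real.exp (c * s) * c * offBlock η (P s) + Real.exp (c * s) * d s) s := by
      intro s
      have := ((hasDerivAt_id s).const_mul c).exp
      simp only [id, mul_one] at this
      exact this.mul (hd s)
    refine monotone_of_deriv_nonneg (fun s => (hder s).differentiableAt) fun s => ?_
    rw [(hder s).deriv]
    have h2 := hd' s
    have h3 : 0 ≤ Real.exp (c * s) * (c * offBlock η (P s) + d s) :=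
      mul_nonneg (Real.exp_pos _).le (by rw [hc]; linarith)
    linarith
  obtain ⟨s, hs, hs'⟩ := exists_hasDerivAt_eq_slope (fun s => slope η (P s))
    (fun s => offBlock η (P s)) (lt_add_one t)
    (fun s _ => (h.hasDerivAt_slope s).continuousAt.continuousWithinAt)
    (fun s _ => h.hasDerivAt_slope s)
  rw [add_sub_cancel_left, div_one] at hs'
  rw [← hs']
  have h1 := hmono hs.1.le
  simp only at h1
  have h2 : Real.exp (c * s) ≤ Real.exp (c * t) * Real.exp c := by
    rw [← Real.exp_add]
    apply Real.exp_le_exp.2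
    nlinarith [hs.2]
  have h3 : Real.exp (c * t) * offBlock η (P t) ≤
      Real.exp (c * t) * (Real.exp c * offBlock η (P s)) := by
    rw [← mul_assoc]
    exact h1.trans (mul_le_mul_of_nonneg_right h2 (offBlock_nonneg η _))
  exact le_of_mul_le_mul_left h3 (Real.exp_pos _)

end FlowProj

end GTemplate

namespace GTemplate

open Matrix

/-! ### Projection matrices of subspaces -/

section ProjOf

variable {n : ℕ}

/-- The matrix of the orthogonal projection to a subspace. -/
def projOf (V : Submodule ℝ (EuclideanSpace ℝ (Fin n))) : Matrix (Fin n) (Fin n) ℝ :=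
  of fun i j => V.starProjection (EuclideanSpace.single j (1 : ℝ)) i

theorem toEuclideanLin_apply_apply (A : Matrix (Fin n) (Fin n) ℝ)
    (x : EuclideanSpace ℝ (Fin n)) (i : Fin n) :
    toEuclideanLin A x i = ∑ j, A i j * x j := rfl

theorem toEuclideanLin_single (A : Matrix (Fin n) (Fin n) ℝ) (i j : Fin n) :
    toEuclideanLin A (EuclideanSpace.single j 1) i = A i j := by
  rw [toEuclideanLin_apply_apply]
  simp

theorem toEuclideanLin_projOf (V : Submodule ℝ (EuclideanSpace ℝ (Fin n)))
    (x : EuclideanSpace ℝ (Fin n)) : toEuclideanLin (projOf V) x = V.starProjection x := by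
  have h : toEuclideanLin (projOf V) = (V.starProjection : _ →ₗ[ℝ] _) := by
    refine (EuclideanSpace.basisFun (Fin n) ℝ).toBasis.ext fun j => ?_
    ext i
    simp only [OrthonormalBasis.coe_toBasis, EuclideanSpace.basisFun_apply, toEuclideanLin_single]
    rfl
  rw [h]; rfl

theorem trace_toEuclideanLin (A : Matrix (Fin n) (Fin n) ℝ) :
    LinearMap.trace ℝ _ (toEuclideanLin A) = A.trace := by
  rw [toEuclideanLin_eq_toLin_orthonormal, trace_toLin_eq]

theorem isProjMat_projOf (V : Submodule ℝ (EuclideanSpace ℝ (Fin n))) : IsProjMat (projOf V) where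
  mul_self := by
    ext i j
    have h := toEuclideanLin_projOf V (V.starProjection (EuclideanSpace.single j 1))
    have h2 : V.starProjection (V.starProjection (EuclideanSpace.single j 1)) =
        V.starProjection (EuclideanSpace.single j (1 : ℝ)) :=
      Submodule.starProjection_eq_self_iff.2 (V.starProjection_apply_mem _)
    rw [h2] at h
    have h3 := congrArg (fun x : EuclideanSpace ℝ (Fin n) => x i) h
    simp only [toEuclideanLin_apply_apply] at h3
    rw [mul_apply]
    exact h3
  transpose := by
    ext i j
    have h := V.inner_starProjection_left_eq_right (EuclideanSpace.single i (1 : ℝ))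
      (EuclideanSpace.single j (1 : ℝ))
    simp only [EuclideanSpace.inner_single_left, EuclideanSpace.inner_single_right] at h
    simpa [projOf] using h

theorem trace_projOf (V : Submodule ℝ (EuclideanSpace ℝ (Fin n))) :
    (projOf V).trace = Module.finrank ℝ V := by
  rw [← trace_toEuclideanLin]
  refine LinearMap.IsProj.trace ⟨fun x => ?_, fun x hx => ?_⟩
  · rw [toEuclideanLin_projOf]; exact V.starProjection_apply_mem _
  · rw [toEuclideanLin_projOf]; exact Submodule.starProjection_eq_self_iff.2 hx

theorem projOf_diag (V : Submodule ℝ (EuclideanSpace ℝ (Fin n))) (i : Fin n) :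
    projOf V i i = ‖V.starProjection (EuclideanSpace.single i (1 : ℝ))‖ ^ 2 := by
  rw [(isProjMat_projOf V).diag_eq, EuclideanSpace.real_norm_sq_eq]
  exact Finset.sum_congr rfl fun k _ => by rw [(isProjMat_projOf V).symm]; rfl

theorem projOf_diag_mono {V W : Submodule ℝ (EuclideanSpace ℝ (Fin n))} (h : V ≤ W) (i : Fin n) :
    projOf V i i ≤ projOf W i i := by
  rw [projOf_diag, projOf_diag]
  have h1 : V.starProjection (EuclideanSpace.single i (1 : ℝ)) =
      V.starProjection (W.starProjection (EuclideanSpace.single i (1 : ℝ))) := by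
    have := Submodule.starProjection_comp_starProjection_of_le h
    exact (congrArg (fun f => f (EuclideanSpace.single i (1 : ℝ))) this).symm
  rw [h1]
  gcongr
  exact V.norm_starProjection_apply_le _

/-- A projection matrix whose image is `V` is the projection matrix of `V`. -/
theorem projOf_eq {P : Matrix (Fin n) (Fin n) ℝ} (hP : IsProjMat P)
    {V : Submodule ℝ (EuclideanSpace ℝ (Fin n))} (h1 : ∀ x, toEuclideanLin P x ∈ V)
    (h2 : ∀ x ∈ V, toEuclideanLin P x = x) : projOf V = P := by
  ext i j
  have h3 : V.starProjection (EuclideanSpace.single j (1 : ℝ)) =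
      toEuclideanLin P (EuclideanSpace.single j 1) := by
    refine Submodule.eq_starProjection_of_mem_of_inner_eq_zero (h1 _) fun w hw => ?_
    rw [inner_sub_left, sub_eq_zero]
    conv_lhs => rw [← h2 w hw]
    simp only [EuclideanSpace.inner_single_left, map_one, one_mul]
    rw [toEuclideanLin_apply_apply]
    simp only [PiLp.inner_apply, toEuclideanLin_single, RCLike.inner_apply, conj_trivial]
    exact Finset.sum_congr rfl fun k _ => by rw [hP.symm]; ring
  have h4 : projOf V i j = V.starProjection (EuclideanSpace.single j (1 : ℝ)) i := rfl
  rw [h4, h3, toEuclideanLin_single]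

theorem toEuclideanLin_mul (A B : Matrix (Fin n) (Fin n) ℝ) (x : EuclideanSpace ℝ (Fin n)) :
    toEuclideanLin (A * B) x = toEuclideanLin A (toEuclideanLin B x) := by
  simp only [toLpLin_apply, mulVec_mulVec]

theorem projOf_range {P : Matrix (Fin n) (Fin n) ℝ} (hP : IsProjMat P) :
    projOf (LinearMap.range (toEuclideanLin P)) = P := by
  refine projOf_eq hP (fun x => ⟨x, rfl⟩) ?_
  rintro _ ⟨x, rfl⟩
  rw [← toEuclideanLin_mul, hP.mul_self]

theorem mem_range_toEuclideanLin {P : Matrix (Fin n) (Fin n) ℝ} (hP : IsProjMat P)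
    (x : EuclideanSpace ℝ (Fin n)) :
    x ∈ LinearMap.range (toEuclideanLin P) ↔ toEuclideanLin P x = x := by
  refine ⟨?_, fun h => ⟨x, h⟩⟩
  rintro ⟨y, rfl⟩
  rw [← toEuclideanLin_mul, hP.mul_self]

end ProjOf

/-! ### Nearby subspaces and the path metric -/

section Near

variable {n : ℕ}

/-- For equal dimensions ‖A - B‖² = 2(dim - tr AB) = 2‖A - BA‖², so a one-sided estimate suffices.
The columns of A - BA are u - P_W u for u = P_V e_j, and the ‖u‖² add up to the dimension. -/
theorem sum_sq_projOf_sub {V W : Submodule ℝ (EuclideanSpace ℝ (Fin n))}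
    (h : Module.finrank ℝ V = Module.finrank ℝ W) {ρ : ℝ}
    (hρ : ∀ u ∈ V, ‖u - W.starProjection u‖ ≤ ρ * ‖u‖) :
    ∑ i, ∑ j, (projOf V i j - projOf W i j) ^ 2 ≤ 2 * Module.finrank ℝ V * ρ ^ 2 := by
  have hV := isProjMat_projOf V
  have hW := isProjMat_projOf W
  set A := projOf V
  set B := projOf W
  have htr : ∀ M : Matrix (Fin n) (Fin n) ℝ, ∑ i, ∑ j, M i j ^ 2 = (M * Mᵀ).trace := by
    intro M
    rw [trace]
    refine Finset.sum_congr rfl fun i _ => ?_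
    rw [diag_apply, mul_apply]
    exact Finset.sum_congr rfl fun j _ => by rw [transpose_apply, sq]
  have h1 : ∑ i, ∑ j, (A i j - B i j) ^ 2 = 2 * (Module.finrank ℝ V - (A * B).trace) := by
    have : ∑ i, ∑ j, (A i j - B i j) ^ 2 = ∑ i, ∑ j, (A - B) i j ^ 2 := rfl
    rw [this, htr, transpose_sub, hV.transpose, hW.transpose, Matrix.sub_mul, Matrix.mul_sub,
      Matrix.mul_sub, hV.mul_self, hW.mul_self, trace_sub, trace_sub, trace_sub, trace_mul_comm B A,
      trace_projOf, trace_projOf, h]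
    ring
  have h2 : ∑ i, ∑ j, (A - B * A) i j ^ 2 = Module.finrank ℝ V - (A * B).trace := by
    rw [htr, transpose_sub, transpose_mul, hV.transpose, hW.transpose, Matrix.sub_mul,
      Matrix.mul_sub, Matrix.mul_sub, hV.mul_self, ← Matrix.mul_assoc, hV.mul_self, Matrix.mul_assoc,
      hV.mul_self,
      show B * A * (A * B) = B * (A * A) * B by simp only [Matrix.mul_assoc], hV.mul_self,
      trace_sub, trace_sub, trace_sub, trace_mul_comm B A, trace_mul_comm (B * A) B,
      ← Matrix.mul_assoc, hW.mul_self, trace_mul_comm B A, trace_projOf]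
    ring
  have h3 : ∑ i, ∑ j, (A - B * A) i j ^ 2 ≤ Module.finrank ℝ V * ρ ^ 2 := by
    rw [Finset.sum_comm, ← trace_projOf, trace, Finset.sum_mul]
    refine Finset.sum_le_sum fun j _ => ?_
    set u := V.starProjection (EuclideanSpace.single j (1 : ℝ)) with hu
    have h4 := hρ u (V.starProjection_apply_mem _)
    have h5 : ∑ i, (A - B * A) i j ^ 2 = ‖u - W.starProjection u‖ ^ 2 := by
      rw [EuclideanSpace.real_norm_sq_eq]
      refine Finset.sum_congr rfl fun i _ => ?_
      rw [← toEuclideanLin_projOf W, PiLp.sub_apply, toEuclideanLin_apply_apply, Matrix.sub_apply,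
        mul_apply]
      rfl
    rw [h5, diag_apply, projOf_diag, ← hu]
    have h6 := pow_le_pow_left₀ (norm_nonneg _) h4 2
    linarith [h6, mul_pow ρ ‖u‖ 2]
  rw [h1, ← h2]
  linarith

theorem norm_starProjection_sub_le {V W : Submodule ℝ (EuclideanSpace ℝ (Fin n))} {e : ℝ}
    (he : ∀ i j, |projOf V i j - projOf W i j| ≤ e) (x : EuclideanSpace ℝ (Fin n)) :
    ‖V.starProjection x - W.starProjection x‖ ≤ n * e * ‖x‖ := by
  rcases Nat.eq_zero_or_pos n with rfl | hn
  · have : V.starProjection x - W.starProjection x = 0 := Subsingleton.elim _ _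
    rw [this]; simp
  have he0 : 0 ≤ e := (abs_nonneg _).trans (he ⟨0, hn⟩ ⟨0, hn⟩)
  refine (sq_le_sq₀ (norm_nonneg _) (by positivity)).1 ?_
  rw [EuclideanSpace.real_norm_sq_eq]
  have h1 : ∀ i, (V.starProjection x - W.starProjection x) i ^ 2 ≤ n * e ^ 2 * ‖x‖ ^ 2 := by
    intro i
    have h2 : (V.starProjection x - W.starProjection x) i =
        ∑ j, (projOf V i j - projOf W i j) * x j := by
      rw [← toEuclideanLin_projOf, ← toEuclideanLin_projOf, PiLp.sub_apply,
        toEuclideanLin_apply_apply, toEuclideanLin_apply_apply, ← Finset.sum_sub_distrib]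
      exact Finset.sum_congr rfl fun j _ => by ring
    rw [h2, EuclideanSpace.real_norm_sq_eq]
    refine (Finset.sum_mul_sq_le_sq_mul_sq _ _ _).trans ?_
    refine mul_le_mul_of_nonneg_right ?_ (by positivity)
    calc ∑ j, (projOf V i j - projOf W i j) ^ 2 ≤ ∑ j : Fin n, e ^ 2 :=
          Finset.sum_le_sum fun j _ => by
            rw [← sq_abs]; exact pow_le_pow_left₀ (abs_nonneg _) (he i j) 2
      _ = n * e ^ 2 := by simp
  calc _ ≤ ∑ i : Fin n, n * e ^ 2 * ‖x‖ ^ 2 := Finset.sum_le_sum fun i _ => h1 i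
    _ = _ := by simp; ring

/-- Two nearby subspaces are joined by a short path. -/
theorem dGr_le {l : ℕ} (V W : Gr n l) {κ : ℝ} (hκ0 : 0 ≤ κ) (hκ : κ ≤ 1 / 2)
    (h : ∀ v ∈ V.1, ‖v - W.1.starProjection v‖ ≤ κ * ‖v‖) :
    dGr V W ≤ ENNReal.ofReal (2 * κ * Real.sqrt (2 * n)) := by
  -- The path moves V by T_s, which interpolates linearly between the identity and the projection to
  -- W.
  let T : ℝ → EuclideanSpace ℝ (Fin n) →ₗ[ℝ] EuclideanSpace ℝ (Fin n) := fun s =>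
    LinearMap.id - s • (LinearMap.id - (W.1.starProjection : _ →ₗ[ℝ] _))
  have hT : ∀ s v, T s v = v - s • (v - W.1.starProjection v) := fun s v => rfl
  -- Paths are functions on all of ℝ, so the parameter is clamped to [0, 1] to keep the dimension
  -- equal to l everywhere.
  let c : ℝ → ℝ := fun s => max 0 (min s 1)
  have hc : ∀ s, 0 ≤ c s ∧ c s ≤ 1 := fun s =>
    ⟨le_max_left _ _, max_le zero_le_one (min_le_right _ _)⟩
  have hc' : ∀ s ∈ Set.Icc (0 : ℝ) 1, c s = s := fun s hs => by
    simp only [c]; rw [min_eq_left hs.2, max_eq_right hs.1]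
  have hlow : ∀ s, ∀ v ∈ V.1, ‖v‖ ≤ 2 * ‖T (c s) v‖ := by
    intro s v hv
    rw [hT]
    have h1 : ‖c s • (v - W.1.starProjection v)‖ ≤ 1 / 2 * ‖v‖ := by
      rw [norm_smul, Real.norm_eq_abs, abs_of_nonneg (hc s).1]
      have h2 := h v hv
      have h3 := norm_nonneg v
      have h4 := (hc s).2
      have h5 := (hc s).1
      nlinarith [norm_nonneg (v - W.1.starProjection v)]
    have h2 := norm_sub_norm_le v (c s • (v - W.1.starProjection v))
    linarith
  have hinj : ∀ s, Module.finrank ℝ (V.1.map (T (c s))) = l := by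
    intro s
    have h1 : Function.Injective ((T (c s)).domRestrict V.1) := by
      rw [injective_iff_map_eq_zero]
      rintro ⟨v, hv⟩ h0
      have h2 := hlow s v hv
      have h3 : T (c s) v = 0 := h0
      rw [h3, norm_zero, mul_zero] at h2
      exact Subtype.ext (norm_le_zero_iff.1 h2)
    have h2 : V.1.map (T (c s)) = LinearMap.range ((T (c s)).domRestrict V.1) := by
      rw [LinearMap.range_domRestrict]
    rw [h2, LinearMap.finrank_range_of_inj h1]
    exact V.2
  let γ : ℝ → Gr n l := fun s => ⟨V.1.map (T (c s)), hinj s⟩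
  have h0 : γ 0 = V := by
    refine Subtype.ext ?_
    have h1 : T (c 0) = LinearMap.id := by
      rw [hc' 0 ⟨le_rfl, zero_le_one⟩]; simp [T]
    change V.1.map (T (c 0)) = V.1
    rw [h1, Submodule.map_id]
  have h1 : γ 1 = W := by
    refine Subtype.ext ?_
    refine Submodule.eq_of_le_of_finrank_eq ?_ ((hinj 1).trans W.2.symm)
    rintro _ ⟨v, hv, rfl⟩
    rw [hT, hc' 1 ⟨zero_le_one, le_rfl⟩, one_smul, sub_sub_cancel]
    exact W.1.starProjection_apply_mem _
  have hK0 : 0 ≤ 2 * κ * Real.sqrt (2 * n) := by positivity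
  -- On T_s V a vector moves by |s - s'| times ‖v - P_W v‖ ≤ κ‖v‖ ≤ 2κ‖T_s v‖; the factor √(2n)
  -- comes from `sum_sq_projOf_sub`.
  have hlip : LipschitzOnWith (Real.toNNReal (2 * κ * Real.sqrt (2 * n)))
      (fun s => projMatrix (γ s)) (Set.Icc 0 1) := by
    refine LipschitzOnWith.of_dist_le_mul fun s hs s' hs' => ?_
    rw [Real.coe_toNNReal _ hK0, dist_eq_norm, Real.dist_eq]
    refine (sq_le_sq₀ (norm_nonneg _) (by positivity)).1 ?_
    rw [EuclideanSpace.real_norm_sq_eq, Fintype.sum_prod_type]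
    have h2 := sum_sq_projOf_sub (V := (γ s).1) (W := (γ s').1) ((γ s).2.trans (γ s').2.symm)
      (ρ := 2 * κ * |s - s'|) ?_
    · refine h2.trans ?_
      have h3 : (Module.finrank ℝ (γ s).1 : ℝ) ≤ n := by
        have := Submodule.finrank_le (γ s).1
        rw [finrank_euclideanSpace_fin] at this
        exact_mod_cast this
      have h4 : (2 * κ * Real.sqrt (2 * n) * |s - s'|) ^ 2 =
          2 * n * (2 * κ * |s - s'|) ^ 2 := by
        rw [mul_pow, mul_pow, Real.sq_sqrt (by positivity)]; ring
      rw [h4]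
      gcongr
    · rintro _ ⟨v, hv, rfl⟩
      have h3 : T (c s') v ∈ (γ s').1 := ⟨v, hv, rfl⟩
      have h4 : ‖T (c s) v - (γ s').1.starProjection (T (c s) v)‖ ≤
          ‖T (c s) v - T (c s') v‖ := by
        rw [Submodule.starProjection_minimal]
        exact ciInf_le ⟨0, by rintro _ ⟨x, rfl⟩; exact norm_nonneg _⟩
          (⟨T (c s') v, h3⟩ : (γ s').1)
      refine h4.trans ?_
      have h5 : T (c s) v - T (c s') v = (s' - s) • (v - W.1.starProjection v) := by
        rw [hT, hT, hc' s hs, hc' s' hs', sub_smul]; abel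
      rw [h5, norm_smul, Real.norm_eq_abs, abs_sub_comm]
      have h6 := h v hv
      have h7 := hlow s v hv
      calc |s - s'| * ‖v - W.1.starProjection v‖ ≤ |s - s'| * (κ * (2 * ‖T (c s) v‖)) := by
            gcongr
            exact h6.trans (mul_le_mul_of_nonneg_left h7 hκ0)
        _ = _ := by ring
  refine (iInf₂_le γ ⟨h0, h1, hlip.continuousOn⟩).trans ?_
  have h2 := hlip.comp_eVariationOn_le (g := id) (s := Set.Icc (0 : ℝ) 1) (Set.mapsTo_id _)
  refine h2.trans ?_
  have h3 := (monotone_id (α := ℝ)).monotoneOn (Set.Icc 0 1) |>.eVariationOn_eq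
    (Set.left_mem_Icc.2 zero_le_one) (Set.right_mem_Icc.2 zero_le_one)
  rw [Set.inter_self] at h3
  calc _ ≤ _ := mul_le_mul_right h3.le _
    _ = _ := by simp [ENNReal.ofReal]

/-! ### Subspaces which are nearly invariant -/

variable {η : Fin n → ℝ}

theorem offBlock_eq_zero {P : Matrix (Fin n) (Fin n) ℝ} (h : offBlock η P = 0) {i j : Fin n}
    (hij : η i ≠ η j) : P i j = 0 := by
  rw [offBlock, Finset.sum_eq_zero_iff_of_nonneg fun _ _ =>
    Finset.sum_nonneg fun _ _ => by positivity] at h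
  have h1 := h i (Finset.mem_univ _)
  rw [Finset.sum_eq_zero_iff_of_nonneg fun _ _ => by positivity] at h1
  have h2 := h1 j (Finset.mem_univ _)
  have h3 : (η i - η j) ^ 2 ≠ 0 := pow_ne_zero _ (sub_ne_zero.2 hij)
  simpa [h3] using h2

theorem gFlow_apply_apply (η : Fin n → ℝ) (t : ℝ) (x : EuclideanSpace ℝ (Fin n)) (i : Fin n) :
    gFlow η t x i = Real.exp (t * η i) * x i := by
  rw [gFlow, toEuclideanLin_apply_apply]
  simp [diagonal_apply]

theorem gFlow_gFlow_neg (η : Fin n → ℝ) (t : ℝ) (x : EuclideanSpace ℝ (Fin n)) :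
    gFlow η t (gFlow η (-t) x) = x := by
  ext i
  rw [gFlow_apply_apply, gFlow_apply_apply, ← mul_assoc, ← Real.exp_add]
  simp

theorem gFlow_toEuclideanLin {P : Matrix (Fin n) (Fin n) ℝ} (h : offBlock η P = 0) (t : ℝ)
    (x : EuclideanSpace ℝ (Fin n)) :
    gFlow η t (toEuclideanLin P x) = toEuclideanLin P (gFlow η t x) := by
  ext i
  rw [gFlow_apply_apply, toEuclideanLin_apply_apply, toEuclideanLin_apply_apply, Finset.mul_sum]
  refine Finset.sum_congr rfl fun j _ => ?_
  rw [gFlow_apply_apply]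
  by_cases hij : η i = η j
  · rw [hij]; ring
  · rw [offBlock_eq_zero h hij]; ring

/-- A block diagonal P commutes with the coordinate projection D to the weight x, so DP is the
projection to the intersection and its trace is the dimension. -/
theorem finrank_range_inf_eigenspace {P : Matrix (Fin n) (Fin n) ℝ} (hP : IsProjMat P)
    (h : offBlock η P = 0) (x : ℝ) :
    (Module.finrank ℝ (LinearMap.range (toEuclideanLin P) ⊓
      Module.End.eigenspace (gFlow η 1) (Real.exp x) :
        Submodule ℝ (EuclideanSpace ℝ (Fin n))) : ℝ) = massAt η P x := by
  classical
  let D : Matrix (Fin n) (Fin n) ℝ := diagonal fun i => if η i = x then 1 else 0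
  have hDP : D * P = P * D := by
    ext i j
    simp only [D, diagonal_mul, mul_diagonal]
    by_cases hij : η i = η j
    · rw [hij]; ring
    · rw [offBlock_eq_zero h hij]; ring
  have hD : ∀ v i, toEuclideanLin D v i = if η i = x then v i else 0 := by
    intro v i
    rw [toEuclideanLin_apply_apply]
    simp [D, diagonal_apply]
  have htr : (D * P).trace = massAt η P x := by
    simp [D, trace, diagonal_mul, massAt, Finset.sum_filter]
  rw [← htr, ← trace_toEuclideanLin]
  symm
  refine LinearMap.IsProj.trace ⟨fun v => ⟨?_, ?_⟩, fun v hv => ?_⟩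
  · rw [hDP, toEuclideanLin_mul]
    exact ⟨_, rfl⟩
  · rw [SetLike.mem_coe, Module.End.mem_eigenspace_iff, toEuclideanLin_mul]
    ext i
    rw [gFlow_apply_apply, hD, PiLp.smul_apply, hD, one_mul]
    split_ifs with hi
    · rw [hi, smul_eq_mul]
    · simp
  · have h1 := (mem_range_toEuclideanLin hP v).1 hv.1
    have h2 := Module.End.mem_eigenspace_iff.1 hv.2
    rw [toEuclideanLin_mul, h1]
    ext i
    rw [hD]
    split_ifs with hi
    · rfl
    · have h3 := congrArg (fun y : EuclideanSpace ℝ (Fin n) => y i) h2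
      simp only [gFlow_apply_apply, PiLp.smul_apply, smul_eq_mul, one_mul] at h3
      by_contra h4
      exact hi (Real.exp_injective (mul_right_cancel₀ (fun h => h4 h.symm) h3))

theorem range_mem_invGr {P : Matrix (Fin n) (Fin n) ℝ} (hP : IsProjMat P)
    (h : offBlock η P = 0) {l : ℕ}
    (hl : Module.finrank ℝ (LinearMap.range (toEuclideanLin P)) = l) :
    (⟨LinearMap.range (toEuclideanLin P), hl⟩ : Gr n l) ∈ invGr η l (projType η P) := by
  refine ⟨fun t => ?_, fun x => ?_⟩
  · apply le_antisymm
    · rintro _ ⟨_, ⟨x, rfl⟩, rfl⟩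
      rw [gFlow_toEuclideanLin h]
      exact ⟨_, rfl⟩
    · rintro _ ⟨x, rfl⟩
      refine ⟨toEuclideanLin P (gFlow η (-t) x), ⟨_, rfl⟩, ?_⟩
      rw [gFlow_toEuclideanLin h, gFlow_gFlow_neg]
  · have h1 := finrank_range_inf_eigenspace hP h x
    have h2 := cast_count_projType (η := η) hP x
    rw [← h1, round_natCast] at h2
    exact_mod_cast h2.symm

/-- The masses of Q are integers, and those of P differ from them by less than 1/2. -/
theorem projType_eq_of_near {P Q : Matrix (Fin n) (Fin n) ℝ} (hQ : IsProjMat Q)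
    (h : offBlock η Q = 0) {e : ℝ} (he : ∀ i j, |P i j - Q i j| ≤ e) (hne : n * e < 1 / 2) :
    projType η P = projType η Q := by
  ext x
  rw [count_projType, count_projType]
  have h1 := finrank_range_inf_eigenspace hQ h x
  congr 1
  rw [← h1, round_natCast, round_eq_iff, Int.cast_natCast, h1]
  have h2 : |massAt η P x - massAt η Q x| < 1 / 2 := by
    refine lt_of_le_of_lt ?_ hne
    rw [massAt, massAt, ← Finset.sum_sub_distrib]
    refine (Finset.abs_sum_le_sum_abs _ _).trans ?_
    calc _ ≤ ∑ i : Fin n, |P i i - Q i i| :=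
          Finset.sum_le_sum_of_subset_of_nonneg (Finset.subset_univ _) fun _ _ _ => abs_nonneg _
      _ ≤ ∑ i : Fin n, e := Finset.sum_le_sum fun i _ => he i i
      _ = n * e := by simp
  have h3 := abs_lt.1 h2
  exact ⟨by linarith, by linarith⟩

/-- Compactness: the projection matrices outside the open e-neighbourhood of the zero set of
`offBlock` form a compact set, on which `offBlock` attains a positive minimum; any δ works if this
set is empty. -/
theorem exists_near_of_offBlock_lt (η : Fin n → ℝ) {e : ℝ} (he : 0 < e) :
    ∃ δ : ℝ, 0 < δ ∧ ∀ P : Matrix (Fin n) (Fin n) ℝ, IsProjMat P → offBlock η P < δ →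
      ∃ Q, IsProjMat Q ∧ offBlock η Q = 0 ∧ ∀ i j, |P i j - Q i j| ≤ e := by
  let S : Set (Fin n → Fin n → ℝ) := {f | IsProjMat (of f)}
  have hS : S = {f | (∀ i j, ∑ k, f i k * f k j = f i j) ∧ ∀ i j, f j i = f i j} := by
    ext f
    constructor
    · intro h
      exact ⟨fun i j => (h.apply i j).symm, fun i j => h.symm j i⟩
    · intro h
      exact ⟨by ext i j; rw [mul_apply]; exact h.1 i j, by ext i j; exact h.2 i j⟩
  have hclosed : IsClosed S := by
    rw [hS]
    have e1 : ∀ i j, Continuous fun f : Fin n → Fin n → ℝ => f i j := fun i j => by fun_prop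
    simp only [Set.ofPred_and, Set.ofPred_forall]
    refine IsClosed.inter ?_ ?_
    · refine isClosed_iInter fun i => isClosed_iInter fun j => isClosed_eq ?_ (e1 i j)
      exact continuous_finsetSum _ fun k _ => (e1 i k).mul (e1 k j)
    · exact isClosed_iInter fun i => isClosed_iInter fun j => isClosed_eq (e1 j i) (e1 i j)
  have hcomp : IsCompact S := by
    refine (isCompact_univ_pi fun _ : Fin n => isCompact_univ_pi fun _ : Fin n =>
      isCompact_Icc (a := (-1 : ℝ)) (b := 1)).of_isClosed_subset hclosed fun f hf => ?_
    simp only [Set.mem_pi, Set.mem_univ, true_implies]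
    exact fun i j => abs_le.1 (IsProjMat.abs_le_one hf i j)
  let U : Set (Fin n → Fin n → ℝ) :=
    ⋃ Q ∈ {Q : Fin n → Fin n → ℝ | IsProjMat (of Q) ∧ offBlock η (of Q) = 0}, Metric.ball Q e
  have hU : IsOpen U := isOpen_biUnion fun _ _ => Metric.isOpen_ball
  have hcont : Continuous fun f : Fin n → Fin n → ℝ => offBlock η (of f) := by
    simp only [offBlock, of_apply]
    fun_prop
  have hin : ∀ P : Matrix (Fin n) (Fin n) ℝ, (show Fin n → Fin n → ℝ from fun i j => P i j) ∈ U →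
      ∃ Q, IsProjMat Q ∧ offBlock η Q = 0 ∧ ∀ i j, |P i j - Q i j| ≤ e := by
    intro P hP
    simp only [U, Set.mem_iUnion, Metric.mem_ball] at hP
    obtain ⟨Q, hQ, hd⟩ := hP
    refine ⟨of Q, hQ.1, hQ.2, fun i j => ?_⟩
    rw [← Real.dist_eq]
    exact ((dist_le_pi_dist _ _ j).trans (dist_le_pi_dist _ _ i)).trans hd.le
  rcases (S \ U).eq_empty_or_nonempty with h | h
  · refine ⟨1, one_pos, fun P hP _ => hin P ?_⟩
    by_contra h1
    have : (show Fin n → Fin n → ℝ from fun i j => P i j) ∈ S \ U := ⟨hP, h1⟩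
    rw [h] at this
    exact this
  · obtain ⟨f, hf, hmin⟩ := (hcomp.diff hU).exists_isMinOn h hcont.continuousOn
    refine ⟨offBlock η (of f), ?_, fun P hP hlt => hin P ?_⟩
    · refine (offBlock_nonneg η _).lt_of_ne fun h0 => hf.2 ?_
      exact Set.mem_biUnion (x := f) ⟨hf.1, h0.symm⟩ (Metric.mem_ball_self he)
    · by_contra h1
      exact absurd (hmin (show (fun i j => P i j) ∈ S \ U from ⟨hP, h1⟩)) (not_le.2 hlt)

/-- Subspaces whose projection matrix is nearly block diagonal are near to invariant subspaces. -/
theorem exists_mem_nhd_invGr (η : Fin n → ℝ) {ε : ℝ} (hε : 0 < ε) :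
    ∃ δ : ℝ, 0 < δ ∧ ∀ (l : ℕ) (V : Gr n l), offBlock η (projOf V.1) < δ →
      V ∈ nhd ε (invGr η l (projType η (projOf V.1))) := by
  set r := Real.sqrt (2 * n) with hr
  have hr0 : 0 ≤ r := Real.sqrt_nonneg _
  -- The first bound makes the traces and masses of P and Q differ by at most 1/4, so that dimension
  -- and type agree; the second makes the joining path shorter than ε.
  set e : ℝ := min (1 / (4 * (n + 1))) (ε / (4 * (n + 1) * (r + 1))) with he
  have he0 : 0 < e := by positivity
  have hne : n * e ≤ 1 / 4 := by
    calc n * e ≤ (n + 1) * (1 / (4 * (n + 1))) := by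
          gcongr
          · linarith
          · exact min_le_left _ _
      _ = 1 / 4 := by field_simp
  have hne2 : 2 * (n * e) * r < ε := by
    have h1 : (n + 1) * e * (r + 1) ≤ ε / 4 := by
      calc (n + 1) * e * (r + 1) ≤ (n + 1) * (ε / (4 * (n + 1) * (r + 1))) * (r + 1) := by
            gcongr
            exact min_le_right _ _
        _ = ε / 4 := by field_simp
    have h2 : n * e * r ≤ (n + 1) * e * (r + 1) := by
      gcongr <;> linarith
    linarith
  obtain ⟨δ, hδ, H⟩ := exists_near_of_offBlock_lt η he0
  refine ⟨δ, hδ, fun l V hV => ?_⟩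
  obtain ⟨Q, hQ, hQ0, hQe⟩ := H _ (isProjMat_projOf V.1) hV
  have hW : projOf (LinearMap.range (toEuclideanLin Q)) = Q := projOf_range hQ
  have hl : Module.finrank ℝ (LinearMap.range (toEuclideanLin Q)) = l := by
    have h1 := trace_projOf (LinearMap.range (toEuclideanLin Q))
    have h2 := trace_projOf V.1
    rw [hW] at h1
    have h3 : |(projOf V.1).trace - Q.trace| < 1 := by
      rw [← trace_sub, trace]
      refine (Finset.abs_sum_le_sum_abs _ _).trans_lt ?_
      calc _ ≤ ∑ i : Fin n, e := Finset.sum_le_sum fun i _ => hQe i i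
        _ = n * e := by simp
        _ < 1 := by linarith
    rw [h1, h2, show Module.finrank ℝ V.1 = l from V.2] at h3
    have h4 : |(l : ℤ) - (Module.finrank ℝ (LinearMap.range (toEuclideanLin Q)) : ℤ)| < 1 := by
      exact_mod_cast h3
    rw [Int.abs_lt_one_iff] at h4
    omega
  refine ⟨⟨_, hl⟩, ?_, ?_⟩
  · rw [projType_eq_of_near hQ hQ0 hQe (by linarith)]
    exact range_mem_invGr hQ hQ0 hl
  · refine (dGr_le V ⟨_, hl⟩ (κ := n * e) (by positivity) (by linarith) ?_).trans_lt
      ((ENNReal.ofReal_lt_ofReal_iff hε).2 hne2)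
    intro v hv
    have h1 := norm_starProjection_sub_le (V := V.1)
      (W := LinearMap.range (toEuclideanLin Q)) (by rw [hW]; exact hQe) v
    rwa [Submodule.starProjection_eq_self_iff.2 hv] at h1

end Near

end GTemplate

namespace GTemplate

open Matrix

/-! ### Determinant inequalities -/

section DetIneq

set_option linter.unusedSectionVars false

theorem one_le_det_one_add {κ : Type*} [Fintype κ] [DecidableEq κ] {X : Matrix κ κ ℝ}
    (hX : X.PosSemidef) : 1 ≤ (1 + X).det := by
  have hA : (1 + X).IsHermitian := isHermitian_one.add hX.1
  rw [hA.det_eq_prod_eigenvalues]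
  simp only [RCLike.ofReal_real_eq_id, id]
  refine Finset.one_le_prod fun a _ => ?_
  set v : κ → ℝ := (hA.eigenvectorBasis a).ofLp with hv
  have hev : (1 + X) *ᵥ v = hA.eigenvalues a • v := hA.mulVec_eigenvectorBasis a
  have h3 := hX.dotProduct_mulVec_nonneg v
  have h4 : X *ᵥ v = (hA.eigenvalues a - 1) • v := by
    rw [sub_smul, ← hev, add_mulVec, one_mulVec, one_smul, add_sub_cancel_left]
  rw [h4, dotProduct_smul, smul_eq_mul] at h3
  have h5 : 0 < star v ⬝ᵥ v := by
    rw [dotProduct_star_self_pos_iff]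
    intro h0
    apply hA.eigenvectorBasis.orthonormal.ne_zero a
    ext i
    exact congrFun h0 i
  have := nonneg_of_mul_nonneg_left h3 h5
  linarith

open scoped MatrixOrder in
-- For invertible A = S*S, conjugating by S reduces the claim to det(1 + X) ≥ 1 with X = S⁻*BS⁻¹;
-- for det A = 0 it is nonnegativity.
theorem det_le_det_add {κ : Type*} [Fintype κ] [DecidableEq κ] {A B : Matrix κ κ ℝ}
    (hA : A.PosSemidef) (hB : B.PosSemidef) : A.det ≤ (A + B).det := by
  by_cases h0 : A.det = 0
  · rw [h0]; exact (hA.add hB).det_nonneg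
  obtain ⟨S, rfl⟩ := CStarAlgebra.nonneg_iff_eq_star_mul_self.mp hA.nonneg
  rw [det_mul] at h0
  have hS : IsUnit S.det := (right_ne_zero_of_mul h0).isUnit
  have hS' : IsUnit (star S).det := (left_ne_zero_of_mul h0).isUnit
  have h1 : star S * S + B = star S * (1 + (S⁻¹)ᴴ * B * S⁻¹) * S := by
    rw [Matrix.mul_add, Matrix.add_mul, Matrix.mul_one, conjTranspose_nonsing_inv,
      ← star_eq_conjTranspose]
    congr 1
    rw [← Matrix.mul_assoc, ← Matrix.mul_assoc, mul_nonsing_inv _ hS', Matrix.one_mul,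
      Matrix.mul_assoc, nonsing_inv_mul _ hS, Matrix.mul_one]
  rw [h1, det_mul, det_mul, det_mul]
  have h2 := one_le_det_one_add (hB.conjTranspose_mul_mul_same S⁻¹)
  have h3 : 0 ≤ (star S).det * S.det := by rw [← det_mul]; exact hA.det_nonneg
  nlinarith

variable {n : ℕ} {κ₀ κ₁ κ₂ : Type*} [Fintype κ₀] [DecidableEq κ₀] [Fintype κ₁] [DecidableEq κ₁]
  [Fintype κ₂] [DecidableEq κ₂]

theorem gram_det_nonneg (M : Matrix (Fin n) κ₀ ℝ) : 0 ≤ (Mᵀ * M).det := by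
  have := (posSemidef_conjTranspose_mul_self M).det_nonneg
  rwa [conjTranspose_eq_transpose_of_trivial] at this

/-- The Gram determinant of two families. -/
theorem det_gram_fromCols {U : Matrix (Fin n) κ₀ ℝ} (V : Matrix (Fin n) κ₁ ℝ)
    (hU : Function.Injective U.mulVec) :
    ((fromCols U V)ᵀ * fromCols U V).det =
      (Uᵀ * U).det * (((1 - colProj U) * V)ᵀ * ((1 - colProj U) * V)).det := by
  have hu : IsUnit (Uᵀ * U) := (gram_posDef hU).isUnit
  let _ := hu.invertible
  -- The Schur complement of UᵀU is the Gram matrix of the part of V orthogonal to U.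
  rw [transpose_fromCols, fromRows_mul_fromCols, det_fromBlocks₁₁]
  congr 2
  have h1 : (1 - colProj U) * (1 - colProj U) = 1 - colProj U := by
    rw [Matrix.sub_mul, Matrix.mul_sub, Matrix.mul_sub, colProj_mul_self hU]
    simp
  rw [transpose_mul, transpose_sub, transpose_one, colProj_transpose,
    show Vᵀ * (1 - colProj U) * ((1 - colProj U) * V) =
      Vᵀ * ((1 - colProj U) * (1 - colProj U)) * V by simp only [Matrix.mul_assoc], h1,
    Matrix.mul_sub, Matrix.sub_mul, Matrix.mul_one, invOf_eq_nonsing_inv]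
  simp only [colProj, Matrix.mul_assoc]

/-- Pythagoras: the Gram matrix of W is the sum of the Gram matrices of its components orthogonal to
V and in V, both positive semidefinite. -/
theorem det_gram_sub_colProj_le {V : Matrix (Fin n) κ₁ ℝ} (W : Matrix (Fin n) κ₂ ℝ)
    (hV : Function.Injective V.mulVec) :
    (((1 - colProj V) * W)ᵀ * ((1 - colProj V) * W)).det ≤ (Wᵀ * W).det := by
  have h1 : Wᵀ * W = ((1 - colProj V) * W)ᵀ * ((1 - colProj V) * W) +
      (colProj V * W)ᵀ * (colProj V * W) := by
    simp only [transpose_mul, transpose_sub, transpose_one, colProj_transpose, Matrix.mul_assoc]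
    rw [← Matrix.mul_add]
    congr 1
    rw [← Matrix.mul_assoc, ← Matrix.mul_assoc, ← Matrix.add_mul, colProj_mul_self hV,
      Matrix.sub_mul, Matrix.mul_sub, Matrix.mul_sub, colProj_mul_self hV]
    simp
  rw [h1]
  have h2 := posSemidef_conjTranspose_mul_self ((1 - colProj V) * W)
  have h3 := posSemidef_conjTranspose_mul_self (colProj V * W)
  rw [conjTranspose_eq_transpose_of_trivial] at h2 h3
  exact det_le_det_add h2 h3

theorem injective_of_det_gram_pos {V : Matrix (Fin n) κ₁ ℝ} (h : 0 < (Vᵀ * V).det) :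
    Function.Injective V.mulVec := by
  intro x y hxy
  have h1 : (Vᵀ * V) *ᵥ x = (Vᵀ * V) *ᵥ y := by
    rw [← mulVec_mulVec, ← mulVec_mulVec, hxy]
  have h2 : IsUnit (Vᵀ * V) := (isUnit_iff_isUnit_det _).2 h.ne'.isUnit
  exact (mulVec_injective_iff_isUnit.2 h2) h1

theorem injective_fromCols_left {U : Matrix (Fin n) κ₀ ℝ} {V : Matrix (Fin n) κ₁ ℝ}
    (h : Function.Injective (fromCols U V).mulVec) : Function.Injective U.mulVec := by
  intro x y hxy
  have h1 := @h (Sum.elim x 0) (Sum.elim y 0) (by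
    simp only [fromCols_mulVec, Sum.elim_comp_inl, Sum.elim_comp_inr, hxy])
  exact funext fun i => congrFun h1 (Sum.inl i)

/-- The Gram determinant is submodular. -/
theorem det_gram_submodular {U : Matrix (Fin n) κ₀ ℝ} {V : Matrix (Fin n) κ₁ ℝ}
    (W : Matrix (Fin n) κ₂ ℝ) (hUV : Function.Injective (fromCols U V).mulVec) :
    (Uᵀ * U).det * ((fromCols U (fromCols V W))ᵀ * fromCols U (fromCols V W)).det ≤
      ((fromCols U V)ᵀ * fromCols U V).det * ((fromCols U W)ᵀ * fromCols U W).det := by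
  have hU := injective_fromCols_left hUV
  set Q := 1 - colProj U with hQ
  have h1 := (gram_posDef hUV).det_pos
  rw [det_gram_fromCols V hU, ← hQ] at h1
  have hU0 := (gram_posDef hU).det_pos
  have h2 : 0 < ((Q * V)ᵀ * (Q * V)).det := pos_of_mul_pos_right h1 hU0.le
  have hV := injective_of_det_gram_pos h2
  rw [det_gram_fromCols V hU, det_gram_fromCols W hU, det_gram_fromCols (fromCols V W) hU, ← hQ,
    mul_fromCols, det_gram_fromCols _ hV]
  -- After factoring out U on both sides and QV on the left, it remains to see that projecting QW
  -- away from QV does not increase its volume.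
  have h3 := det_gram_sub_colProj_le (Q * W) hV
  calc _ = (Uᵀ * U).det * (Uᵀ * U).det * ((Q * V)ᵀ * (Q * V)).det *
        (((1 - colProj (Q * V)) * (Q * W))ᵀ * ((1 - colProj (Q * V)) * (Q * W))).det := by ring
    _ ≤ (Uᵀ * U).det * (Uᵀ * U).det * ((Q * V)ᵀ * (Q * V)).det *
        ((Q * W)ᵀ * (Q * W)).det := by gcongr
    _ = _ := by ring

end DetIneq

/-! ### Covolumes and Gram determinants -/

section Covolume

set_option linter.unusedSectionVars false

variable {n : ℕ} {κ : Type*} [Fintype κ] [DecidableEq κ]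

/-- The matrix whose columns are the given vectors. -/
def colMat (v : κ → EuclideanSpace ℝ (Fin n)) : Matrix (Fin n) κ ℝ := of fun i k => v k i

theorem colMat_mulVec (v : κ → EuclideanSpace ℝ (Fin n)) (x : κ → ℝ) :
    colMat v *ᵥ x = (∑ k, x k • v k).ofLp := by
  ext i
  simp [mulVec, dotProduct, colMat, mul_comm]

theorem colMat_injective_iff (v : κ → EuclideanSpace ℝ (Fin n)) :
    Function.Injective (colMat v).mulVec ↔ LinearIndependent ℝ v := by
  rw [Fintype.linearIndependent_iff]
  constructor
  · intro h g hg
    have h1 : colMat v *ᵥ g = colMat v *ᵥ 0 := by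
      rw [colMat_mulVec, hg, mulVec_zero]; rfl
    exact fun i => congrFun (h h1) i
  · intro h x y hxy
    rw [colMat_mulVec, colMat_mulVec] at hxy
    have h1 : ∑ k, (x k - y k) • v k = 0 := by
      simp only [sub_smul, Finset.sum_sub_distrib]
      rw [sub_eq_zero]
      exact WithLp.ofLp_injective _ hxy
    exact funext fun k => sub_eq_zero.1 (h _ h1 k)

variable (Γ : Submodule ℤ (EuclideanSpace ℝ (Fin n))) [DiscreteTopology Γ]

instance discreteTopology_comap_span :
    DiscreteTopology (ZLattice.comap ℝ Γ (Submodule.span ℝ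
      (Γ : Set (EuclideanSpace ℝ (Fin n)))).subtype) :=
  ZLattice.comap_discreteTopology ℝ Γ (continuous_subtype_val) (Submodule.injective_subtype _)

instance isZLattice_comap_span :
    IsZLattice ℝ (ZLattice.comap ℝ Γ (Submodule.span ℝ
      (Γ : Set (EuclideanSpace ℝ (Fin n)))).subtype) :=
  ⟨by rw [ZLattice.coe_comap]; exact Submodule.span_span_coe_preimage⟩

variable {Γ}

/-- The basis of the lattice inside its real span. -/
def spanBasis (b : Module.Basis κ ℤ Γ) :
    Module.Basis κ ℤ (ZLattice.comap ℝ Γ (Submodule.span ℝ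
      (Γ : Set (EuclideanSpace ℝ (Fin n)))).subtype) :=
  b.map (Submodule.comapSubtypeEquivOfLe (q := (Submodule.span ℝ
      (Γ : Set (EuclideanSpace ℝ (Fin n)))).restrictScalars ℤ)
    (fun _ hx => Submodule.subset_span hx)).symm

theorem coe_spanBasis (b : Module.Basis κ ℤ Γ) (k : κ) :
    ((spanBasis b k : Submodule.span ℝ (Γ : Set (EuclideanSpace ℝ (Fin n)))) :
      EuclideanSpace ℝ (Fin n)) = b k := rfl

theorem linearIndependent_basis (b : Module.Basis κ ℤ Γ) :
    LinearIndependent ℝ fun k => (b k : EuclideanSpace ℝ (Fin n)) := by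
  have h := ((spanBasis b).ofZLatticeBasis ℝ _).linearIndependent
  have h2 := h.map' (Submodule.span ℝ (Γ : Set (EuclideanSpace ℝ (Fin n)))).subtype
    (Submodule.ker_subtype _)
  have h3 : (fun k => (b k : EuclideanSpace ℝ (Fin n))) =
      (Submodule.span ℝ (Γ : Set (EuclideanSpace ℝ (Fin n)))).subtype ∘
        (spanBasis b).ofZLatticeBasis ℝ _ := by
    ext1 k
    rw [Function.comp_apply, Module.Basis.ofZLatticeBasis_apply, Submodule.subtype_apply,
      coe_spanBasis]
  rw [h3]
  exact h2

theorem colMat_basis_injective (b : Module.Basis κ ℤ Γ) :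
    Function.Injective (colMat fun k => (b k : EuclideanSpace ℝ (Fin n))).mulVec :=
  (colMat_injective_iff _).2 (linearIndependent_basis b)

theorem finrank_span_eq (Γ : Submodule ℤ (EuclideanSpace ℝ (Fin n))) [DiscreteTopology Γ] :
    Module.finrank ℝ (Submodule.span ℝ (Γ : Set (EuclideanSpace ℝ (Fin n)))) =
      Module.finrank ℤ Γ := by
  have b := Module.finBasis ℤ Γ
  rw [Module.finrank_eq_card_basis ((spanBasis b).ofZLatticeBasis ℝ _), Fintype.card_fin]

/-- The covolume is the square root of the Gram determinant of a basis. -/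
theorem cov_eq (b : Module.Basis κ ℤ Γ) :
    cov Γ = Real.sqrt ((colMat fun k => (b k : EuclideanSpace ℝ (Fin n)))ᵀ *
      colMat fun k => (b k : EuclideanSpace ℝ (Fin n))).det := by
  set F := Submodule.span ℝ (Γ : Set (EuclideanSpace ℝ (Fin n)))
  have hcard : Module.finrank ℝ F = Fintype.card κ :=
    Module.finrank_eq_card_basis ((spanBasis b).ofZLatticeBasis ℝ _)
  let b₀ : OrthonormalBasis κ ℝ F :=
    (stdOrthonormalBasis ℝ F).reindex (Fintype.equivOfCardEq (by rw [Fintype.card_fin, hcard]))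
  -- An orthonormal basis of the span has a fundamental domain of volume 1, so the covolume is the
  -- absolute determinant of the coordinate matrix; the square of that determinant is the Gram
  -- determinant.
  have h1 : cov Γ = |b₀.toBasis.det ((↑) ∘ spanBasis b)| := by
    rw [cov, ZLattice.covolume_eq_det_mul_measureReal _ _ (spanBasis b) b₀.toBasis]
    have h2 : MeasureTheory.Measure.real MeasureTheory.MeasureSpace.volume
        (ZSpan.fundamentalDomain b₀.toBasis) = 1 := by
      rw [MeasureTheory.measureReal_def,
        MeasureTheory.measure_congr (ZSpan.fundamentalDomain_ae_parallelepiped _ _)]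
      have := b₀.volume_parallelepiped
      rw [OrthonormalBasis.coe_toBasis]
      rw [this]; rfl
    rw [h2, mul_one]
  rw [h1, ← Real.sqrt_sq_eq_abs, sq, Module.Basis.det_apply]
  congr 1
  conv_lhs => enter [1]; rw [← det_transpose]
  rw [← det_mul]
  congr 1
  ext a c
  rw [mul_apply, mul_apply]
  have h2 := b₀.sum_inner_mul_inner (spanBasis b a : F) (spanBasis b c : F)
  rw [Submodule.coe_inner, coe_spanBasis, coe_spanBasis, PiLp.inner_apply] at h2
  simp only [RCLike.inner_apply, conj_trivial] at h2
  calc _ = ∑ i, inner ℝ (spanBasis b a : F) (b₀ i) * inner ℝ (b₀ i) (spanBasis b c : F) := by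
        refine Finset.sum_congr rfl fun i _ => ?_
        simp only [transpose_apply, Module.Basis.toMatrix_apply, Function.comp_apply,
          OrthonormalBasis.coe_toBasis_repr_apply, b₀.repr_apply_apply]
        rw [real_inner_comm]
    _ = _ := by
        rw [h2]
        refine Finset.sum_congr rfl fun i _ => ?_
        simp [colMat, mul_comm]

theorem cov_pos (Γ : Submodule ℤ (EuclideanSpace ℝ (Fin n))) [DiscreteTopology Γ] : 0 < cov Γ := by
  have b := Module.finBasis ℤ Γ
  rw [cov_eq b]
  exact Real.sqrt_pos.2 (gram_posDef (colMat_basis_injective b)).det_pos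

/-- The covolume is at most the volume spanned by a maximal independent family. -/
theorem cov_le {v : κ → EuclideanSpace ℝ (Fin n)} (hv : ∀ k, v k ∈ Γ)
    (hli : LinearIndependent ℤ v) (hcard : Fintype.card κ = Module.finrank ℤ Γ) :
    cov Γ ≤ Real.sqrt ((colMat v)ᵀ * colMat v).det := by
  let b : Module.Basis κ ℤ Γ :=
    (Module.finBasis ℤ Γ).reindex (Fintype.equivOfCardEq (by rw [Fintype.card_fin, hcard]))
  rw [cov_eq b]
  -- The integral coordinate matrix of the family. The Gram determinant gets multiplied by (det Z)²,
  -- at least 1 because det Z is a nonzero integer.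
  let Z : Matrix κ κ ℤ := b.toMatrix fun k => (⟨v k, hv k⟩ : Γ)
  have hZ : colMat v = (colMat fun k => (b k : EuclideanSpace ℝ (Fin n))) *
      Z.map (Int.cast : ℤ → ℝ) := by
    ext i k
    have h1 := b.sum_repr (⟨v k, hv k⟩ : Γ)
    have h2 := congrArg (fun x : Γ => (x : EuclideanSpace ℝ (Fin n)) i) h1
    simp only [AddSubmonoidClass.coe_finsetSum, SetLike.val_smul] at h2
    have h3 : colMat v i k = v k i := rfl
    rw [h3, ← h2, mul_apply]
    simp only [WithLp.ofLp_sum, Finset.sum_apply, PiLp.smul_apply, map_apply, Z,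
      Module.Basis.toMatrix_apply, zsmul_eq_mul]
    exact Finset.sum_congr rfl fun j _ => mul_comm _ _
  have hdet : Z.det ≠ 0 := by
    intro h0
    obtain ⟨w, hw, hw0⟩ := exists_mulVec_eq_zero_iff.2 h0
    apply hw
    rw [Fintype.linearIndependent_iff] at hli
    refine funext fun k => hli w ?_ k
    have h1 : ∑ k, w k • (⟨v k, hv k⟩ : Γ) = 0 := by
      rw [← b.repr.map_eq_zero_iff]
      ext j
      have h2 := congrFun hw0 j
      simp only [mulVec, dotProduct, Z, Module.Basis.toMatrix_apply, Pi.zero_apply] at h2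
      simp only [map_sum, map_smul, Finsupp.coe_finsetSum, Finset.sum_apply, Finsupp.smul_apply,
        Finsupp.zero_apply, smul_eq_mul]
      rw [← h2]
      exact Finset.sum_congr rfl fun _ _ => mul_comm _ _
    have h2 := congrArg (fun x : Γ => (x : EuclideanSpace ℝ (Fin n))) h1
    simpa using h2
  rw [hZ]
  apply Real.sqrt_le_sqrt
  set M := colMat fun k => (b k : EuclideanSpace ℝ (Fin n))
  have h1 : (M * Z.map (Int.cast : ℤ → ℝ))ᵀ * (M * Z.map (Int.cast : ℤ → ℝ)) =
      (Z.map (Int.cast : ℤ → ℝ))ᵀ * (Mᵀ * M) * Z.map (Int.cast : ℤ → ℝ) := by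
    simp only [transpose_mul, Matrix.mul_assoc]
  have h2 : (Z.map (Int.cast : ℤ → ℝ)).det = (Z.det : ℝ) := (Int.cast_det Z).symm
  rw [h1, det_mul, det_mul, det_transpose, h2]
  have h3 : (1 : ℝ) ≤ (Z.det : ℝ) ^ 2 := by
    have : 1 ≤ Z.det ^ 2 := by
      have := sq_pos_of_ne_zero hdet
      omega
    exact_mod_cast this
  have h4 := gram_det_nonneg M
  nlinarith

theorem projOf_span_eq (b : Module.Basis κ ℤ Γ) :
    projOf (Submodule.span ℝ (Γ : Set (EuclideanSpace ℝ (Fin n)))) =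
      colProj (colMat fun k => (b k : EuclideanSpace ℝ (Fin n))) := by
  set M := colMat fun k => (b k : EuclideanSpace ℝ (Fin n)) with hM
  have hinj := colMat_basis_injective b
  refine projOf_eq ⟨colProj_mul_self hinj, colProj_transpose _⟩ (fun x => ?_) ?_
  · have h1 : toEuclideanLin (colProj M) x =
        ∑ k, (((Mᵀ * M)⁻¹ * Mᵀ) *ᵥ x.ofLp) k • (b k : EuclideanSpace ℝ (Fin n)) := by
      apply WithLp.ofLp_injective
      rw [← colMat_mulVec, ← hM, mulVec_mulVec, ← Matrix.mul_assoc]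
      rfl
    rw [h1]
    exact Submodule.sum_mem _ fun k _ => Submodule.smul_mem _ _ (Submodule.subset_span (b k).2)
  · have h1 : ∀ k, toEuclideanLin (colProj M) (b k : EuclideanSpace ℝ (Fin n)) = b k := by
      intro k
      have h2 := colProj_mul hinj
      ext i
      rw [toEuclideanLin_apply_apply]
      have h3 := congrFun (congrFun h2 i) k
      rw [mul_apply] at h3
      exact h3
    have h4 : Submodule.span ℝ (Γ : Set (EuclideanSpace ℝ (Fin n))) ≤
        LinearMap.eqLocus (toEuclideanLin (colProj M)) LinearMap.id := by
      rw [Submodule.span_le]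
      intro x hx
      have h5 := b.sum_repr (⟨x, hx⟩ : Γ)
      have h6 := congrArg (fun x : Γ => (x : EuclideanSpace ℝ (Fin n))) h5
      simp only [AddSubmonoidClass.coe_finsetSum, SetLike.val_smul] at h6
      rw [SetLike.mem_coe, LinearMap.mem_eqLocus, LinearMap.id_apply, ← h6, map_sum]
      refine Finset.sum_congr rfl fun k _ => ?_
      rw [map_zsmul, h1]
    exact fun x hx => h4 hx

end Covolume

end GTemplate

namespace GTemplate

open Matrix

/-! ### Primitive subgroups -/

section Primitive

variable {n : ℕ}

theorem discreteTopology_of_le {Γ Λ : Submodule ℤ (EuclideanSpace ℝ (Fin n))} (h : Γ ≤ Λ)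
    [DiscreteTopology Λ] : DiscreteTopology Γ :=
  DiscreteTopology.of_subset (s := (Λ : Set (EuclideanSpace ℝ (Fin n)))) inferInstance h

/-- A basis of a lattice adapted to a primitive subgroup. -/
theorem exists_adapted_basis {A N : Submodule ℤ (EuclideanSpace ℝ (Fin n))} [DiscreteTopology A]
    (hNA : N ≤ A) (hprim : ∀ x ∈ A, ∀ m : ℤ, m ≠ 0 → m • x ∈ N → x ∈ N) {κ : Type}
    (u : Module.Basis κ ℤ N) :
    ∃ (r : ℕ) (b : Module.Basis (κ ⊕ Fin r) ℤ A),
      ∀ i, (b (Sum.inl i) : EuclideanSpace ℝ (Fin n)) = u i := by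
  let N' : Submodule ℤ A := N.comap A.subtype
  -- Primitivity makes the quotient torsion-free, hence free, so that the basis of N extends to A.
  have : Module.IsTorsionFree ℤ (A ⧸ N') := by
    refine Module.IsTorsionFree.of_smul_eq_zero fun m q hq => ?_
    obtain ⟨x, rfl⟩ := N'.mkQ_surjective q
    rw [← map_smul, Submodule.mkQ_apply, Submodule.Quotient.mk_eq_zero] at hq
    rw [or_iff_not_imp_left]
    intro hm
    rw [Submodule.mkQ_apply, Submodule.Quotient.mk_eq_zero]
    exact hprim x x.2 m hm hq
  let u' : Module.Basis κ ℤ N' := u.map (Submodule.comapSubtypeEquivOfLe hNA).symm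
  refine ⟨_, u'.sumQuot (Module.finBasis ℤ (A ⧸ N')), fun i => ?_⟩
  rw [Module.Basis.sumQuot_inl]
  rfl

theorem finrank_sup_add_finrank_inf {A B : Submodule ℤ (EuclideanSpace ℝ (Fin n))}
    [DiscreteTopology A] [DiscreteTopology B] [DiscreteTopology (A ⊔ B : Submodule ℤ _)] :
    Module.finrank ℤ (A ⊔ B : Submodule ℤ (EuclideanSpace ℝ (Fin n))) +
      Module.finrank ℤ (A ⊓ B : Submodule ℤ (EuclideanSpace ℝ (Fin n))) =
      Module.finrank ℤ A + Module.finrank ℤ B := by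
  have := discreteTopology_of_le (inf_le_left : A ⊓ B ≤ A)
  have h := Submodule.rank_sup_add_rank_inf_eq A B
  rw [← Module.finrank_eq_rank, ← Module.finrank_eq_rank, ← Module.finrank_eq_rank,
    ← Module.finrank_eq_rank] at h
  exact_mod_cast h

theorem colMat_sum_elim {κ₀ κ₁ : Type*} [Fintype κ₀] [Fintype κ₁] [DecidableEq κ₀]
    [DecidableEq κ₁] (u : κ₀ → EuclideanSpace ℝ (Fin n))
    (v : κ₁ → EuclideanSpace ℝ (Fin n)) :
    colMat (Sum.elim u v) = fromCols (colMat u) (colMat v) := by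
  ext i (k | k) <;> rfl

/-- Submodularity of covolumes. -/
theorem cov_submodular {A B J : Submodule ℤ (EuclideanSpace ℝ (Fin n))} [DiscreteTopology A]
    [DiscreteTopology B] [DiscreteTopology J]
    (hA : ∀ x ∈ A, ∀ m : ℤ, m ≠ 0 → m • x ∈ B → x ∈ B)
    (hB : ∀ x ∈ B, ∀ m : ℤ, m ≠ 0 → m • x ∈ A → x ∈ A) (hJ : A ⊔ B ≤ J)
    (hr : Module.finrank ℤ J + Module.finrank ℤ (A ⊓ B : Submodule ℤ _) =
      Module.finrank ℤ A + Module.finrank ℤ B) :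
    cov (A ⊓ B) * cov J ≤ cov A * cov B := by
  have hN := discreteTopology_of_le (inf_le_left : A ⊓ B ≤ A)
  let u := Module.finBasis ℤ (A ⊓ B : Submodule ℤ (EuclideanSpace ℝ (Fin n)))
  obtain ⟨r₁, a, ha⟩ := exists_adapted_basis (inf_le_left : A ⊓ B ≤ A)
    (fun x hx m hm hmx => ⟨hx, hA x hx m hm hmx.2⟩) u
  obtain ⟨r₂, b, hb⟩ := exists_adapted_basis (inf_le_right : A ⊓ B ≤ B)
    (fun x hx m hm hmx => ⟨hB x hx m hm hmx.1, hx⟩) u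
  set U : Fin _ → EuclideanSpace ℝ (Fin n) := fun i => u i with hU
  set V : Fin r₁ → EuclideanSpace ℝ (Fin n) := fun i => a (Sum.inr i) with hV
  set W : Fin r₂ → EuclideanSpace ℝ (Fin n) := fun i => b (Sum.inr i) with hW
  have haE : (fun k => (a k : EuclideanSpace ℝ (Fin n))) = Sum.elim U V := by
    ext1 (k | k)
    · exact ha k
    · rfl
  have hbE : (fun k => (b k : EuclideanSpace ℝ (Fin n))) = Sum.elim U W := by
    ext1 (k | k)
    · exact hb k
    · rfl
  have hliA : LinearIndependent ℤ (Sum.elim U V) := by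
    rw [← haE]; exact a.linearIndependent.map' A.subtype (Submodule.ker_subtype _)
  have hliB : LinearIndependent ℤ (Sum.elim U W) := by
    rw [← hbE]; exact b.linearIndependent.map' B.subtype (Submodule.ker_subtype _)
  have hUA : ∀ k, U k ∈ A := fun k => (u k).2.1
  have hUB : ∀ k, U k ∈ B := fun k => (u k).2.2
  have hVA : ∀ k, V k ∈ A := fun k => (a _).2
  have hWB : ∀ k, W k ∈ B := fun k => (b _).2
  -- In a relation the W-part lies in A ⊓ B, hence is a combination of U. Independence of (U, W)
  -- kills it, and independence of (U, V) kills the rest.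
  have hli : LinearIndependent ℤ (Sum.elim U (Sum.elim V W)) := by
    rw [Fintype.linearIndependent_iff] at hliA hliB ⊢
    intro g hg
    simp only [Fintype.sum_sum_type, Sum.elim_inl, Sum.elim_inr] at hg hliA hliB
    have hc : ∑ k, g (Sum.inr (Sum.inr k)) • W k ∈ A ⊓ B := by
      refine ⟨?_, Submodule.sum_mem _ fun k _ => Submodule.smul_mem _ _ (hWB k)⟩
      rw [← add_assoc] at hg
      rw [SetLike.mem_coe, eq_neg_of_add_eq_zero_right hg]
      refine A.neg_mem (A.add_mem ?_ ?_)
      · exact Submodule.sum_mem _ fun k _ => Submodule.smul_mem _ _ (hUA k)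
      · exact Submodule.sum_mem _ fun k _ => Submodule.smul_mem _ _ (hVA k)
    have hrepr := u.sum_repr ⟨_, hc⟩
    have hrepr2 := congrArg (fun x : (A ⊓ B : Submodule ℤ (EuclideanSpace ℝ (Fin n))) =>
      (x : EuclideanSpace ℝ (Fin n))) hrepr
    simp only [AddSubmonoidClass.coe_finsetSum, SetLike.val_smul] at hrepr2
    have hw : ∀ k, g (Sum.inr (Sum.inr k)) = 0 := by
      have h1 := hliB (Sum.elim (fun i => -(u.repr ⟨_, hc⟩ i)) fun k => g (Sum.inr (Sum.inr k))) (by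
        simp only [Sum.elim_inl, Sum.elim_inr, neg_smul, Finset.sum_neg_distrib]
        exact neg_add_eq_zero.2 hrepr2)
      exact fun k => h1 (Sum.inr k)
    have h2 := hliA (Sum.elim (fun i => g (Sum.inl i)) fun k => g (Sum.inr (Sum.inl k))) (by
      simp only [Sum.elim_inl, Sum.elim_inr]
      simpa [hw] using hg)
    rintro (k | k | k)
    · exact h2 (Sum.inl k)
    · exact h2 (Sum.inr k)
    · exact hw k
  have hcA := Module.finrank_eq_card_basis a
  have hcB := Module.finrank_eq_card_basis b
  -- The family (U, V, W) has rank J many elements by `hr`; it may span only a subgroup of finite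
  -- index in J, which the inequality of `cov_le` permits.
  have hJle := cov_le (Γ := J) (v := Sum.elim U (Sum.elim V W)) (by
    rintro (k | k | k)
    · exact hJ (Submodule.mem_sup_left (hUA k))
    · exact hJ (Submodule.mem_sup_left (hVA k))
    · exact hJ (Submodule.mem_sup_right (hWB k))) hli (by
    simp only [Fintype.card_sum, Fintype.card_fin] at hcA hcB ⊢
    omega)
  have hinj := colMat_basis_injective a
  have h3 := cov_pos (A ⊓ B : Submodule ℤ (EuclideanSpace ℝ (Fin n)))
  refine (mul_le_mul_of_nonneg_left hJle h3.le).trans ?_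
  rw [cov_eq u, cov_eq a, cov_eq b]
  simp only [haE, hbE] at hinj ⊢
  simp only [colMat_sum_elim] at hinj ⊢
  rw [← Real.sqrt_mul (gram_det_nonneg _), ← Real.sqrt_mul (gram_det_nonneg _)]
  exact Real.sqrt_le_sqrt (det_gram_submodular _ hinj)

/-- A subgroup of `Λ` which contains all points of `Λ` in its real span. -/
structure IsPrimitive (Λ Γ : Submodule ℤ (EuclideanSpace ℝ (Fin n))) : Prop where
  le : Γ ≤ Λ
  mem : ∀ x ∈ Λ, x ∈ Submodule.span ℝ (Γ : Set (EuclideanSpace ℝ (Fin n))) → x ∈ Γ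

variable {Λ : Submodule ℤ (EuclideanSpace ℝ (Fin n))}

theorem IsPrimitive.mem_of_smul {Γ : Submodule ℤ (EuclideanSpace ℝ (Fin n))}
    (h : IsPrimitive Λ Γ) {x : EuclideanSpace ℝ (Fin n)} (hx : x ∈ Λ) {m : ℤ} (hm : m ≠ 0)
    (hmx : m • x ∈ Γ) : x ∈ Γ := by
  refine h.mem x hx ?_
  have h1 : x = (m : ℝ)⁻¹ • (m • x) := by
    rw [← Int.cast_smul_eq_zsmul ℝ m x, smul_smul, inv_mul_cancel₀ (Int.cast_ne_zero.2 hm),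
      one_smul]
  rw [h1]
  exact Submodule.smul_mem _ _ (Submodule.subset_span hmx)

theorem IsPrimitive.inf {A B : Submodule ℤ (EuclideanSpace ℝ (Fin n))} (hA : IsPrimitive Λ A)
    (hB : IsPrimitive Λ B) : IsPrimitive Λ (A ⊓ B) where
  le := inf_le_left.trans hA.le
  mem x hx hs := ⟨hA.mem x hx (Submodule.span_mono (fun _ h => h.1) hs),
    hB.mem x hx (Submodule.span_mono (fun _ h => h.2) hs)⟩

/-- The primitive subgroup generated by `Γ`. -/
def saturation (Λ Γ : Submodule ℤ (EuclideanSpace ℝ (Fin n))) :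
    Submodule ℤ (EuclideanSpace ℝ (Fin n)) :=
  Λ ⊓ (Submodule.span ℝ (Γ : Set (EuclideanSpace ℝ (Fin n)))).restrictScalars ℤ

theorem le_saturation {Γ : Submodule ℤ (EuclideanSpace ℝ (Fin n))} (h : Γ ≤ Λ) :
    Γ ≤ saturation Λ Γ := fun _ hx => ⟨h hx, Submodule.subset_span hx⟩

theorem span_saturation {Γ : Submodule ℤ (EuclideanSpace ℝ (Fin n))} (h : Γ ≤ Λ) :
    Submodule.span ℝ (saturation Λ Γ : Set (EuclideanSpace ℝ (Fin n))) =
      Submodule.span ℝ (Γ : Set (EuclideanSpace ℝ (Fin n))) :=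
  le_antisymm (Submodule.span_le.2 fun _ hx => hx.2) (Submodule.span_mono (le_saturation h))

theorem isPrimitive_saturation {Γ : Submodule ℤ (EuclideanSpace ℝ (Fin n))} (h : Γ ≤ Λ) :
    IsPrimitive Λ (saturation Λ Γ) where
  le := inf_le_left
  mem x hx hs := ⟨hx, by rw [span_saturation h] at hs; exact hs⟩

theorem IsPrimitive.eq_of_le [DiscreteTopology Λ]
    {A B : Submodule ℤ (EuclideanSpace ℝ (Fin n))} (hA : IsPrimitive Λ A) (hB : B ≤ Λ)
    (h : A ≤ B) (hr : Module.finrank ℤ A = Module.finrank ℤ B) : A = B := by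
  have := discreteTopology_of_le hA.le
  have := discreteTopology_of_le hB
  refine le_antisymm h fun x hx => hA.mem x (hB hx) ?_
  have h1 : Submodule.span ℝ (A : Set (EuclideanSpace ℝ (Fin n))) =
      Submodule.span ℝ (B : Set (EuclideanSpace ℝ (Fin n))) :=
    Submodule.eq_of_le_of_finrank_eq (Submodule.span_mono h)
      (by rw [finrank_span_eq, finrank_span_eq, hr])
  rw [h1]
  exact Submodule.subset_span hx

theorem isPrimitive_bot [DiscreteTopology Λ] : IsPrimitive Λ ⊥ where
  le := bot_le
  mem x _ hs := by simpa using hs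

theorem isPrimitive_self : IsPrimitive Λ Λ := ⟨le_rfl, fun _ hx _ => hx⟩

end Primitive

end GTemplate

namespace GTemplate

open Matrix

/-! ### Finiteness of primitive subgroups of bounded covolume -/

section Finiteness

variable {n : ℕ}

/-- The constant c is the least eigenvalue, capped at 1 so that later c^n ≤ c^r for all ranks r ≤ n.
-/
theorem exists_sub_smul_one_posSemidef {κ : Type*} [Fintype κ] [DecidableEq κ]
    {S : Matrix κ κ ℝ} (hS : S.PosDef) :
    ∃ c : ℝ, 0 < c ∧ c ≤ 1 ∧ (S - c • (1 : Matrix κ κ ℝ)).PosSemidef := by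
  obtain ⟨c, hc0, hc1, hc⟩ : ∃ c : ℝ, 0 < c ∧ c ≤ 1 ∧ ∀ i, c ≤ hS.1.eigenvalues i := by
    rcases isEmpty_or_nonempty κ with h | h
    · exact ⟨1, one_pos, le_rfl, fun i => (h.false i).elim⟩
    · obtain ⟨i, hi⟩ := Finite.exists_min hS.1.eigenvalues
      exact ⟨min 1 (hS.1.eigenvalues i), lt_min one_pos (hS.eigenvalues_pos i), min_le_left _ _,
        fun j => (min_le_right _ _).trans (hi j)⟩
  refine ⟨c, hc0, hc1, ?_⟩
  have h1 : S - c • (1 : Matrix κ κ ℝ) = hS.1.eigenvectorUnitary.1 *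
      diagonal (fun i => hS.1.eigenvalues i - c) * hS.1.eigenvectorUnitary.1ᴴ := by
    have h2 := hS.1.spectral_theorem
    rw [Unitary.conjStarAlgAut_apply] at h2
    have h3 : (diagonal fun i => hS.1.eigenvalues i - c) =
        diagonal (RCLike.ofReal ∘ hS.1.eigenvalues) - c • (1 : Matrix κ κ ℝ) := by
      ext i j
      by_cases hij : i = j
      · subst hij; simp
      · simp [hij]
    rw [h3, Matrix.mul_sub, Matrix.sub_mul, ← star_eq_conjTranspose, Matrix.mul_smul,
      Matrix.smul_mul, Matrix.mul_one]
    have h4 : (hS.1.eigenvectorUnitary : Matrix κ κ ℝ) * star (hS.1.eigenvectorUnitary : Matrix κ κ ℝ) = 1 :=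
      Unitary.coe_mul_star_self _
    rw [h4]
    congr 1
  rw [h1]
  exact (PosSemidef.diagonal fun i => sub_nonneg.2 (hc i)).mul_mul_conjTranspose_same _

theorem intCast_gram {κ : Type*} [Fintype κ] (z : Matrix (Fin n) κ ℤ) :
    ((z.map (Int.cast : ℤ → ℝ))ᵀ * z.map (Int.cast : ℤ → ℝ)) =
      (zᵀ * z).map (Int.cast : ℤ → ℝ) := by
  rw [← transpose_map]
  exact (Matrix.map_mul (f := Int.castRingHom ℝ)).symm

theorem det_intCast_gram {κ : Type*} [Fintype κ] [DecidableEq κ] (z : Matrix (Fin n) κ ℤ) :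
    ((z.map (Int.cast : ℤ → ℝ))ᵀ * z.map (Int.cast : ℤ → ℝ)).det = ((zᵀ * z).det : ℝ) := by
  rw [intCast_gram]
  exact (Int.cast_det _).symm

theorem det_intCast_gram_pos {κ : Type*} [Fintype κ] [DecidableEq κ] {z : Matrix (Fin n) κ ℤ}
    (hz : Function.Injective (z.map (Int.cast : ℤ → ℝ)).mulVec) : 1 ≤ (zᵀ * z).det := by
  have h1 := (gram_posDef hz).det_pos
  rw [det_intCast_gram] at h1
  have : 0 < (zᵀ * z).det := by exact_mod_cast h1
  omega

/-- The projection matrix of an integral matrix is a quotient of integers with denominator the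
Gram determinant. -/
theorem exists_int_colProj {κ : Type*} [Fintype κ] [DecidableEq κ] {z : Matrix (Fin n) κ ℤ}
    (hz : Function.Injective (z.map (Int.cast : ℤ → ℝ)).mulVec) :
    ∃ Q : Fin n → Fin n → ℤ, ∀ i j,
      colProj (z.map (Int.cast : ℤ → ℝ)) i j = (Q i j : ℝ) / ((zᵀ * z).det : ℝ) ∧
        |Q i j| ≤ (zᵀ * z).det := by
  -- The numerators come from the adjugate in place of the inverse; their size is bounded because
  -- entries of projection matrices have absolute value at most 1.
  let Q : Matrix (Fin n) (Fin n) ℤ := z * adjugate (zᵀ * z) * zᵀ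
  have hpos := det_intCast_gram_pos hz
  have hpos' : (0 : ℝ) < ((zᵀ * z).det : ℝ) := by exact_mod_cast hpos
  have hQ : ∀ i j, colProj (z.map (Int.cast : ℤ → ℝ)) i j = (Q i j : ℝ) / ((zᵀ * z).det : ℝ) := by
    intro i j
    have h3 : Q.map (Int.cast : ℤ → ℝ) = z.map (Int.cast : ℤ → ℝ) *
        adjugate ((zᵀ * z).map (Int.cast : ℤ → ℝ)) * (z.map (Int.cast : ℤ → ℝ))ᵀ := by
      have h4 : adjugate ((zᵀ * z).map (Int.cast : ℤ → ℝ)) =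
          (adjugate (zᵀ * z)).map (Int.cast : ℤ → ℝ) :=
        ((Int.castRingHom ℝ).map_adjugate (zᵀ * z)).symm
      rw [h4, ← transpose_map]
      change (z * adjugate (zᵀ * z) * zᵀ).map (Int.castRingHom ℝ) = _
      rw [Matrix.map_mul, Matrix.map_mul]
      rfl
    have h5 : (Q i j : ℝ) = Q.map (Int.cast : ℤ → ℝ) i j := rfl
    rw [h5, h3, colProj, inv_def, det_intCast_gram, intCast_gram, Ring.inverse_eq_inv',
      Matrix.mul_smul, Matrix.smul_mul, Matrix.smul_apply, smul_eq_mul, inv_mul_eq_div]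
  refine ⟨Q, fun i j => ⟨hQ i j, ?_⟩⟩
  have h1 := (IsProjMat.mk (colProj_mul_self hz) (colProj_transpose _)).abs_le_one i j
  rw [hQ, abs_div, abs_of_pos hpos', div_le_one hpos'] at h1
  exact_mod_cast h1

/-- There are finitely many primitive subgroups of bounded covolume. -/
theorem finite_primitive (Λ : Submodule ℤ (EuclideanSpace ℝ (Fin n))) [DiscreteTopology Λ]
    [IsZLattice ℝ Λ] (C : ℝ) : {Γ | IsPrimitive Λ Γ ∧ cov Γ ≤ C}.Finite := by
  classical
  have hcardΛ : Fintype.card (Module.Free.ChooseBasisIndex ℤ Λ) = Fintype.card (Fin n) := by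
    rw [← Module.finrank_eq_card_chooseBasisIndex, ZLattice.rank ℝ, finrank_euclideanSpace]
  let b : Module.Basis (Fin n) ℤ Λ :=
    (Module.Free.chooseBasis ℤ Λ).reindex (Fintype.equivOfCardEq hcardΛ)
  let β : Module.Basis (Fin n) ℝ (EuclideanSpace ℝ (Fin n)) := b.ofZLatticeBasis ℝ Λ
  set M : Matrix (Fin n) (Fin n) ℝ := colMat fun k => (b k : EuclideanSpace ℝ (Fin n)) with hM
  have hMinj : Function.Injective M.mulVec := colMat_basis_injective b
  obtain ⟨c, hc0, hc1, hc⟩ := exists_sub_smul_one_posSemidef (gram_posDef hMinj)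
  -- In lattice coordinates a primitive subgroup is determined by its projection matrix. Its entries
  -- are fractions whose denominator is an integral Gram determinant, at most C²/c^n when the
  -- covolume is at most C, so only finitely many matrices occur.
  obtain ⟨N, hN⟩ := exists_nat_ge (C ^ 2 / c ^ n)
  let fin : Set (Matrix (Fin n) (Fin n) ℝ) :=
    (fun p : ℤ × (Fin n → Fin n → ℤ) => of fun i j => (p.2 i j : ℝ) / (p.1 : ℝ)) ''
      (Set.Icc (1 : ℤ) N ×ˢ Set.pi Set.univ fun _ => Set.pi Set.univ fun _ => Set.Icc (-(N : ℤ)) N)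
  have hfin : fin.Finite := by
    refine Set.Finite.image _ ((Set.finite_Icc _ _).prod ?_)
    exact Set.Finite.pi fun _ => Set.Finite.pi fun _ => Set.finite_Icc (-(N : ℤ)) N
  have hx : ∀ x : EuclideanSpace ℝ (Fin n), M *ᵥ (β.repr x) = x.ofLp := by
    intro x
    rw [hM, colMat_mulVec]
    have := β.sum_repr x
    conv_rhs => rw [← this]
    simp [β]
  have hU : (⋃ P ∈ fin, {Γ : Submodule ℤ (EuclideanSpace ℝ (Fin n)) |
      (Γ : Set (EuclideanSpace ℝ (Fin n))) =
        {x | x ∈ Λ ∧ P *ᵥ (β.repr x) = β.repr x}}).Finite := by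
    refine hfin.biUnion fun P _ => Set.Subsingleton.finite fun A hA B hB => ?_
    exact SetLike.coe_injective (hA.trans hB.symm)
  refine hU.subset ?_
  rintro Γ ⟨hΓ, hcov⟩
  have := discreteTopology_of_le hΓ.le
  let a := Module.finBasis ℤ Γ
  let z : Matrix (Fin n) (Fin (Module.finrank ℤ Γ)) ℤ :=
    of fun i k => b.repr ⟨a k, hΓ.le (a k).2⟩ i
  set zr := z.map (Int.cast : ℤ → ℝ) with hzr
  have hMz : (colMat fun k => (a k : EuclideanSpace ℝ (Fin n))) = M * zr := by
    ext i k
    have h1 := b.sum_repr ⟨a k, hΓ.le (a k).2⟩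
    have h2 := congrArg (fun x : Λ => (x : EuclideanSpace ℝ (Fin n)) i) h1
    simp only [AddSubmonoidClass.coe_finsetSum, SetLike.val_smul] at h2
    have h3 : (colMat fun k => (a k : EuclideanSpace ℝ (Fin n))) i k =
      (a k : EuclideanSpace ℝ (Fin n)) i := rfl
    rw [h3, ← h2, mul_apply]
    simp only [WithLp.ofLp_sum, Finset.sum_apply, PiLp.smul_apply, zsmul_eq_mul]
    exact Finset.sum_congr rfl fun j _ => mul_comm _ _
  have hainj := colMat_basis_injective a
  have hzinj : Function.Injective zr.mulVec := by
    intro x y hxy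
    apply hainj
    rw [hMz, ← mulVec_mulVec, ← mulVec_mulVec, hxy]
  have hset : (Γ : Set (EuclideanSpace ℝ (Fin n))) =
      {x | x ∈ Λ ∧ colProj zr *ᵥ (β.repr x) = β.repr x} := by
    ext x
    constructor
    · intro hxΓ
      refine ⟨hΓ.le hxΓ, ?_⟩
      have h1 := a.sum_repr ⟨x, hxΓ⟩
      have h2 := congrArg (fun x : Γ => (x : EuclideanSpace ℝ (Fin n)).ofLp) h1
      simp only [AddSubmonoidClass.coe_finsetSum, SetLike.val_smul] at h2
      have h3 : β.repr x = zr *ᵥ fun k => ((a.repr ⟨x, hxΓ⟩ k : ℤ) : ℝ) := by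
        apply hMinj
        rw [hx, mulVec_mulVec, ← hMz, colMat_mulVec, ← h2]
        simp only [Int.cast_smul_eq_zsmul]
      rw [h3, mulVec_mulVec, colProj_mul hzinj]
    · rintro ⟨hxΛ, h1⟩
      refine hΓ.mem x hxΛ ?_
      have h2 : x.ofLp = (∑ k, (((zrᵀ * zr)⁻¹ * zrᵀ) *ᵥ β.repr x) k •
          (a k : EuclideanSpace ℝ (Fin n))).ofLp := by
        have h3 : zr *ᵥ ((zrᵀ * zr)⁻¹ * zrᵀ) *ᵥ β.repr x = β.repr x := by
          rw [mulVec_mulVec, ← Matrix.mul_assoc]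
          exact h1
        rw [← colMat_mulVec, hMz, ← mulVec_mulVec, h3, hx]
      rw [WithLp.ofLp_injective _ h2]
      exact Submodule.sum_mem _ fun k _ => Submodule.smul_mem _ _ (Submodule.subset_span (a k).2)
  refine Set.mem_biUnion (x := colProj zr) ?_ hset
  obtain ⟨Q, hQ⟩ := exists_int_colProj hzinj
  have hdet : (zᵀ * z).det ≤ N := by
    have h1 : c ^ n * ((zᵀ * z).det : ℝ) ≤ C ^ 2 := by
      have h2 : (zrᵀ * zr).det = ((zᵀ * z).det : ℝ) := det_intCast_gram z
      -- Since MᵀM - c is positive semidefinite, so is its conjugate by z, and determinants are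
      -- monotone.
      have h3 : c ^ (Module.finrank ℤ Γ) * (zrᵀ * zr).det ≤
          ((M * zr)ᵀ * (M * zr)).det := by
        have h4 : (M * zr)ᵀ * (M * zr) = c • (zrᵀ * zr) +
            zrᵀ * (Mᵀ * M - c • (1 : Matrix (Fin n) (Fin n) ℝ)) * zr := by
          simp only [transpose_mul, Matrix.mul_sub, Matrix.sub_mul, Matrix.mul_smul,
            Matrix.smul_mul, Matrix.mul_one, Matrix.mul_assoc]
          abel
        have h5 : c ^ (Module.finrank ℤ Γ) * (zrᵀ * zr).det = (c • (zrᵀ * zr)).det := by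
          rw [det_smul, Fintype.card_fin]
        rw [h4, h5]
        refine det_le_det_add ((gram_posDef hzinj).posSemidef.smul hc0.le) ?_
        have := hc.conjTranspose_mul_mul_same zr
        rwa [conjTranspose_eq_transpose_of_trivial] at this
      have h4 : ((M * zr)ᵀ * (M * zr)).det ≤ C ^ 2 := by
        rw [← hMz]
        rw [cov_eq a] at hcov
        have h0 := gram_det_nonneg (colMat fun k => (a k : EuclideanSpace ℝ (Fin n)))
        rw [← Real.sq_sqrt h0]
        gcongr
      have h5 : c ^ n ≤ c ^ (Module.finrank ℤ Γ) := by
        refine pow_le_pow_of_le_one hc0.le hc1 ?_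
        rw [← finrank_span_eq]
        refine (Submodule.finrank_le _).trans ?_
        rw [finrank_euclideanSpace_fin]
      have h6 := (gram_posDef hzinj).det_pos
      rw [← h2]
      nlinarith
    have h2 : ((zᵀ * z).det : ℝ) ≤ N := by
      refine le_trans ?_ hN
      rw [le_div_iff₀ (by positivity)]
      linarith
    exact_mod_cast h2
  refine ⟨((zᵀ * z).det, Q), ⟨⟨det_intCast_gram_pos hzinj, hdet⟩, ?_⟩, ?_⟩
  · intro i _ j _
    exact abs_le.1 ((hQ i j).2.trans hdet)
  · ext i j
    exact ((hQ i j).1).symm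

end Finiteness

end GTemplate

namespace GTemplate

open Matrix

/-! ### The flow on subgroups -/

section Flow

variable {n : ℕ} (η : Fin n → ℝ)

theorem gFlow_neg_gFlow (t : ℝ) (x : EuclideanSpace ℝ (Fin n)) :
    gFlow η (-t) (gFlow η t x) = x := by
  simpa using gFlow_gFlow_neg η (-t) x

theorem gFlow_injective (t : ℝ) : Function.Injective (gFlow η t) :=
  Function.LeftInverse.injective (gFlow_neg_gFlow η t)

theorem gFlow_zero (x : EuclideanSpace ℝ (Fin n)) : gFlow η 0 x = x := by
  ext i
  simp [gFlow_apply_apply]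

variable {Γ Γ' Λ : Submodule ℤ (EuclideanSpace ℝ (Fin n))}

theorem mem_flowLattice {t : ℝ} {x : EuclideanSpace ℝ (Fin n)} :
    x ∈ flowLattice η t Γ ↔ gFlow η (-t) x ∈ Γ := by
  constructor
  · rintro ⟨y, hy, rfl⟩
    change gFlow η (-t) (gFlow η t y) ∈ Γ
    rwa [gFlow_neg_gFlow]
  · intro h
    exact ⟨_, h, gFlow_gFlow_neg η t x⟩

theorem flowLattice_mono (t : ℝ) (h : Γ ≤ Γ') : flowLattice η t Γ ≤ flowLattice η t Γ' :=
  Submodule.map_mono h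

theorem flowLattice_flowLattice_neg (t : ℝ) (Γ : Submodule ℤ (EuclideanSpace ℝ (Fin n))) :
    flowLattice η t (flowLattice η (-t) Γ) = Γ := by
  ext x
  rw [mem_flowLattice, mem_flowLattice, neg_neg, gFlow_gFlow_neg]

theorem flowLattice_neg_flowLattice (t : ℝ) (Γ : Submodule ℤ (EuclideanSpace ℝ (Fin n))) :
    flowLattice η (-t) (flowLattice η t Γ) = Γ := by
  simpa using flowLattice_flowLattice_neg η (-t) Γ

theorem flowLattice_zero (Γ : Submodule ℤ (EuclideanSpace ℝ (Fin n))) :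
    flowLattice η 0 Γ = Γ := by
  ext x
  rw [mem_flowLattice, neg_zero, gFlow_zero]

theorem flowLattice_inf (t : ℝ) (A B : Submodule ℤ (EuclideanSpace ℝ (Fin n))) :
    flowLattice η t (A ⊓ B) = flowLattice η t A ⊓ flowLattice η t B := by
  ext x
  simp only [Submodule.mem_inf, mem_flowLattice]

instance discreteTopology_flowLattice [DiscreteTopology Γ] (t : ℝ) :
    DiscreteTopology (flowLattice η t Γ) := by
  have h : flowLattice η t Γ = ZLattice.comap ℝ Γ (gFlow η (-t)) := by
    ext x
    exact mem_flowLattice η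
  rw [h]
  exact ZLattice.comap_discreteTopology ℝ Γ (LinearMap.continuous_of_finiteDimensional _)
    (gFlow_injective η _)

/-- The isomorphism between a subgroup and its image under the flow. -/
def flowEquiv (t : ℝ) (Γ : Submodule ℤ (EuclideanSpace ℝ (Fin n))) :
    Γ ≃ₗ[ℤ] flowLattice η t Γ :=
  Submodule.equivMapOfInjective ((gFlow η t).restrictScalars ℤ) (gFlow_injective η t) Γ

theorem finrank_flowLattice (t : ℝ) (Γ : Submodule ℤ (EuclideanSpace ℝ (Fin n))) :
    Module.finrank ℤ (flowLattice η t Γ) = Module.finrank ℤ Γ :=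
  (flowEquiv η t Γ).symm.finrank_eq

theorem colMat_flow {κ : Type*} [Fintype κ] [DecidableEq κ] (b : Module.Basis κ ℤ Γ) (t : ℝ) :
    (colMat fun k => (b.map (flowEquiv η t Γ) k : EuclideanSpace ℝ (Fin n))) =
      flowMat η (colMat fun k => (b k : EuclideanSpace ℝ (Fin n))) t := by
  ext i k
  rw [flowMat, diagonal_mul]
  exact gFlow_apply_apply η t (b k : EuclideanSpace ℝ (Fin n)) i

/-- The logarithm of the covolume along the flow. -/
def logCov (Γ : Submodule ℤ (EuclideanSpace ℝ (Fin n))) (t : ℝ) : ℝ :=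
  Real.log (cov (flowLattice η t Γ))

/-- The orthogonal projection to the span along the flow. -/
def flowProj (Γ : Submodule ℤ (EuclideanSpace ℝ (Fin n))) (t : ℝ) : Matrix (Fin n) (Fin n) ℝ :=
  projOf (Submodule.span ℝ (flowLattice η t Γ : Set (EuclideanSpace ℝ (Fin n))))

theorem flowProj_eq [DiscreteTopology Γ] {κ : Type*} [Fintype κ] [DecidableEq κ]
    (b : Module.Basis κ ℤ Γ) (t : ℝ) : flowProj η Γ t =
      colProj (flowMat η (colMat fun k => (b k : EuclideanSpace ℝ (Fin n))) t) := by
  rw [flowProj, projOf_span_eq (b.map (flowEquiv η t Γ)), colMat_flow]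

theorem logCov_eq [DiscreteTopology Γ] {κ : Type*} [Fintype κ] [DecidableEq κ]
    (b : Module.Basis κ ℤ Γ) (t : ℝ) : logCov η Γ t =
      Real.log ((flowMat η (colMat fun k => (b k : EuclideanSpace ℝ (Fin n))) t)ᵀ *
        flowMat η (colMat fun k => (b k : EuclideanSpace ℝ (Fin n))) t).det / 2 := by
  rw [logCov, cov_eq (b.map (flowEquiv η t Γ)), colMat_flow, Real.log_sqrt (gram_det_nonneg _)]

theorem isFlowProj_flowProj (Γ : Submodule ℤ (EuclideanSpace ℝ (Fin n))) [DiscreteTopology Γ] :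
    IsFlowProj η (flowProj η Γ) := by
  have b := Module.finBasis ℤ Γ
  have h := isFlowProj_colProj η (colMat_basis_injective b)
  rwa [← funext (flowProj_eq η b)] at h

theorem hasDerivAt_logCov (Γ : Submodule ℤ (EuclideanSpace ℝ (Fin n))) [DiscreteTopology Γ]
    (t : ℝ) : HasDerivAt (logCov η Γ) (slope η (flowProj η Γ t)) t := by
  have b := Module.finBasis ℤ Γ
  have h := hasDerivAt_log_det_gram η (colMat_basis_injective b) t
  rwa [← flowProj_eq η b, ← funext (logCov_eq η b)] at h

theorem trace_flowProj (Γ : Submodule ℤ (EuclideanSpace ℝ (Fin n))) [DiscreteTopology Γ]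
    (t : ℝ) : (flowProj η Γ t).trace = Module.finrank ℤ Γ := by
  rw [flowProj, trace_projOf, finrank_span_eq, finrank_flowLattice]

theorem flowProj_diag_mono (h : Γ ≤ Γ') (t : ℝ) (i : Fin n) :
    flowProj η Γ t i i ≤ flowProj η Γ' t i i :=
  projOf_diag_mono (Submodule.span_mono (flowLattice_mono η t h)) i

theorem cov_bot : cov (⊥ : Submodule ℤ (EuclideanSpace ℝ (Fin n))) = 1 := by
  rw [cov_eq (Module.Basis.empty (ι := Fin 0) _)]
  simp

theorem logCov_bot (t : ℝ) : logCov η ⊥ t = 0 := by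
  rw [logCov, flowLattice, Submodule.map_bot, cov_bot, Real.log_one]

theorem flowProj_bot (t : ℝ) : flowProj η ⊥ t = 0 := by
  have h : flowLattice η t ⊥ = ⊥ := Submodule.map_bot _
  rw [flowProj, h]
  have h2 : Submodule.span ℝ
      ((⊥ : Submodule ℤ (EuclideanSpace ℝ (Fin n))) : Set (EuclideanSpace ℝ (Fin n))) = ⊥ := by
    simp
  rw [h2]
  ext i j
  simp [projOf]

theorem finrank_eq_of_isZLattice (Λ : Submodule ℤ (EuclideanSpace ℝ (Fin n))) [DiscreteTopology Λ]
    [IsZLattice ℝ Λ] : Module.finrank ℤ Λ = n := by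
  rw [ZLattice.rank ℝ, finrank_euclideanSpace, Fintype.card_fin]

/-- Diagonal entries at most 1 with sum n are all 1, and then P_ii = Σ P_ik² leaves no room for
off-diagonal entries. -/
theorem eq_one_of_trace {P : Matrix (Fin n) (Fin n) ℝ} (hP : IsProjMat P) (h : P.trace = n) :
    P = 1 := by
  have hd : ∀ i, P i i = 1 := by
    have h1 : ∑ i, (1 - P i i) = 0 := by
      have : ∑ i, P i i = n := h
      simp [this]
    intro i
    have := (Finset.sum_eq_zero_iff_of_nonneg fun i _ => sub_nonneg.2 (hP.diag_le_one i)).1 h1 i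
      (Finset.mem_univ i)
    linarith
  ext i j
  by_cases hij : i = j
  · subst hij; rw [hd, one_apply_eq]
  rw [one_apply_ne hij]
  have h1 := hP.diag_eq i
  have h2 : P i i ^ 2 + P i j ^ 2 ≤ ∑ k, P i k ^ 2 := by
    rw [← Finset.sum_pair hij (f := fun k => P i k ^ 2)]
    exact Finset.sum_le_sum_of_subset_of_nonneg (Finset.subset_univ _) fun _ _ _ => sq_nonneg _
  rw [← h1, hd] at h2
  nlinarith [sq_nonneg (P i j)]

theorem flowProj_self (Λ : Submodule ℤ (EuclideanSpace ℝ (Fin n))) [DiscreteTopology Λ]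
    [IsZLattice ℝ Λ] (t : ℝ) : flowProj η Λ t = 1 := by
  refine eq_one_of_trace ((isFlowProj_flowProj η Λ).proj t) ?_
  rw [trace_flowProj, finrank_eq_of_isZLattice]

theorem cov_eq_covolume (Λ : Submodule ℤ (EuclideanSpace ℝ (Fin n))) [DiscreteTopology Λ]
    [IsZLattice ℝ Λ] : cov Λ = ZLattice.covolume Λ := by
  let e := LinearIsometryEquiv.ofTop (EuclideanSpace ℝ (Fin n))
    (Submodule.span ℝ (Λ : Set (EuclideanSpace ℝ (Fin n)))) IsZLattice.span_top
  exact ZLattice.covolume_comap Λ MeasureTheory.volume MeasureTheory.volume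
    (e := e.toContinuousLinearEquiv) e.measurePreserving

theorem logCov_self (hsum : ∑ i, η i = 0) (Λ : Submodule ℤ (EuclideanSpace ℝ (Fin n)))
    [DiscreteTopology Λ] [IsZLattice ℝ Λ] (hΛ : ZLattice.covolume Λ = 1) (t : ℝ) :
    logCov η Λ t = 0 := by
  have h1 : ∀ s, HasDerivAt (logCov η Λ) 0 s := fun s => by
    refine (hasDerivAt_logCov η Λ s).congr_deriv ?_
    simp [flowProj_self, slope, hsum]
  rw [is_const_of_deriv_eq_zero (fun s => (h1 s).differentiableAt) (fun s => (h1 s).deriv) t 0,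
    logCov, flowLattice_zero, cov_eq_covolume, hΛ, Real.log_one]

/-- The flow preserves primitivity, intersections and ranks, so `cov_submodular` applies to the
images at time t. Saturating the sum keeps its rank. -/
theorem logCov_submodular [DiscreteTopology Λ] {A B : Submodule ℤ (EuclideanSpace ℝ (Fin n))}
    (hA : IsPrimitive Λ A) (hB : IsPrimitive Λ B) (t : ℝ) :
    logCov η (A ⊓ B) t + logCov η (saturation Λ (A ⊔ B)) t ≤ logCov η A t + logCov η B t := by
  have hAB : A ⊔ B ≤ Λ := sup_le hA.le hB.le
  have := discreteTopology_of_le hA.le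
  have := discreteTopology_of_le hB.le
  have := discreteTopology_of_le hAB
  have := discreteTopology_of_le (isPrimitive_saturation hAB).le
  have := discreteTopology_of_le (hA.inf hB).le
  have h1 : cov (flowLattice η t A ⊓ flowLattice η t B) *
      cov (flowLattice η t (saturation Λ (A ⊔ B))) ≤
      cov (flowLattice η t A) * cov (flowLattice η t B) := by
    refine cov_submodular ?_ ?_ ?_ ?_
    · intro x hx m hm hmx
      rw [mem_flowLattice] at hx hmx ⊢
      rw [map_zsmul] at hmx
      exact hB.mem_of_smul (hA.le hx) hm hmx
    · intro x hx m hm hmx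
      rw [mem_flowLattice] at hx hmx ⊢
      rw [map_zsmul] at hmx
      exact hA.mem_of_smul (hB.le hx) hm hmx
    · exact sup_le (flowLattice_mono η t (le_sup_left.trans (le_saturation hAB)))
        (flowLattice_mono η t (le_sup_right.trans (le_saturation hAB)))
    · rw [← flowLattice_inf]
      simp only [finrank_flowLattice]
      rw [← finrank_span_eq (saturation Λ (A ⊔ B)), span_saturation hAB, finrank_span_eq,
        finrank_sup_add_finrank_inf]
  rw [← flowLattice_inf] at h1
  rw [logCov, logCov, logCov, logCov, ← Real.log_mul (cov_pos _).ne' (cov_pos _).ne',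
    ← Real.log_mul (cov_pos _).ne' (cov_pos _).ne']
  exact Real.log_le_log (mul_pos (cov_pos _) (cov_pos _)) h1

theorem cov_antitone [DiscreteTopology Γ'] (h : Γ ≤ Γ')
    (hr : Module.finrank ℤ Γ = Module.finrank ℤ Γ') : cov Γ' ≤ cov Γ := by
  have := discreteTopology_of_le h
  have b := Module.finBasis ℤ Γ
  rw [cov_eq b]
  refine cov_le (fun k => h (b k).2) ?_ (by rw [Fintype.card_fin, hr])
  exact b.linearIndependent.map' Γ.subtype (Submodule.ker_subtype _)

theorem finrank_saturation [DiscreteTopology Λ] (h : Γ ≤ Λ) :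
    Module.finrank ℤ (saturation Λ Γ) = Module.finrank ℤ Γ := by
  have := discreteTopology_of_le h
  have := discreteTopology_of_le (isPrimitive_saturation h).le
  rw [← finrank_span_eq (saturation Λ Γ), span_saturation h, finrank_span_eq]

theorem logCov_saturation_le [DiscreteTopology Λ] (h : Γ ≤ Λ) (t : ℝ) :
    logCov η (saturation Λ Γ) t ≤ logCov η Γ t := by
  have := discreteTopology_of_le (isPrimitive_saturation h).le
  refine Real.log_le_log (cov_pos _) (cov_antitone (flowLattice_mono η t (le_saturation h)) ?_)
  rw [finrank_flowLattice, finrank_flowLattice, finrank_saturation h]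

end Flow

theorem abs_sub_le_of_hasDerivAt {f f' : ℝ → ℝ} {M : ℝ} (hf : ∀ t, HasDerivAt f (f' t) t)
    (hM : ∀ t, |f' t| ≤ M) (s t : ℝ) : |f t - f s| ≤ M * |t - s| :=
  Convex.norm_image_sub_le_of_norm_hasDerivWithin_le (s := Set.univ)
    (fun x _ => (hf x).hasDerivWithinAt) (fun x _ => hM x) convex_univ (Set.mem_univ s)
    (Set.mem_univ t)

/-! ### Abstract families of flowing subspaces -/

/-- A ranked family of subspaces moving with the flow, together with their logarithmic
covolumes. -/
structure FlowSystem {n : ℕ} (η : Fin n → ℝ) (ι : Type*) [PartialOrder ι] [BoundedOrder ι] where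
  /-- the rank -/
  rk : ι → ℕ
  /-- the orthogonal projection to the subspace at a given time -/
  P : ι → ℝ → Matrix (Fin n) (Fin n) ℝ
  /-- the logarithm of the covolume at a given time -/
  ψ : ι → ℝ → ℝ
  isFlowProj : ∀ A, IsFlowProj η (P A)
  trace_P : ∀ A t, (P A t).trace = rk A
  hasDerivAt_ψ : ∀ A t, HasDerivAt (ψ A) (slope η (P A t)) t
  diag_mono : ∀ ⦃A B⦄, A ≤ B → ∀ t i, P A t i i ≤ P B t i i
  eq_of_le : ∀ ⦃A B⦄, A ≤ B → rk A = rk B → A = B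
  exists_modular : ∀ A B, ¬ A ≤ B → ∃ I J, rk I < rk A ∧ rk I + rk J = rk A + rk B ∧
    ∀ t, ψ I t + ψ J t ≤ ψ A t + ψ B t
  finite_le : ∀ t C, {A | ψ A t ≤ C}.Finite
  P_bot : ∀ t, P ⊥ t = 0
  P_top : ∀ t, P ⊤ t = 1
  ψ_bot : ∀ t, ψ ⊥ t = 0
  ψ_top : ∀ t, ψ ⊤ t = 0

section LatticeSystem

variable {n : ℕ}

/-- The primitive subgroups. -/
abbrev PrimitiveSubgroup (Λ : Submodule ℤ (EuclideanSpace ℝ (Fin n))) : Type :=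
  {Γ : Submodule ℤ (EuclideanSpace ℝ (Fin n)) // IsPrimitive Λ Γ}

instance (Λ : Submodule ℤ (EuclideanSpace ℝ (Fin n))) [DiscreteTopology Λ] :
    BoundedOrder (PrimitiveSubgroup Λ) where
  top := ⟨Λ, isPrimitive_self⟩
  le_top A := A.2.le
  bot := ⟨⊥, isPrimitive_bot⟩
  bot_le _ := bot_le (α := Submodule ℤ (EuclideanSpace ℝ (Fin n)))

/-- The primitive subgroups of a unimodular lattice. -/
def latticeSystem {η : Fin n → ℝ} (hsum : ∑ i, η i = 0)
    (Λ : Submodule ℤ (EuclideanSpace ℝ (Fin n))) [DiscreteTopology Λ] [IsZLattice ℝ Λ]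
    (hΛ : ZLattice.covolume Λ = 1) : FlowSystem η (PrimitiveSubgroup Λ) where
  rk A := Module.finrank ℤ A.1
  P A := flowProj η A.1
  ψ A := logCov η A.1
  isFlowProj A := by
    have := discreteTopology_of_le A.2.le
    exact isFlowProj_flowProj η A.1
  trace_P A t := by
    have := discreteTopology_of_le A.2.le
    exact trace_flowProj η A.1 t
  hasDerivAt_ψ A t := by
    have := discreteTopology_of_le A.2.le
    exact hasDerivAt_logCov η A.1 t
  diag_mono A B h t i := flowProj_diag_mono η h t i
  eq_of_le A B h hr := Subtype.ext (A.2.eq_of_le B.2.le h hr)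
  exists_modular A B h := by
    have hAB : A.1 ⊔ B.1 ≤ Λ := sup_le A.2.le B.2.le
    have := discreteTopology_of_le A.2.le
    have := discreteTopology_of_le B.2.le
    have := discreteTopology_of_le hAB
    have := discreteTopology_of_le (A.2.inf B.2).le
    -- The modular pair is the intersection and the saturated sum; the rank of the intersection
    -- drops strictly, because otherwise primitivity would give A ≤ B.
    refine ⟨⟨_, A.2.inf B.2⟩, ⟨_, isPrimitive_saturation hAB⟩, ?_, ?_,
      logCov_submodular η A.2 B.2⟩
    · refine lt_of_le_of_ne ?_ fun h1 => h ?_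
      · rw [← finrank_span_eq, ← finrank_span_eq A.1]
        exact Submodule.finrank_mono (Submodule.span_mono fun _ hx => hx.1)
      · have h2 := (A.2.inf B.2).eq_of_le A.2.le inf_le_left h1
        exact inf_eq_left.1 h2
    · change Module.finrank ℤ (A.1 ⊓ B.1 : Submodule ℤ _) +
        Module.finrank ℤ (saturation Λ (A.1 ⊔ B.1)) = _
      rw [finrank_saturation hAB, add_comm, finrank_sup_add_finrank_inf]
  finite_le t C := by
    refine Set.Finite.of_finite_image (f := Subtype.val) ?_ Subtype.val_injective.injOn
    -- Logarithmic covolumes are Lipschitz in time, so a bound at time t gives one at time 0.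
    refine (finite_primitive Λ (Real.exp (C + (∑ i, |η i|) * |0 - t|))).subset ?_
    rintro _ ⟨A, hA, rfl⟩
    have := discreteTopology_of_le A.2.le
    refine ⟨A.2, ?_⟩
    have h1 := abs_sub_le_of_hasDerivAt (hasDerivAt_logCov η A.1)
      (fun s => abs_slope_le ((isFlowProj_flowProj η A.1).proj s)) t 0
    have h2 : logCov η A.1 0 = Real.log (cov A.1) := by rw [logCov, flowLattice_zero]
    have h3 : logCov η A.1 t ≤ C := hA
    rw [← Real.log_le_iff_le_exp (cov_pos _), ← h2]
    linarith [(abs_le.1 h1).2]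
  P_bot t := flowProj_bot η t
  P_top t := flowProj_self η Λ t
  ψ_bot t := logCov_bot η t
  ψ_top t := logCov_self η hsum Λ hΛ t

end LatticeSystem

end GTemplate

namespace GTemplate

open Filter Set

/-! ### Piecewise linear functions -/

section PiecewiseLinear

/-- The function `f` is affine in the distance to `t` along the filter `F`. -/
def HasSlope (F : Filter ℝ) (t : ℝ) (f : ℝ → ℝ) (a : ℝ) : Prop :=
  ∀ᶠ s in F, f s = f t + a * |s - t|

/-- Locally, `f` is affine on both sides of every point. -/
def IsPL (f : ℝ → ℝ) : Prop :=
  ∀ t, (∃ a, HasSlope (𝓝[>] t) t f a) ∧ ∃ a, HasSlope (𝓝[<] t) t f a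

variable {F : Filter ℝ} {t : ℝ} {f g : ℝ → ℝ} {a b : ℝ}

theorem HasSlope.add (hf : HasSlope F t f a) (hg : HasSlope F t g b) :
    HasSlope F t (fun s => f s + g s) (a + b) := by
  filter_upwards [hf, hg] with s h1 h2
  rw [h1, h2]; ring

theorem HasSlope.const_mul (c : ℝ) (hf : HasSlope F t f a) :
    HasSlope F t (fun s => c * f s) (c * a) := by
  filter_upwards [hf] with s h1
  rw [h1]; ring

theorem hasSlope_const (F : Filter ℝ) (t c : ℝ) : HasSlope F t (fun _ => c) 0 :=
  Eventually.of_forall fun s => by ring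

theorem IsPL.add (hf : IsPL f) (hg : IsPL g) : IsPL fun s => f s + g s := fun t =>
  ⟨⟨_, (hf t).1.choose_spec.add (hg t).1.choose_spec⟩,
    ⟨_, (hf t).2.choose_spec.add (hg t).2.choose_spec⟩⟩

theorem IsPL.const_mul (c : ℝ) (hf : IsPL f) : IsPL fun s => c * f s := fun t =>
  ⟨⟨_, (hf t).1.choose_spec.const_mul c⟩, ⟨_, (hf t).2.choose_spec.const_mul c⟩⟩

theorem isPL_const (c : ℝ) : IsPL fun _ => c := fun t =>
  ⟨⟨_, hasSlope_const _ t c⟩, ⟨_, hasSlope_const _ t c⟩⟩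

theorem tendsto_add_mul_abs (hF : F ≤ 𝓝 t) (c a : ℝ) :
    Tendsto (fun s => c + a * |s - t|) F (𝓝 c) := by
  have h : Continuous fun s => c + a * |s - t| := by fun_prop
  have h2 := h.tendsto t
  simp only [sub_self, abs_zero, mul_zero, add_zero] at h2
  exact h2.mono_left hF

theorem HasSlope.tendsto (hF : F ≤ 𝓝 t) (hf : HasSlope F t f a) : Tendsto f F (𝓝 (f t)) :=
  (tendsto_add_mul_abs hF (f t) a).congr' (hf.mono fun _ h => h.symm)

theorem IsPL.continuous (hf : IsPL f) : Continuous f := by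
  rw [continuous_iff_continuousAt]
  intro t
  rw [continuousAt_iff_continuous_left'_right']
  obtain ⟨⟨a, ha⟩, b, hb⟩ := hf t
  exact ⟨hb.tendsto nhdsWithin_le_nhds, ha.tendsto nhdsWithin_le_nhds⟩

/-- A nonnegative piecewise linear function is eventually positive or eventually zero on each
side of a point. -/
theorem HasSlope.eventually_pos_or (hF : F ≤ 𝓝[≠] t) (hf : HasSlope F t f a) (h0 : 0 ≤ f t) :
    (∀ᶠ s in F, 0 < f s) ∨ ∀ᶠ s in F, ¬ 0 < f s := by
  rcases h0.eq_or_lt with h0 | h0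
  · rcases lt_or_ge 0 a with ha | ha
    · left
      filter_upwards [hf, hF self_mem_nhdsWithin] with s hs hne
      rw [hs, ← h0, zero_add]
      exact mul_pos ha (abs_pos.2 (sub_ne_zero.2 hne))
    · right
      filter_upwards [hf] with s hs
      rw [hs, ← h0, zero_add, not_lt]
      exact mul_nonpos_of_nonpos_of_nonneg ha (abs_nonneg _)
  · left
    exact (hf.tendsto (hF.trans nhdsWithin_le_nhds)).eventually (lt_mem_nhds h0)

/-- The minimum of a locally finite family. -/
theorem exists_hasSlope_of_min {ι : Type*} {u : ι → ℝ → ℝ} {m : ℝ → ℝ} (hF : F ≤ 𝓝 t)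
    (hle : ∀ s p, m s ≤ u p s) (hatt : ∀ s, ∃ p, m s = u p s)
    (hu : ∀ p, ∃ a, HasSlope F t (u p) a)
    (hfin : ∀ B, {p | ∃ s, |s - t| ≤ 1 ∧ u p s ≤ B}.Finite) : ∃ a, HasSlope F t m a := by
  choose a ha using hu
  obtain ⟨p₀, hp₀⟩ := hatt t
  have hev : ∀ᶠ s in F, u p₀ s < m t + 1 := by
    refine ((ha p₀).tendsto hF).eventually (gt_mem_nhds ?_)
    rw [hp₀]; exact lt_add_one _
  -- Only these finitely many indices can realize the minimum near t. The index with
  -- lexicographically least (value at t, slope) then wins along the whole filter.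
  set S := {p | ∃ s, |s - t| ≤ 1 ∧ u p s ≤ m t + 1} with hS
  have hp₀S : p₀ ∈ S := ⟨t, by simp, by rw [hp₀]; linarith⟩
  obtain ⟨p, hpS, hp⟩ := exists_min_image S (fun p => toLex (u p t, a p)) (hfin _) ⟨p₀, hp₀S⟩
  have hp' : ∀ q ∈ S, u p t < u q t ∨ u p t = u q t ∧ a p ≤ a q := fun q hq =>
    Prod.Lex.toLex_le_toLex.1 (hp q hq)
  have hpt : m t = u p t := by
    refine le_antisymm (hle t p) ?_
    rw [hp₀]
    rcases hp' p₀ hp₀S with h | h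
    · exact h.le
    · exact h.1.le
  have hall : ∀ᶠ s in F, ∀ q ∈ S, u p s ≤ u q s := by
    rw [eventually_all_finite (hfin _)]
    intro q hq
    rcases hp' q hq with h | h
    · exact (((ha p).tendsto hF).eventually_lt ((ha q).tendsto hF) h).mono fun _ h => h.le
    · filter_upwards [ha p, ha q] with s h1 h2
      rw [h1, h2, h.1]
      have := mul_le_mul_of_nonneg_right h.2 (abs_nonneg (s - t))
      linarith
  have hnear : ∀ᶠ s in F, |s - t| ≤ 1 := by
    have : Tendsto (fun s => |s - t|) (𝓝 t) (𝓝 0) := by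
      have h : Continuous fun s => |s - t| := by fun_prop
      have h2 := h.tendsto t
      rwa [sub_self, abs_zero] at h2
    exact ((this.eventually (gt_mem_nhds one_pos)).filter_mono hF).mono fun _ h => h.le
  refine ⟨a p, ?_⟩
  filter_upwards [ha p, hev, hall, hnear] with s h1 h2 h3 h4
  obtain ⟨q, hq⟩ := hatt s
  have hqS : q ∈ S := ⟨s, h4, by rw [← hq]; exact (hle s p₀).trans h2.le⟩
  rw [hpt, ← h1]
  exact le_antisymm (hle s p) (by rw [hq]; exact h3 q hqS)

theorem isPL_of_min {ι : Type*} {u : ι → ℝ → ℝ} {m : ℝ → ℝ}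
    (hle : ∀ s p, m s ≤ u p s) (hatt : ∀ s, ∃ p, m s = u p s) (hu : ∀ p, IsPL (u p))
    (hfin : ∀ t B, {p | ∃ s, |s - t| ≤ 1 ∧ u p s ≤ B}.Finite) : IsPL m := fun t =>
  ⟨exists_hasSlope_of_min nhdsWithin_le_nhds hle hatt (fun p => (hu p t).1) (hfin t),
    exists_hasSlope_of_min nhdsWithin_le_nhds hle hatt (fun p => (hu p t).2) (hfin t)⟩

/-- Slopes are measured in the distance to t, so on the left an affine function of derivative a has
slope -a. -/
theorem HasSlope.hasDerivAt (hr : HasSlope (𝓝[>] t) t f a) (hl : HasSlope (𝓝[<] t) t f (-a)) :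
    HasDerivAt f a t := by
  have h : f =ᶠ[𝓝 t] fun s => f t + a * (s - t) := by
    rw [← nhdsNE_sup_pure, ← nhdsLT_sup_nhdsGT]
    refine eventually_sup.2 ⟨eventually_sup.2 ⟨?_, ?_⟩, ?_⟩
    · filter_upwards [hl, self_mem_nhdsWithin] with s hs hst
      rw [hs, abs_of_neg (sub_neg.2 hst)]; ring
    · filter_upwards [hr, self_mem_nhdsWithin] with s hs hst
      rw [hs, abs_of_pos (sub_pos.2 hst)]
    · simp
  refine HasDerivAt.congr_of_eventuallyEq ?_ h
  refine (((hasDerivAt_id t).sub_const t).const_mul a |>.const_add (f t)).congr_deriv ?_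
  simp

end PiecewiseLinear

/-! ### Primitives of step functions -/

section StepPrimitive

/-- The primitive of the step function with value `σ k` on `[k L, (k + 1) L)`. -/
def stepPrimitive (L : ℝ) (σ : ℤ → ℝ) (t : ℝ) : ℝ := ∫ x in (0 : ℝ)..t, σ ⌊x / L⌋

variable {L : ℝ} {σ : ℤ → ℝ} {M : ℝ}

theorem intervalIntegrable_step (hM : ∀ k, |σ k| ≤ M) (a b : ℝ) :
    IntervalIntegrable (fun x => σ ⌊x / L⌋) MeasureTheory.volume a b := by
  rw [intervalIntegrable_iff]
  refine MeasureTheory.Measure.integrableOn_of_bounded (M := M) ?_ ?_ ?_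
  · simp [uIoc]
  · have : Measurable fun x : ℝ => σ ⌊x / L⌋ :=
      (measurable_from_top (f := σ)).comp (Int.measurable_floor.comp (measurable_id.div_const L))
    exact this.aestronglyMeasurable
  · exact Eventually.of_forall fun x => hM _

theorem stepPrimitive_sub (hM : ∀ k, |σ k| ≤ M) (s t : ℝ) :
    stepPrimitive L σ s - stepPrimitive L σ t = ∫ x in t..s, σ ⌊x / L⌋ := by
  rw [stepPrimitive, stepPrimitive, intervalIntegral.integral_interval_sub_left
    (intervalIntegrable_step hM _ _) (intervalIntegrable_step hM _ _)]

theorem eventually_floor_right (hL : 0 < L) (t : ℝ) : ∀ᶠ s in 𝓝[>] t, ⌊s / L⌋ = ⌊t / L⌋ := by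
  have h1 : Tendsto (fun s => s / L) (𝓝[>] t) (𝓝[≥] (t / L)) := by
    refine tendsto_nhdsWithin_iff.2 ⟨?_, ?_⟩
    · exact ((continuous_id.div_const L).tendsto t).mono_left nhdsWithin_le_nhds
    · filter_upwards [self_mem_nhdsWithin] with s hs
      exact div_le_div_of_nonneg_right (le_of_lt hs) hL.le
  have := (tendsto_floor_right_pure_floor (t / L)).comp h1
  exact tendsto_pure.1 this

/-- The window immediately before t is ⌈t/L⌉ - 1; it differs from ⌊t/L⌋ only when t is a window
boundary. -/
theorem eventually_floor_left (hL : 0 < L) (t : ℝ) : ∀ᶠ s in 𝓝[<] t, ⌊s / L⌋ = ⌈t / L⌉ - 1 := by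
  have h1 : Tendsto (fun s => s / L) (𝓝[<] t) (𝓝[<] (t / L)) := by
    refine tendsto_nhdsWithin_iff.2 ⟨?_, ?_⟩
    · exact ((continuous_id.div_const L).tendsto t).mono_left nhdsWithin_le_nhds
    · filter_upwards [self_mem_nhdsWithin] with s hs
      exact div_lt_div_of_pos_right hs hL
  have := (tendsto_floor_left_pure_ceil_sub_one (t / L)).comp h1
  exact tendsto_pure.1 this

theorem hasSlope_stepPrimitive_right (hL : 0 < L) (hM : ∀ k, |σ k| ≤ M) (t : ℝ) :
    HasSlope (𝓝[>] t) t (stepPrimitive L σ) (σ ⌊t / L⌋) := by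
  obtain ⟨u, hu, hut⟩ := (mem_nhdsGT_iff_exists_Ioo_subset).1 (eventually_floor_right hL t)
  filter_upwards [Ioo_mem_nhdsGT hu] with s hs
  rw [← sub_eq_iff_eq_add', stepPrimitive_sub hM, abs_of_pos (sub_pos.2 hs.1)]
  rw [intervalIntegral.integral_congr_Ioo_of_le (g := fun _ => σ ⌊t / L⌋) hs.1.le
    fun x hx => congrArg σ (hut ⟨hx.1, hx.2.trans hs.2⟩)]
  rw [intervalIntegral.integral_const, smul_eq_mul, mul_comm]

theorem hasSlope_stepPrimitive_left (hL : 0 < L) (hM : ∀ k, |σ k| ≤ M) (t : ℝ) :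
    HasSlope (𝓝[<] t) t (stepPrimitive L σ) (-σ (⌈t / L⌉ - 1)) := by
  obtain ⟨u, hu, hut⟩ := (mem_nhdsLT_iff_exists_Ioo_subset).1 (eventually_floor_left hL t)
  filter_upwards [Ioo_mem_nhdsLT hu] with s hs
  rw [← sub_eq_iff_eq_add', stepPrimitive_sub hM, abs_of_neg (sub_neg.2 hs.2),
    intervalIntegral.integral_symm]
  rw [intervalIntegral.integral_congr_Ioo_of_le (g := fun _ => σ (⌈t / L⌉ - 1)) hs.2.le
    fun x hx => congrArg σ (hut ⟨hs.1.trans hx.1, hx.2⟩)]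
  rw [intervalIntegral.integral_const, smul_eq_mul]
  ring

theorem isPL_stepPrimitive (hL : 0 < L) (hM : ∀ k, |σ k| ≤ M) : IsPL (stepPrimitive L σ) :=
  fun t => ⟨⟨_, hasSlope_stepPrimitive_right hL hM t⟩, ⟨_, hasSlope_stepPrimitive_left hL hM t⟩⟩

/-- If the step function stays close to the derivative `v` of `ψ`, in the sense that the error is
controlled by the increments of `v`, then its primitive stays close to `ψ`. -/
theorem abs_stepPrimitive_sub_le (hσ : ∀ k, |σ k| ≤ M) {ψ v : ℝ → ℝ}
    (hψ : ∀ t, HasDerivAt ψ (v t) t) (hv : Monotone v) (hvM : ∀ t, |v t| ≤ M) {C D : ℝ}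
    (hC : 0 ≤ C) (hD : 0 ≤ D)
    (h : ∀ x, |σ ⌊x / L⌋ - v x| ≤ C * (v (x + D) - v (x - D))) (t : ℝ) :
    |ψ 0 + stepPrimitive L σ t - ψ t| ≤ 4 * C * D * M := by
  have hvi : ∀ a b, IntervalIntegrable v MeasureTheory.volume a b := fun a b =>
    (hv.monotoneOn _).intervalIntegrable
  have h1 : ψ t - ψ 0 = ∫ x in (0 : ℝ)..t, v x :=
    (intervalIntegral.integral_eq_sub_of_hasDerivAt (fun x _ => hψ x) (hvi _ _)).symm
  have h2 : ψ 0 + stepPrimitive L σ t - ψ t = ∫ x in (0 : ℝ)..t, (σ ⌊x / L⌋ - v x) := by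
    rw [intervalIntegral.integral_sub (intervalIntegrable_step hσ _ _) (hvi _ _), ← h1,
      stepPrimitive]
    ring
  -- A primitive of the bound for the error. As ψ is M-Lipschitz, |Θ| ≤ 2CDM, so the integrated
  -- error stays bounded for all t.
  set Θ : ℝ → ℝ := fun x => C * (ψ (x + D) - ψ (x - D)) with hΘ
  have hΘ' : ∀ x, HasDerivAt Θ (C * (v (x + D) - v (x - D))) x := fun x =>
    (((hψ (x + D)).comp_add_const x D).sub ((hψ (x - D)).comp_sub_const x D)).const_mul C
  have hΘi : ∀ a b, IntervalIntegrable (fun x => C * (v (x + D) - v (x - D)))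
      MeasureTheory.volume a b := fun a b =>
    ((((hv.comp (fun x y hxy => by linarith : Monotone fun x : ℝ => x + D)).monotoneOn
      _).intervalIntegrable).sub (((hv.comp (fun x y hxy => by linarith :
        Monotone fun x : ℝ => x - D)).monotoneOn _).intervalIntegrable)).const_mul C
  have hΘb : ∀ x, |Θ x| ≤ 2 * C * D * M := fun x => by
    have h3 := abs_sub_le_of_hasDerivAt hψ hvM (x - D) (x + D)
    rw [hΘ]
    simp only
    rw [abs_mul, abs_of_nonneg hC]
    have h4 : |x + D - (x - D)| = 2 * D := by rw [abs_of_nonneg] <;> linarith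
    rw [h4] at h3
    nlinarith
  rw [h2]
  have h5 : |∫ x in (0 : ℝ)..t, (σ ⌊x / L⌋ - v x)| ≤
      |∫ x in (0 : ℝ)..t, C * (v (x + D) - v (x - D))| := by
    rw [← Real.norm_eq_abs]
    exact intervalIntegral.norm_integral_le_abs_of_norm_le
      (Eventually.of_forall fun x => h x) (hΘi _ _)
  rw [intervalIntegral.integral_eq_sub_of_hasDerivAt (fun x _ => hΘ' x) (hΘi _ _)] at h5
  have h6 := abs_sub (Θ t) (Θ 0)
  linarith [hΘb t, hΘb 0]

end StepPrimitive

end GTemplate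

namespace GTemplate

/-! ### Lower hulls -/

section LowerHull

variable {ι : Type*}

/-- The pairs of indices whose segment is used to compute the lower hull at `l`. -/
abbrev HullPair (rk : ι → ℕ) (l : ℕ) : Type _ :=
  {p : ι × ι // (p.1 = p.2 ∧ rk p.1 = l) ∨ (rk p.1 < l ∧ l < rk p.2)}

/-- The weight of the first member of a pair. -/
def pairWeight (rk : ι → ℕ) (l : ℕ) (p : ι × ι) : ℝ :=
  if rk p.1 = rk p.2 then 1 else ((rk p.2 : ℝ) - l) / ((rk p.2 : ℝ) - rk p.1)

/-- The value at `l` of the segment of a pair. -/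
def interp (rk : ι → ℕ) (v : ι → ℝ) (l : ℕ) (p : ι × ι) : ℝ :=
  pairWeight rk l p * v p.1 + (1 - pairWeight rk l p) * v p.2

/-- The value at `l` of the lower boundary of the convex hull of the points `(rk A, v A)`. -/
def lowerHull (rk : ι → ℕ) (v : ι → ℝ) (l : ℕ) : ℝ :=
  ⨅ p : HullPair rk l, interp rk v l p.1

/-- Values on a ranked set, bounded below in a strong sense. -/
structure IsRanked (n : ℕ) (rk : ι → ℕ) (v : ι → ℝ) : Prop where
  rk_le : ∀ A, rk A ≤ n
  exists_rk_zero : ∃ A, rk A = 0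
  exists_rk_top : ∃ A, rk A = n
  finite_le : ∀ C, {A | v A ≤ C}.Finite

variable {n : ℕ} {rk : ι → ℕ} {v w : ι → ℝ} {l : ℕ}

theorem pairWeight_diag (A : ι) : pairWeight rk l (A, A) = 1 := by simp [pairWeight]

theorem interp_diag (A : ι) : interp rk v l (A, A) = v A := by
  rw [interp, pairWeight_diag]; simp

/-- Both weights are at least 1/(n + 1). Together with a lower bound for all values, a bound for an
interpolated value therefore bounds both endpoint values; this gives `IsRanked.finite_interp_le`. -/
theorem pairWeight_mem (hrk : ∀ A, rk A ≤ n) {A B : ι} (hA : rk A < l) (hB : l < rk B) :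
    1 ≤ pairWeight rk l (A, B) * (n + 1) ∧ 1 ≤ (1 - pairWeight rk l (A, B)) * (n + 1) := by
  have hne : rk A ≠ rk B := by omega
  have h1 : (rk A : ℝ) + 1 ≤ l := by exact_mod_cast hA
  have h2 : (l : ℝ) + 1 ≤ rk B := by exact_mod_cast hB
  have h3 : (rk B : ℝ) ≤ n := by exact_mod_cast hrk B
  have h0 : (0 : ℝ) ≤ rk A := Nat.cast_nonneg _
  have hpos : (0 : ℝ) < rk B - rk A := by linarith
  simp only [pairWeight, hne, if_false]
  have h4 : 1 - ((rk B : ℝ) - l) / (rk B - rk A) = (l - rk A) / (rk B - rk A) := by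
    field_simp; ring
  rw [h4, div_mul_eq_mul_div, div_mul_eq_mul_div, le_div_iff₀ hpos, le_div_iff₀ hpos]
  constructor <;> nlinarith

theorem pairWeight_rank {p : ι × ι} (hp : (p.1 = p.2 ∧ rk p.1 = l) ∨ (rk p.1 < l ∧ l < rk p.2)) :
    pairWeight rk l p * rk p.1 + (1 - pairWeight rk l p) * rk p.2 = l := by
  obtain ⟨A, B⟩ := p
  rcases hp with ⟨h1, h2⟩ | ⟨h1, h2⟩
  · simp only at h1 h2
    subst h1
    rw [pairWeight_diag]; simp [h2]
  · simp only at h1 h2 ⊢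
    have hne : rk A ≠ rk B := by omega
    have h3 : (rk A : ℝ) < rk B := by exact_mod_cast h1.trans h2
    simp only [pairWeight, hne, if_false]
    have : (rk B : ℝ) - rk A ≠ 0 := by linarith
    field_simp
    ring

theorem pairWeight_bounds (hrk : ∀ A, rk A ≤ n) {p : ι × ι}
    (hp : (p.1 = p.2 ∧ rk p.1 = l) ∨ (rk p.1 < l ∧ l < rk p.2)) :
    0 ≤ pairWeight rk l p ∧ pairWeight rk l p ≤ 1 := by
  obtain ⟨A, B⟩ := p
  rcases hp with ⟨h1, h2⟩ | ⟨h1, h2⟩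
  · simp only at h1 h2
    subst h1
    rw [pairWeight_diag]; simp
  · obtain ⟨h3, h4⟩ := pairWeight_mem hrk h1 h2
    have : (0 : ℝ) ≤ n := Nat.cast_nonneg n
    constructor
    · by_contra h
      nlinarith
    · by_contra h
      nlinarith

theorem interp_mono (hrk : ∀ A, rk A ≤ n) (h : ∀ A, w A ≤ v A) (p : HullPair rk l) :
    interp rk w l p.1 ≤ interp rk v l p.1 := by
  obtain ⟨h1, h2⟩ := pairWeight_bounds hrk p.2
  exact add_le_add (mul_le_mul_of_nonneg_left (h _) h1)
    (mul_le_mul_of_nonneg_left (h _) (sub_nonneg.2 h2))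

theorem IsRanked.exists_lower_bound (h : IsRanked n rk v) : ∃ D, ∀ A, D ≤ v A := by
  obtain ⟨D, hD⟩ := ((h.finite_le 0).image v).bddBelow
  refine ⟨min D 0, fun A => ?_⟩
  rcases le_total (v A) 0 with h1 | h1
  · exact (min_le_left _ _).trans (hD ⟨A, h1, rfl⟩)
  · exact (min_le_right _ _).trans h1

theorem IsRanked.finite_interp_le (h : IsRanked n rk v) (l : ℕ) (C : ℝ) :
    {p : HullPair rk l | interp rk v l p.1 ≤ C}.Finite := by
  obtain ⟨D, hD⟩ := h.exists_lower_bound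
  set E := ((n : ℝ) + 1) * (|C| + |D|) with hE
  have hE0 : |C| ≤ E := by
    have : (0 : ℝ) ≤ n := Nat.cast_nonneg n
    nlinarith [abs_nonneg C, abs_nonneg D]
  have hkey : ∀ (θ a b : ℝ), 1 ≤ θ * (n + 1) → 1 ≤ (1 - θ) * (n + 1) → D ≤ b →
      θ * a + (1 - θ) * b ≤ C → a ≤ E := by
    intro θ a b h1 h2 hb hab
    have hn : (0 : ℝ) < n + 1 := by positivity
    have hθ : 0 ≤ θ := by by_contra hh; nlinarith
    have hθ1 : 0 ≤ 1 - θ := by by_contra hh; nlinarith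
    have h3 : (1 - θ) * b ≥ -|D| := by nlinarith [neg_abs_le D, abs_nonneg D]
    by_contra hh
    rw [not_le] at hh
    have h4 : 0 ≤ E := (abs_nonneg C).trans hE0
    have h5 : θ * a ≤ |C| + |D| := by linarith [le_abs_self C]
    have h6 : a ≤ (n + 1) * (θ * a) := by nlinarith
    have h7 : (n + 1) * (θ * a) ≤ E := mul_le_mul_of_nonneg_left h5 hn.le
    linarith
  refine Set.Finite.of_finite_image (f := Subtype.val) ?_ Subtype.val_injective.injOn
  refine ((h.finite_le E).prod (h.finite_le E)).subset ?_
  rintro _ ⟨⟨⟨A, B⟩, hp⟩, hle, rfl⟩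
  rcases hp with ⟨h1, h2⟩ | ⟨h1, h2⟩
  · simp only at h1 h2
    subst h1
    have hle' : interp rk v l (A, A) ≤ C := hle
    rw [interp_diag] at hle'
    have : v A ≤ E := hle'.trans ((le_abs_self C).trans hE0)
    exact ⟨this, this⟩
  · obtain ⟨h3, h4⟩ := pairWeight_mem h.rk_le h1 h2
    have hle' : interp rk v l (A, B) ≤ C := hle
    rw [interp] at hle'
    refine ⟨hkey _ _ _ h3 h4 (hD B) hle', hkey (1 - pairWeight rk l (A, B)) _ (v A) h4 ?_ (hD A) ?_⟩
    · rwa [sub_sub_cancel]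
    · rw [sub_sub_cancel]; simp only at hle'; linarith

theorem IsRanked.nonempty_hullPair (h : IsRanked n rk v) (hl : l ≤ n) :
    Nonempty (HullPair rk l) := by
  obtain ⟨A, hA⟩ := h.exists_rk_zero
  obtain ⟨B, hB⟩ := h.exists_rk_top
  rcases Nat.eq_zero_or_pos l with rfl | hl0
  · exact ⟨⟨(A, A), Or.inl ⟨rfl, hA⟩⟩⟩
  rcases hl.eq_or_lt with rfl | hln
  · exact ⟨⟨(B, B), Or.inl ⟨rfl, hB⟩⟩⟩
  · exact ⟨⟨(A, B), Or.inr ⟨by simp [hA, hl0], by simp [hB, hln]⟩⟩⟩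

theorem IsRanked.exists_lowerHull_eq (h : IsRanked n rk v) (hl : l ≤ n) :
    ∃ p : HullPair rk l, lowerHull rk v l = interp rk v l p.1 := by
  obtain ⟨p₀⟩ := h.nonempty_hullPair hl
  obtain ⟨p, _, hp⟩ := Set.exists_min_image _ (fun p : HullPair rk l => interp rk v l p.1)
    (h.finite_interp_le l (interp rk v l p₀.1)) ⟨p₀, le_refl (interp rk v l p₀.1)⟩
  have hmin : ∀ q : HullPair rk l, interp rk v l p.1 ≤ interp rk v l q.1 := by
    intro q
    rcases le_total (interp rk v l q.1) (interp rk v l p₀.1) with h1 | h1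
    · exact hp q h1
    · exact (hp p₀ (le_refl (interp rk v l p₀.1))).trans h1
  exact ⟨p, le_antisymm (ciInf_le ⟨_, Set.forall_mem_range.2 hmin⟩ p)
    (@le_ciInf _ _ _ ⟨p⟩ _ _ hmin)⟩

theorem IsRanked.lowerHull_le_interp (h : IsRanked n rk v) (p : HullPair rk l) :
    lowerHull rk v l ≤ interp rk v l p.1 := by
  obtain ⟨D, hD⟩ := h.exists_lower_bound
  refine ciInf_le ⟨D, Set.forall_mem_range.2 fun q => ?_⟩ p
  obtain ⟨h1, h2⟩ := pairWeight_bounds h.rk_le q.2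
  rw [interp]
  nlinarith [hD q.1.1, hD q.1.2]

theorem IsRanked.lowerHull_le (h : IsRanked n rk v) {A : ι} (hA : rk A = l) :
    lowerHull rk v l ≤ v A := by
  have := h.lowerHull_le_interp (l := l) ⟨(A, A), Or.inl ⟨rfl, hA⟩⟩
  rwa [interp_diag] at this

/-- The lower hull has supporting lines. -/
theorem IsRanked.exists_support (h : IsRanked n rk v) (hl : l ≤ n) :
    ∃ m : ℝ, ∀ A, lowerHull rk v l + m * ((rk A : ℝ) - l) ≤ v A := by
  obtain ⟨D, hD⟩ := h.exists_lower_bound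
  set y := lowerHull rk v l with hy
  rcases Nat.eq_zero_or_pos l with hl0 | hl0
  · refine ⟨min 0 (D - y), fun A => ?_⟩
    rcases Nat.eq_zero_or_pos (rk A) with hA | hA
    · rw [hA, hl0]; simpa using h.lowerHull_le (hA.trans hl0.symm)
    · have h1 : (1 : ℝ) ≤ rk A := by exact_mod_cast hA
      have h2 : (l : ℝ) = 0 := by simp [hl0]
      nlinarith [min_le_left 0 (D - y), min_le_right 0 (D - y), hD A]
  rcases hl.eq_or_lt with hln | hln
  · refine ⟨max 0 (y - D), fun A => ?_⟩
    rcases (h.rk_le A).eq_or_lt with hA | hA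
    · rw [hA, hln]; simpa using h.lowerHull_le (hA.trans hln.symm)
    · have h1 : (rk A : ℝ) + 1 ≤ n := by exact_mod_cast hA
      have h2 : (l : ℝ) = n := by simp [hln]
      nlinarith [le_max_left 0 (y - D), le_max_right 0 (y - D), hD A]
  obtain ⟨A₀, hA₀⟩ := h.exists_rk_zero
  obtain ⟨B₀, hB₀⟩ := h.exists_rk_top
  -- Slopes of chords arriving from the left do not exceed those leaving to the right, since y lies
  -- below every segment across l. The supremum of the former is a supporting slope.
  have hcross : ∀ A B, rk A < l → l < rk B →
      (y - v A) / ((l : ℝ) - rk A) ≤ (v B - y) / ((rk B : ℝ) - l) := by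
    intro A B hA hB
    have h1 : (0 : ℝ) < l - rk A := sub_pos.2 (by exact_mod_cast hA)
    have h2 : (0 : ℝ) < rk B - l := sub_pos.2 (by exact_mod_cast hB)
    have h3 := h.lowerHull_le_interp (l := l) ⟨(A, B), Or.inr ⟨hA, hB⟩⟩
    rw [← hy, interp] at h3
    have hne : rk A ≠ rk B := by omega
    simp only [pairWeight, hne, if_false] at h3
    have h4 : 1 - ((rk B : ℝ) - l) / (rk B - rk A) = (l - rk A) / (rk B - rk A) := by
      have : (rk B : ℝ) - rk A ≠ 0 := by linarith
      field_simp; ring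
    rw [h4, div_mul_eq_mul_div, div_mul_eq_mul_div, ← add_div, le_div_iff₀ (by linarith)] at h3
    rw [div_le_div_iff₀ h1 h2]
    nlinarith
  let S : Set ℝ := {x | ∃ A, rk A < l ∧ x = (y - v A) / ((l : ℝ) - rk A)}
  have hSb : ∀ B, l < rk B → (v B - y) / ((rk B : ℝ) - l) ∈ upperBounds S := by
    rintro B hB _ ⟨A, hA, rfl⟩
    exact hcross A B hA hB
  have hSn : S.Nonempty := ⟨_, A₀, by omega, rfl⟩
  refine ⟨sSup S, fun A => ?_⟩
  rcases lt_trichotomy (rk A) l with hA | hA | hA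
  · have h1 : (0 : ℝ) < l - rk A := sub_pos.2 (by exact_mod_cast hA)
    have h2 := le_csSup ⟨_, hSb B₀ (by omega)⟩ ⟨A, hA, rfl⟩
    rw [div_le_iff₀ h1] at h2
    linarith
  · rw [hA, sub_self, mul_zero, add_zero]; exact h.lowerHull_le hA
  · have h1 : (0 : ℝ) < rk A - l := sub_pos.2 (by exact_mod_cast hA)
    have h2 := csSup_le hSn (hSb A hA)
    rw [le_div_iff₀ h1] at h2
    linarith

/-- A line below all points is below the lower hull. -/
theorem IsRanked.le_lowerHull (h : IsRanked n rk v) (hl : l ≤ n) {m q : ℝ}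
    (hm : ∀ A, q + m * rk A ≤ v A) : q + m * l ≤ lowerHull rk v l := by
  obtain ⟨p, hp⟩ := h.exists_lowerHull_eq hl
  obtain ⟨h1, h2⟩ := pairWeight_bounds h.rk_le p.2
  have h3 := pairWeight_rank p.2
  rw [hp, interp]
  rw [← h3]
  nlinarith [mul_le_mul_of_nonneg_left (hm p.1.1) h1,
    mul_le_mul_of_nonneg_left (hm p.1.2) (sub_nonneg.2 h2)]

/-- The chord bound without denominators: the supporting line at l is tested at A and B. In this
form the cases where l is the rank of A or of B are included. -/
theorem IsRanked.lowerHull_mul_le (h : IsRanked n rk v) (hl : l ≤ n) {A B : ι}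
    (hA : rk A ≤ l) (hB : l ≤ rk B) :
    lowerHull rk v l * ((rk B : ℝ) - rk A) ≤
      ((rk B : ℝ) - l) * v A + ((l : ℝ) - rk A) * v B := by
  obtain ⟨m, hm⟩ := h.exists_support hl
  have h1 : (0 : ℝ) ≤ l - rk A := sub_nonneg.2 (by exact_mod_cast hA)
  have h2 : (0 : ℝ) ≤ rk B - l := sub_nonneg.2 (by exact_mod_cast hB)
  nlinarith [mul_le_mul_of_nonneg_left (hm A) h2, mul_le_mul_of_nonneg_left (hm B) h1]

theorem IsRanked.secondDiff_nonneg (h : IsRanked n rk v) (hl1 : 1 ≤ l) (hln : l < n) :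
    0 ≤ secondDiff (lowerHull rk v) l := by
  obtain ⟨m, hm⟩ := h.exists_support hln.le
  have hm' : ∀ A, (lowerHull rk v l - m * l) + m * rk A ≤ v A := fun A => by linarith [hm A]
  have h1 := h.le_lowerHull (l := l - 1) (by omega) hm'
  have h2 := h.le_lowerHull (l := l + 1) (by omega) hm'
  rw [Nat.cast_sub hl1] at h1
  push_cast at h1 h2
  rw [secondDiff]
  linarith

/-- At a vertex the lower hull is attained. -/
theorem IsRanked.exists_vertex (h : IsRanked n rk v) (hl1 : 1 ≤ l) (hln : l < n)
    (hd : 0 < secondDiff (lowerHull rk v) l) : ∃ A, rk A = l ∧ v A = lowerHull rk v l := by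
  obtain ⟨⟨⟨A, B⟩, hp⟩, hpe⟩ := h.exists_lowerHull_eq hln.le
  rcases hp with ⟨h1, h2⟩ | ⟨h1, h2⟩
  · simp only at h1 h2
    subst h1
    exact ⟨A, h2, by rw [hpe, interp_diag]⟩
  -- If the hull at l lies on a segment with endpoints on both sides of l, then at l - 1 and l + 1
  -- it is at most that segment, forcing a second difference ≤ 0.
  · exfalso
    simp only at h1 h2
    have h3 := h.lowerHull_mul_le (l := l - 1) (A := A) (B := B) (by omega) (by omega) (by omega)
    have h4 := h.lowerHull_mul_le (l := l + 1) (A := A) (B := B) (by omega) (by omega) (by omega)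
    have hne : rk A ≠ rk B := by omega
    have hpos : (0 : ℝ) < rk B - rk A := sub_pos.2 (by exact_mod_cast h1.trans h2)
    simp only [interp, pairWeight, hne, if_false] at hpe
    have h5 : lowerHull rk v l * ((rk B : ℝ) - rk A) =
        ((rk B : ℝ) - l) * v A + ((l : ℝ) - rk A) * v B := by
      rw [hpe]; field_simp; ring
    rw [Nat.cast_sub hl1] at h3
    push_cast at h3 h4
    rw [secondDiff] at hd
    have := mul_pos hd hpos
    nlinarith

/-- Away from the rank of a vertex, the values lie well above the tangent. -/
theorem IsRanked.tangent_add_le (h : IsRanked n rk v) (hl1 : 1 ≤ l) (hln : l < n) {A : ι}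
    (hA : rk A = l) (hv : v A = lowerHull rk v l) {B : ι} (hB : rk B ≠ l) :
    v A + (lowerHull rk v (l + 1) - lowerHull rk v (l - 1)) / 2 * ((rk B : ℝ) - l) +
      secondDiff (lowerHull rk v) l / 2 ≤ v B := by
  have hd := h.secondDiff_nonneg hl1 hln
  -- The averaged slope differs from each one-sided slope of the hull at l by half the second
  -- difference, and every point of another rank is at least one step away.
  rcases lt_or_gt_of_ne hB with hB | hB
  · have h3 := h.lowerHull_mul_le (l := l - 1) (A := B) (B := A) (by omega) (by omega) (by omega)
    rw [Nat.cast_sub hl1, hA, hv] at h3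
    push_cast at h3
    have h4 : (rk B : ℝ) + 1 ≤ l := by exact_mod_cast hB
    rw [secondDiff] at hd ⊢
    rw [hv]
    nlinarith
  · have h3 := h.lowerHull_mul_le (l := l + 1) (A := A) (B := B) (by omega) (by omega) (by omega)
    rw [hA, hv] at h3
    push_cast at h3
    have h4 : (l : ℝ) + 1 ≤ rk B := by exact_mod_cast hB
    rw [secondDiff] at hd ⊢
    rw [hv]
    nlinarith

/-- A minimum of piecewise linear interpolations. The uniform Lipschitz bound makes the family
locally finite: within distance 1 of t each value is at least v A t - M. -/
theorem isPL_lowerHull {v : ι → ℝ → ℝ} {M : ℝ} (h : ∀ t, IsRanked n rk fun A => v A t)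
    (hv : ∀ A, IsPL (v A)) (hM : ∀ A s t, |v A t - v A s| ≤ M * |t - s|) (hM0 : 0 ≤ M)
    (hl : l ≤ n) : IsPL fun t => lowerHull rk (fun A => v A t) l := by
  refine isPL_of_min (u := fun (p : HullPair rk l) t => interp rk (fun A => v A t) l p.1)
    (fun s p => (h s).lowerHull_le_interp p) (fun s => (h s).exists_lowerHull_eq hl)
    (fun p => ((hv _).const_mul _).add ((hv _).const_mul _)) fun t B => ?_
  have hw : IsRanked n rk fun A => v A t - M :=
    ⟨(h t).rk_le, (h t).exists_rk_zero, (h t).exists_rk_top, fun C =>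
      ((h t).finite_le (C + M)).subset fun A (hA : v A t - M ≤ C) => sub_le_iff_le_add.1 hA⟩
  refine (hw.finite_interp_le l B).subset ?_
  rintro p ⟨s, hs, hp⟩
  refine (interp_mono (h t).rk_le (fun A => ?_) p).trans hp
  have h1 := (abs_le.1 (hM A s t)).2
  rw [abs_sub_comm] at hs
  have h2 := mul_le_mul_of_nonneg_left hs hM0
  linarith

end LowerHull

end GTemplate

namespace GTemplate

open Filter Set

/-! ### Bounds for sums of weights. -/

section Weights

variable {n : ℕ} (η : Fin n → ℝ)

/-- A bound for the absolute values of sums of weights. -/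
def weightBound : ℝ := ∑ i, |η i|

theorem weightBound_nonneg : 0 ≤ weightBound η := Finset.sum_nonneg fun _ _ => abs_nonneg _

theorem abs_le_weightBound (i : Fin n) : |η i| ≤ weightBound η :=
  Finset.single_le_sum (f := fun i => |η i|) (fun _ _ => abs_nonneg _) (Finset.mem_univ i)

theorem abs_sum_le_weightBound {E : Multiset ℝ} (h : E ≤ Eall η) : |E.sum| ≤ weightBound η := by
  refine (Multiset.abs_sum_le_sum_abs (s := E)).trans ?_
  obtain ⟨E', hE'⟩ := Multiset.le_iff_exists_add.1 h
  have h1 : ((Eall η).map abs).sum = weightBound η := by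
    rw [Eall, Multiset.map_map]; rfl
  rw [← h1, hE', Multiset.map_add, Multiset.sum_add]
  refine le_add_of_nonneg_right (Multiset.sum_nonneg fun x hx => ?_)
  obtain ⟨y, _, rfl⟩ := Multiset.mem_map.1 hx
  exact abs_nonneg y

end Weights

/-! ### Parameters of the construction -/

/-- The time scale of the construction, with the constants it depends on. -/
structure Scale {n : ℕ} (η : Fin n → ℝ) where
  /-- a lower bound for the gaps between different weights -/
  gap : ℝ
  gap_pos : 0 < gap
  gap_le : ∀ i j, η i ≠ η j → gap ≤ |η i - η j|
  /-- the constant in the comparison of the off-diagonal blocks with the growth of the slope -/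
  growth : ℝ
  growth_nonneg : 0 ≤ growth
  offBlock_le : ∀ P, IsFlowProj η P → ∀ t,
    offBlock η (P t) ≤ growth * (slope η (P (t + 1)) - slope η (P t))
  /-- the length of the windows -/
  len : ℕ
  len_pos : 0 < len
  small : 2 / gap ^ 2 * (growth * (2 * (n + 1) * weightBound η / len)) < 1 / 2

namespace Scale

variable {n : ℕ} {η : Fin n → ℝ} (c : Scale η)

/-- The bound for the off-diagonal blocks at the sample times. -/
def small_bound : ℝ := c.growth * (2 * (n + 1) * weightBound η / c.len)

/-- The bound for the distance between the piecewise linear and the true heights. -/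
def dist : ℝ := 4 * (weightBound η * (2 / c.gap ^ 2) * c.growth + 1) * (c.len + 1) * weightBound η

/-- The tolerance in the definition of relevant elements. -/
def tol : ℝ := 4 * c.dist + 8 * c.len * weightBound η

/-- The concave correction. -/
def corr (r : ℕ) : ℝ := (c.tol + 1) * (r * (n - r))

theorem dist_nonneg : 0 ≤ c.dist := by
  have h1 := weightBound_nonneg η
  have h2 := c.growth_nonneg
  have h3 := c.gap_pos
  unfold dist
  positivity

theorem tol_nonneg : 0 ≤ c.tol := by
  have h1 := weightBound_nonneg η
  have h2 := c.dist_nonneg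
  unfold tol
  positivity

theorem corr_nonneg {r : ℕ} (hr : r ≤ n) : 0 ≤ c.corr r := by
  have h1 := c.tol_nonneg
  have h2 : (0 : ℝ) ≤ n - r := sub_nonneg.2 (by exact_mod_cast hr)
  unfold corr
  positivity

theorem corr_le {r : ℕ} (hr : r ≤ n) : c.corr r ≤ (c.tol + 1) * n ^ 2 := by
  have h1 := c.tol_nonneg
  have h2 : (r : ℝ) ≤ n := by exact_mod_cast hr
  have h3 : (0 : ℝ) ≤ r := Nat.cast_nonneg r
  refine mul_le_mul_of_nonneg_left ?_ (by linarith)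
  nlinarith

theorem corr_zero : c.corr 0 = 0 := by simp [corr]

theorem corr_top : c.corr n = 0 := by simp [corr]

end Scale

/-! ### Ranks, relevance, and the piecewise linear heights of a flow system. -/

namespace FlowSystem

variable {n : ℕ} {η : Fin n → ℝ} {ι : Type*} [PartialOrder ι] [BoundedOrder ι]
  (S : FlowSystem η ι) (c : Scale η)

theorem isProjMat (A : ι) (t : ℝ) : IsProjMat (S.P A t) := (S.isFlowProj A).proj t

theorem rk_mono {A B : ι} (h : A ≤ B) : S.rk A ≤ S.rk B := by
  have h1 := S.trace_P A 0
  have h2 := S.trace_P B 0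
  have h3 : (S.P A 0).trace ≤ (S.P B 0).trace := Finset.sum_le_sum fun i _ => S.diag_mono h 0 i
  rw [h1, h2] at h3
  exact_mod_cast h3

theorem rk_bot : S.rk ⊥ = 0 := by
  have h := S.trace_P ⊥ 0
  rw [S.P_bot, Matrix.trace_zero] at h
  exact_mod_cast h.symm

theorem rk_top : S.rk ⊤ = n := by
  have h := S.trace_P ⊤ 0
  rw [S.P_top, Matrix.trace_one, Fintype.card_fin] at h
  exact_mod_cast h.symm

theorem rk_le (A : ι) : S.rk A ≤ n := (S.rk_mono le_top).trans_eq S.rk_top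

theorem eq_bot {A : ι} (h : S.rk A = 0) : A = ⊥ :=
  (S.eq_of_le bot_le (by rw [h, S.rk_bot])).symm

theorem eq_top {A : ι} (h : S.rk A = n) : A = ⊤ :=
  S.eq_of_le le_top (by rw [h, S.rk_top])

theorem abs_slope_le' (A : ι) (t : ℝ) : |slope η (S.P A t)| ≤ weightBound η :=
  abs_slope_le (S.isProjMat A t)

theorem abs_ψ_sub_le (A : ι) (s t : ℝ) : |S.ψ A t - S.ψ A s| ≤ weightBound η * |t - s| :=
  abs_sub_le_of_hasDerivAt (S.hasDerivAt_ψ A) (S.abs_slope_le' A) s t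

/-! ### Relevant elements -/

/-- The corrected point of `A` is close to a supporting line. -/
def IsRelevant (t : ℝ) (A : ι) : Prop :=
  ∃ m : ℝ, ∀ B, S.ψ A t + c.corr (S.rk A) - c.tol + m * ((S.rk B : ℝ) - S.rk A) ≤
    S.ψ B t + c.corr (S.rk B)

variable {S c} in
-- An uncrossing argument. If A ≤ B fails, submodularity gives I and J with the same total rank and
-- no larger total ψ, while the concave corrections of A and B exceed those of I and J by at least
-- 2(tol + 1). This beats the two tolerances.
theorem IsRelevant.le {t : ℝ} {A B : ι} (hA : S.IsRelevant c t A) (hB : S.IsRelevant c t B)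
    (hr : S.rk A ≤ S.rk B) : A ≤ B := by
  by_contra hAB
  obtain ⟨I, J, h1, h2, h3⟩ := S.exists_modular A B hAB
  obtain ⟨m, hm⟩ := hA
  obtain ⟨m', hm'⟩ := hB
  have hd : (S.rk I : ℝ) + 1 ≤ S.rk A := by exact_mod_cast h1
  have hIJ : (S.rk J : ℝ) = S.rk A + S.rk B - S.rk I := by
    have : (S.rk I : ℝ) + S.rk J = S.rk A + S.rk B := by exact_mod_cast h2
    linarith
  have hr' : (S.rk A : ℝ) ≤ S.rk B := by exact_mod_cast hr
  have h4 := h3 t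
  have hAI := hm I
  have hAJ := hm J
  have hBI := hm' I
  have hBJ := hm' J
  have ht := c.tol_nonneg
  have hcorr : c.corr (S.rk I) + c.corr (S.rk J) + 2 * (c.tol + 1) ≤
      c.corr (S.rk A) + c.corr (S.rk B) := by
    simp only [Scale.corr]
    rw [hIJ]
    set a := (S.rk A : ℝ)
    set b := (S.rk B : ℝ)
    set i := (S.rk I : ℝ)
    have h5 : a * (n - a) + b * (n - b) - (i * (n - i) + (a + b - i) * (n - (a + b - i))) =
        2 * ((a - i) * (b - i)) := by ring
    have h6 : 1 ≤ (a - i) * (b - i) := by nlinarith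
    nlinarith
  rw [hIJ] at hAJ hBJ
  -- The two supporting lines are tested at (I, J) or at (J, I), according to which pairing makes
  -- the slope terms add up to something nonnegative.
  rcases le_total m m' with hmm | hmm
  · nlinarith
  · nlinarith

variable {S c} in
theorem IsRelevant.eq {t : ℝ} {A B : ι} (hA : S.IsRelevant c t A) (hB : S.IsRelevant c t B)
    (hr : S.rk A = S.rk B) : A = B := S.eq_of_le (hA.le hB hr.le) hr

/-- There is a time in every window at which the relevant slopes do not grow much. -/
theorem exists_sample (k : ℤ) : ∃ j : ℕ, j < c.len ∧ ∀ A, S.IsRelevant c (k * c.len) A →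
    slope η (S.P A (k * c.len + j + 1)) - slope η (S.P A (k * c.len + j)) ≤
      2 * (n + 1) * weightBound η / c.len := by
  set N := {A | S.IsRelevant c (k * c.len) A} with hN
  -- Relevant elements are determined by their rank, so there are at most n + 1 of them.
  have hinj : InjOn S.rk N := fun A hA B hB h => hA.eq hB h
  have hmaps : MapsTo S.rk N (Finset.range (n + 1) : Finset ℕ) := fun A _ => by
    simpa [Nat.lt_succ_iff] using S.rk_le A
  have hfin : N.Finite := Finite.of_injOn hmaps hinj (Finset.finite_toSet _)
  set N' := hfin.toFinset
  have hcard : (N'.card : ℝ) ≤ n + 1 := by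
    have : N'.card ≤ (Finset.range (n + 1)).card :=
      Finset.card_le_card_of_injOn S.rk (fun A hA => hmaps (hfin.mem_toFinset.1 hA))
        (fun A hA B hB h => hinj (hfin.mem_toFinset.1 hA) (hfin.mem_toFinset.1 hB) h)
    rw [Finset.card_range] at this
    exact_mod_cast this
  set T : ℝ := k * c.len
  set Δ : ι → ℕ → ℝ := fun A j => slope η (S.P A (T + j + 1)) - slope η (S.P A (T + j)) with hΔ
  have hΔ0 : ∀ A j, 0 ≤ Δ A j := fun A j =>
    sub_nonneg.2 ((S.isFlowProj A).monotone_slope (by linarith))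
  have htel : ∀ A, ∑ j ∈ Finset.range c.len, Δ A j ≤ 2 * weightBound η := by
    intro A
    have h1 := Finset.sum_range_sub (fun j : ℕ => slope η (S.P A (T + j))) c.len
    have h2 : ∑ j ∈ Finset.range c.len, Δ A j =
        slope η (S.P A (T + c.len)) - slope η (S.P A (T + (0 : ℕ))) := by
      rw [← h1]
      refine Finset.sum_congr rfl fun j _ => ?_
      rw [hΔ]; push_cast; rw [add_assoc]
    rw [h2]
    linarith [(abs_le.1 (S.abs_slope_le' A (T + c.len))).2,
      (abs_le.1 (S.abs_slope_le' A (T + (0 : ℕ)))).1]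
  have hlen : (0 : ℝ) < c.len := by exact_mod_cast c.len_pos
  -- Each slope grows by at most 2 · `weightBound` over the window, so some unit step has at most
  -- the average total growth. All increments are nonnegative, hence the bound holds for each
  -- element separately.
  have hsum : ∑ j ∈ Finset.range c.len, ∑ A ∈ N', Δ A j ≤
      ∑ _j ∈ Finset.range c.len, 2 * (n + 1) * weightBound η / c.len := by
    rw [Finset.sum_comm, Finset.sum_const, Finset.card_range, nsmul_eq_mul,
      mul_div_cancel₀ _ hlen.ne']
    refine (Finset.sum_le_sum fun A _ => htel A).trans ?_
    rw [Finset.sum_const, nsmul_eq_mul]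
    nlinarith [weightBound_nonneg η]
  obtain ⟨j, hj, hle⟩ := Finset.exists_le_of_sum_le
    (Finset.nonempty_range_iff.2 c.len_pos.ne') hsum
  refine ⟨j, Finset.mem_range.1 hj, fun A hA => ?_⟩
  exact (Finset.single_le_sum (f := fun A => Δ A j) (fun A _ => hΔ0 A j)
    (hfin.mem_toFinset.2 hA)).trans hle

/-- The sample time of a window. -/
def sample (k : ℤ) : ℝ := k * c.len + (S.exists_sample c k).choose

theorem le_sample (k : ℤ) : k * c.len ≤ S.sample c k := le_add_of_nonneg_right (Nat.cast_nonneg _)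

theorem sample_add_one_le (k : ℤ) : S.sample c k + 1 ≤ (k + 1) * c.len := by
  have h := (S.exists_sample c k).choose_spec.1
  have h1 : ((S.exists_sample c k).choose : ℝ) + 1 ≤ c.len := by exact_mod_cast h
  rw [sample]
  linarith

variable {S c} in
theorem IsRelevant.offBlock_sample_le {k : ℤ} {A : ι} (h : S.IsRelevant c (k * c.len) A) :
    offBlock η (S.P A (S.sample c k)) ≤ c.small_bound :=
  (c.offBlock_le _ (S.isFlowProj A) _).trans
    (mul_le_mul_of_nonneg_left ((S.exists_sample c k).choose_spec.2 A h) c.growth_nonneg)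

/-- The type of `A` in a window. -/
def typ (k : ℤ) (A : ι) : Multiset ℝ := projType η (S.P A (S.sample c k))

theorem typ_le (k : ℤ) (A : ι) : S.typ c k A ≤ Eall η := projType_le_Eall (S.isProjMat A _)

theorem typ_mono (k : ℤ) {A B : ι} (h : A ≤ B) : S.typ c k A ≤ S.typ c k B :=
  projType_mono (S.diag_mono h _)

theorem typ_bot (k : ℤ) : S.typ c k ⊥ = 0 := by rw [typ, S.P_bot, projType_zero]

theorem typ_top (k : ℤ) : S.typ c k ⊤ = Eall η := by rw [typ, S.P_top, projType_one]

variable {S c} in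
theorem IsRelevant.two_div_mul_offBlock_lt {k : ℤ} {A : ι} (h : S.IsRelevant c (k * c.len) A) :
    2 / c.gap ^ 2 * offBlock η (S.P A (S.sample c k)) < 1 / 2 := by
  have h1 := c.gap_pos
  exact (mul_le_mul_of_nonneg_left h.offBlock_sample_le (by positivity)).trans_lt c.small

variable {S c} in
theorem IsRelevant.card_typ {k : ℤ} {A : ι} (h : S.IsRelevant c (k * c.len) A) :
    (S.typ c k A).card = S.rk A :=
  card_projType c.gap_pos c.gap_le (S.isProjMat A _) (S.trace_P A _)
    (h.two_div_mul_offBlock_lt.trans (by norm_num))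

/-- The piecewise linear approximation of the logarithmic covolume. -/
def φ (A : ι) (t : ℝ) : ℝ := S.ψ A 0 + stepPrimitive c.len (fun k => (S.typ c k A).sum) t

theorem abs_sum_typ_le (A : ι) (k : ℤ) : |(S.typ c k A).sum| ≤ weightBound η :=
  abs_sum_le_weightBound η (S.typ_le c k A)

theorem len_pos' : (0 : ℝ) < c.len := by exact_mod_cast c.len_pos

theorem floor_mul_le (t : ℝ) : ⌊t / c.len⌋ * (c.len : ℝ) ≤ t :=
  (le_div_iff₀ (len_pos' c)).1 (Int.floor_le _)

theorem lt_floor_add_one_mul (t : ℝ) : t < (⌊t / c.len⌋ + 1) * (c.len : ℝ) :=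
  (div_lt_iff₀ (len_pos' c)).1 (Int.lt_floor_add_one _)

/-- Both the rounding error at the sample time and the change of slope from there to x are bounded
by increments of the monotone slope near x, so the error integrates to a constant. Relevance of A
plays no role, which is needed to compare with all competitors. -/
theorem abs_φ_sub_ψ_le (A : ι) (t : ℝ) : |S.φ c A t - S.ψ A t| ≤ c.dist := by
  have h0 := weightBound_nonneg η
  have h1 := c.gap_pos
  have h2 := c.growth_nonneg
  set C := weightBound η * (2 / c.gap ^ 2) * c.growth with hC
  have hC0 : 0 ≤ C := by positivity
  have hmono := (S.isFlowProj A).monotone_slope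
  -- The summand 1 in C + 1 pays for passing from x to the sample time s; s and s + 1 lie within
  -- `len` + 1 of x.
  refine abs_stepPrimitive_sub_le (S.abs_sum_typ_le c A) (S.hasDerivAt_ψ A) hmono
    (S.abs_slope_le' A) (C := C + 1) (D := c.len + 1) (by positivity) (by positivity) ?_ t
  intro x
  set k := ⌊x / c.len⌋
  have hk1 := floor_mul_le c x
  have hk2 := lt_floor_add_one_mul c x
  have hs1 := S.le_sample c k
  have hs2 := S.sample_add_one_le c k
  set s := S.sample c k
  have h3 : |slope η (S.P A s) - (S.typ c k A).sum| ≤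
      weightBound η * (2 / c.gap ^ 2 * offBlock η (S.P A s)) :=
    abs_sub_sum_projType_le c.gap_pos c.gap_le (abs_le_weightBound η) (S.isProjMat A s)
  have h4 := c.offBlock_le _ (S.isFlowProj A) s
  set F : ℝ → ℝ := fun t => slope η (S.P A t)
  have h5 : F (s + 1) - F s ≤ F (x + (c.len + 1)) - F (x - (c.len + 1)) :=
    sub_le_sub (hmono (by linarith)) (hmono (by linarith))
  have h6 : |F s - F x| ≤ F (x + (c.len + 1)) - F (x - (c.len + 1)) := by
    have hlen := len_pos' c
    have a1 : F s ≤ F (x + (c.len + 1)) := hmono (by linarith)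
    have a2 : F (x - (c.len + 1)) ≤ F s := hmono (by linarith)
    have a3 : F x ≤ F (x + (c.len + 1)) := hmono (by linarith)
    have a4 : F (x - (c.len + 1)) ≤ F x := hmono (by linarith)
    rw [abs_le]; constructor <;> linarith
  have h7 : weightBound η * (2 / c.gap ^ 2 * offBlock η (S.P A s)) ≤
      C * (F (x + (c.len + 1)) - F (x - (c.len + 1))) := by
    calc weightBound η * (2 / c.gap ^ 2 * offBlock η (S.P A s))
        ≤ weightBound η * (2 / c.gap ^ 2 * (c.growth * (F (s + 1) - F s))) := by gcongr
      _ = C * (F (s + 1) - F s) := by rw [hC]; ring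
      _ ≤ _ := mul_le_mul_of_nonneg_left h5 hC0
  have h8 : |(S.typ c k A).sum - F x| ≤ |F s - (S.typ c k A).sum| + |F s - F x| := by
    rw [abs_sub_comm (F s)]
    exact abs_sub_le _ _ _
  linarith

/-! ### Heights -/

/-- The corrected piecewise linear height of an element. -/
def val (A : ι) (t : ℝ) : ℝ := S.φ c A t + c.corr (S.rk A)

theorem val_bot (t : ℝ) : S.val c ⊥ t = 0 := by
  simp [val, φ, typ_bot, stepPrimitive, S.ψ_bot, S.rk_bot, c.corr_zero]

theorem val_top (hsum : ∑ i, η i = 0) (t : ℝ) : S.val c ⊤ t = 0 := by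
  have h : (Eall η).sum = 0 := hsum
  simp [val, φ, typ_top, stepPrimitive, S.ψ_top, S.rk_top, c.corr_top, h]

theorem isPL_val (A : ι) : IsPL (S.val c A) :=
  ((isPL_const _).add (isPL_stepPrimitive (len_pos' c) (S.abs_sum_typ_le c A))).add (isPL_const _)

theorem hasSlope_val_right (A : ι) (t : ℝ) :
    HasSlope (𝓝[>] t) t (S.val c A) (S.typ c ⌊t / c.len⌋ A).sum := by
  have h := ((hasSlope_const (𝓝[>] t) t (S.ψ A 0)).add (hasSlope_stepPrimitive_right (len_pos' c)
    (S.abs_sum_typ_le c A) t)).add (hasSlope_const _ t (c.corr (S.rk A)))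
  rwa [zero_add, add_zero] at h

theorem hasSlope_val_left (A : ι) (t : ℝ) :
    HasSlope (𝓝[<] t) t (S.val c A) (-(S.typ c (⌈t / c.len⌉ - 1) A).sum) := by
  have h := ((hasSlope_const (𝓝[<] t) t (S.ψ A 0)).add (hasSlope_stepPrimitive_left (len_pos' c)
    (S.abs_sum_typ_le c A) t)).add (hasSlope_const _ t (c.corr (S.rk A)))
  rwa [zero_add, add_zero] at h

theorem abs_val_sub_le (A : ι) (s t : ℝ) :
    |S.val c A t - S.val c A s| ≤ weightBound η * |t - s| := by
  have h : S.val c A t - S.val c A s = stepPrimitive c.len (fun k => (S.typ c k A).sum) t -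
      stepPrimitive c.len (fun k => (S.typ c k A).sum) s := by
    simp only [val, φ]; ring
  rw [h, stepPrimitive_sub (S.abs_sum_typ_le c A), ← Real.norm_eq_abs]
  exact intervalIntegral.norm_integral_le_of_norm_le_const fun x _ => S.abs_sum_typ_le c A _

theorem isRanked_val (t : ℝ) : IsRanked n S.rk fun A => S.val c A t where
  rk_le := S.rk_le
  exists_rk_zero := ⟨⊥, S.rk_bot⟩
  exists_rk_top := ⟨⊤, S.rk_top⟩
  finite_le C := (S.finite_le t (C + c.dist)).subset fun A (hA : S.val c A t ≤ C) => by
    have h1 := (abs_le.1 (S.abs_φ_sub_ψ_le c A t)).1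
    have h2 := c.corr_nonneg (S.rk_le A)
    rw [val] at hA
    change S.ψ A t ≤ _
    linarith

/-- The heights of the template. -/
def height (t : ℝ) (l : ℕ) : ℝ := lowerHull S.rk (fun A => S.val c A t) l

theorem isPL_height {l : ℕ} (hl : l ≤ n) : IsPL fun t => S.height c t l :=
  isPL_lowerHull (S.isRanked_val c) (S.isPL_val c) (S.abs_val_sub_le c) (weightBound_nonneg η) hl

theorem isPL_secondDiff {l : ℕ} (hl : l < n) : IsPL fun t => secondDiff (S.height c t) l := by
  have h1 := (S.isPL_height c (l := l - 1) (by omega)).add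
    ((S.isPL_height c hl.le).const_mul (-2))
  have h2 := h1.add (S.isPL_height c (l := l + 1) hl)
  have h3 : (fun t => secondDiff (S.height c t) l) = fun t =>
      S.height c t (l - 1) + -2 * S.height c t l + S.height c t (l + 1) := by
    funext t; rw [secondDiff]; ring
  rw [h3]; exact h2

variable {c} in
/-- Elements which nearly realize the height are relevant at nearby times. -/
theorem isRelevant_of_val_le {t : ℝ} {A : ι} (h : S.val c A t ≤ S.height c t (S.rk A) + 2 * c.dist)
    {u : ℝ} (hu : |t - u| ≤ 4 * c.len) : S.IsRelevant c u A := by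
  obtain ⟨m, hm⟩ := (S.isRanked_val c t).exists_support (S.rk_le A)
  refine ⟨m, fun B => ?_⟩
  have h1 := hm B
  have h2 := abs_le.1 (S.abs_φ_sub_ψ_le c A t)
  have h3 := abs_le.1 (S.abs_φ_sub_ψ_le c B t)
  have h4 := abs_le.1 (S.abs_ψ_sub_le A u t)
  have h5 := abs_le.1 (S.abs_ψ_sub_le B u t)
  have h6 := mul_le_mul_of_nonneg_left hu (weightBound_nonneg η)
  simp only [val, height] at h h1
  -- The tolerance: 2 dist for the slack in `h`, one dist each for A and B in passing from φ to ψ,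
  -- and 4 · `len` · `weightBound` each for moving from t to u.
  rw [Scale.tol]
  linarith [h2.1, h2.2, h3.1, h3.2, h4.1, h4.2, h5.1, h5.2]

end FlowSystem

end GTemplate

namespace GTemplate

open Filter Set

namespace FlowSystem

variable {n : ℕ} {η : Fin n → ℝ} {ι : Type*} [PartialOrder ι] [BoundedOrder ι]
  (S : FlowSystem η ι) (c : Scale η)

/-! ### Vertices -/

/-- The index `l` carries a vertex of the heights at time `t`. -/
def HasVertex (t : ℝ) (l : ℕ) : Prop :=
  l = 0 ∨ l = n ∨ (1 ≤ l ∧ l < n ∧ 0 < secondDiff (S.height c t) l)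

theorem hasVertex_iff {t : ℝ} {l : ℕ} (h1 : 1 ≤ l) (hn : l < n) :
    S.HasVertex c t l ↔ 0 < secondDiff (S.height c t) l := by
  unfold HasVertex
  constructor
  · rintro (h | h | h)
    · omega
    · omega
    · exact h.2.2
  · exact fun h => Or.inr (Or.inr ⟨h1, hn, h⟩)

theorem HasVertex.le {t : ℝ} {l : ℕ} (h : S.HasVertex c t l) : l ≤ n := by
  rcases h with h | h | h <;> omega

theorem height_bot (t : ℝ) : S.height c t 0 = 0 := by
  obtain ⟨⟨⟨A, B⟩, hp⟩, hpe⟩ := (S.isRanked_val c t).exists_lowerHull_eq (Nat.zero_le n)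
  rcases hp with ⟨h1, h2⟩ | ⟨h1, h2⟩
  · simp only at h1 h2
    subst h1
    rw [height, hpe, interp_diag, S.eq_bot h2, S.val_bot]
  · exact absurd h1 (Nat.not_lt_zero _)

theorem height_top (hsum : ∑ i, η i = 0) (t : ℝ) : S.height c t n = 0 := by
  obtain ⟨⟨⟨A, B⟩, hp⟩, hpe⟩ := (S.isRanked_val c t).exists_lowerHull_eq le_rfl
  rcases hp with ⟨h1, h2⟩ | ⟨h1, h2⟩
  · simp only at h1 h2
    subst h1
    rw [height, hpe, interp_diag, S.eq_top h2, S.val_top c hsum]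
  · exact absurd h2 (S.rk_le B).not_gt

theorem HasVertex.exists_eq (hsum : ∑ i, η i = 0) {t : ℝ} {l : ℕ} (h : S.HasVertex c t l)
    :
    ∃ A, S.rk A = l ∧ S.val c A t = S.height c t l := by
  rcases h with rfl | rfl | ⟨h1, h2, h3⟩
  · exact ⟨⊥, S.rk_bot, by rw [S.val_bot, S.height_bot]⟩
  · exact ⟨⊤, S.rk_top, by rw [S.val_top c hsum, S.height_top c hsum]⟩
  · exact (S.isRanked_val c t).exists_vertex h1 h2 h3

open Classical in
/-- The vertex of rank `l` at time `t`. -/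
def vertex (t : ℝ) (l : ℕ) : ι :=
  if h : ∃ A, S.rk A = l ∧ S.val c A t = S.height c t l then h.choose else ⊥

section Vertex

variable {S c}

theorem HasVertex.rk_vertex (hsum : ∑ i, η i = 0) {t : ℝ} {l : ℕ} (h : S.HasVertex c t l)
    :
    S.rk (S.vertex c t l) = l := by
  rw [vertex, dif_pos (h.exists_eq S c hsum)]
  exact (h.exists_eq S c hsum).choose_spec.1

theorem HasVertex.val_vertex (hsum : ∑ i, η i = 0) {t : ℝ} {l : ℕ} (h : S.HasVertex c t l)
    :
    S.val c (S.vertex c t l) t = S.height c t l := by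
  rw [vertex, dif_pos (h.exists_eq S c hsum)]
  exact (h.exists_eq S c hsum).choose_spec.2

theorem HasVertex.isRelevant (hsum : ∑ i, η i = 0) {t : ℝ} {l : ℕ} (h : S.HasVertex c t l) {u
    : ℝ}
    (hu : |t - u| ≤ 4 * c.len) : S.IsRelevant c u (S.vertex c t l) := by
  refine S.isRelevant_of_val_le ?_ hu
  rw [h.val_vertex hsum, h.rk_vertex hsum]
  linarith [c.dist_nonneg]

/-- Both vertices are relevant at the common time u, where an element is determined by its rank. No
vertex needs to exist in between. -/
theorem HasVertex.vertex_eq (hsum : ∑ i, η i = 0) {t t' : ℝ} {l : ℕ} (h : S.HasVertex c t l)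
    (h' : S.HasVertex c t' l)
    {u : ℝ} (hu : |t - u| ≤ 4 * c.len) (hu' : |t' - u| ≤ 4 * c.len) :
    S.vertex c t l = S.vertex c t' l :=
  (h.isRelevant hsum hu).eq (h'.isRelevant hsum hu')
    (by rw [h.rk_vertex hsum, h'.rk_vertex hsum])

end Vertex

theorem HasVertex.eventually {t : ℝ} {l : ℕ} (h : S.HasVertex c t l) :
    ∀ᶠ s in 𝓝 t, S.HasVertex c s l := by
  rcases h with h | h | ⟨h1, h2, h3⟩
  · exact Eventually.of_forall fun s => Or.inl h
  · exact Eventually.of_forall fun s => Or.inr (Or.inl h)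
  · exact ((S.isPL_secondDiff c h2).continuous.tendsto t).eventually (lt_mem_nhds h3) |>.mono
      fun s hs => Or.inr (Or.inr ⟨h1, h2, hs⟩)

/-- On each side of a point, vertices of rank `l` either exist or do not exist. -/
theorem eventually_hasVertex_or {F : Filter ℝ} {t : ℝ} (hF : F = 𝓝[>] t ∨ F = 𝓝[<] t) (l : ℕ)
    :
    (∀ᶠ s in F, S.HasVertex c s l) ∨ ∀ᶠ s in F, ¬ S.HasVertex c s l := by
  by_cases h0 : l = 0
  · exact Or.inl (Eventually.of_forall fun s => Or.inl h0)
  by_cases hn : l = n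
  · exact Or.inl (Eventually.of_forall fun s => Or.inr (Or.inl hn))
  by_cases hl : l < n
  · have h1 : 1 ≤ l := Nat.one_le_iff_ne_zero.2 h0
    have hpl := S.isPL_secondDiff c hl t
    have hF' : F ≤ 𝓝[≠] t := by
      rcases hF with rfl | rfl
      · exact nhdsWithin_mono _ fun x hx => ne_of_gt hx
      · exact nhdsWithin_mono _ fun x hx => ne_of_lt hx
    obtain ⟨a, ha⟩ : ∃ a, HasSlope F t (fun t => secondDiff (S.height c t) l) a := by
      rcases hF with rfl | rfl
      exacts [hpl.1, hpl.2]
    simp only [S.hasVertex_iff c h1 hl]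
    exact ha.eventually_pos_or hF' ((S.isRanked_val c t).secondDiff_nonneg h1 hl)
  · exact Or.inr (Eventually.of_forall fun s h => hl (lt_of_le_of_ne (HasVertex.le S c h) hn))

/-! ### The category flow -/

open Classical in
/-- The value of the category flow. -/
def obj (t : ℝ) (l : ℕ) : StarObj :=
  if S.HasVertex c t l then some (S.typ c ⌊t / c.len⌋ (S.vertex c t l)) else none

theorem obj_of_hasVertex {t : ℝ} {l : ℕ} (h : S.HasVertex c t l) :
    S.obj c t l = some (S.typ c ⌊t / c.len⌋ (S.vertex c t l)) := if_pos h

theorem obj_of_not_hasVertex {t : ℝ} {l : ℕ} (h : ¬ S.HasVertex c t l) :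
    S.obj c t l = none := if_neg h

theorem hasVertex_of_obj {t : ℝ} {l : ℕ} {E : Multiset ℝ} (h : S.obj c t l = some E)
    :
    S.HasVertex c t l := by
  by_contra hh
  rw [S.obj_of_not_hasVertex c hh] at h
  exact Option.some_ne_none _ h.symm

theorem abs_sub_floor_mul_le {s : ℝ} {k : ℤ} (h : ⌊s / c.len⌋ = k) :
    |s - k * c.len| ≤ c.len := by
  have h1 := floor_mul_le c s
  have h2 := lt_floor_add_one_mul c s
  rw [h] at h1 h2
  rw [abs_le]; constructor <;> linarith

section Limits

variable {S c}

/-- On one side of t the window is fixed, existence of a vertex is decided by piecewise linearity,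
and the vertex is then constant; so the one-sided limits exist. -/
theorem exists_eventually_obj_eq (hsum : ∑ i, η i = 0) {F : Filter ℝ} [F.NeBot] {t : ℝ} (hF
    : F = 𝓝[>] t ∨ F = 𝓝[<] t)
    {k : ℤ} (hk : ∀ᶠ s : ℝ in F, ⌊s / c.len⌋ = k) (l : ℕ) :
    ∃ v, ∀ᶠ s in F, S.obj c s l = v := by
  have hlen := len_pos' c
  rcases S.eventually_hasVertex_or c hF l with h | h
  · obtain ⟨s₀, hs₀, hk₀⟩ := (h.and hk).exists
    refine ⟨some (S.typ c k (S.vertex c s₀ l)), ?_⟩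
    filter_upwards [h, hk] with s hs hks
    have h1 := abs_sub_floor_mul_le c hk₀
    have h2 := abs_sub_floor_mul_le c hks
    rw [S.obj_of_hasVertex c hs, hks, hs.vertex_eq hsum hs₀ (u := (k : ℝ) * c.len) (by linarith)
      (by linarith)]
  · exact ⟨none, h.mono fun s hs => S.obj_of_not_hasVertex c hs⟩

theorem HasVertex.eventually_vertex_eq (hsum : ∑ i, η i = 0) {t : ℝ} {l : ℕ} (h : S.HasVertex c t l)
    :
    ∀ᶠ s in 𝓝 t, S.HasVertex c s l ∧ S.vertex c s l = S.vertex c t l := by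
  have hlen := len_pos' c
  filter_upwards [HasVertex.eventually S c h, Metric.ball_mem_nhds t hlen] with s hs hst
  rw [Metric.mem_ball, Real.dist_eq] at hst
  exact ⟨hs, hs.vertex_eq hsum h (u := t) (by linarith) (by simp)⟩

theorem HasVertex.eventually_obj_eq (hsum : ∑ i, η i = 0) {F : Filter ℝ} {t : ℝ} {l : ℕ} (h
    : S.HasVertex c t l)
    (hF : F ≤ 𝓝 t) {k : ℤ} (hk : ∀ᶠ s : ℝ in F, ⌊s / c.len⌋ = k) :
    ∀ᶠ s in F, S.obj c s l = some (S.typ c k (S.vertex c t l)) := by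
  filter_upwards [(h.eventually_vertex_eq hsum).filter_mono hF, hk] with s hs hks
  rw [S.obj_of_hasVertex c hs.1, hs.2, hks]

theorem exists_right (hsum : ∑ i, η i = 0) (t : ℝ) (l : ℕ) : ∃ v, ∀ᶠ s in 𝓝[>] t, S.obj c s l = v
    :=
  exists_eventually_obj_eq hsum (Or.inl rfl) (eventually_floor_right (len_pos' c) t) l

theorem exists_left (hsum : ∑ i, η i = 0) (t : ℝ) (l : ℕ) : ∃ v, ∀ᶠ s in 𝓝[<] t, S.obj c s l = v
    :=
  exists_eventually_obj_eq hsum (Or.inr rfl) (eventually_floor_left (len_pos' c) t) l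

end Limits

variable (hsum : ∑ i, η i = 0)

/-- The limit of the category flow from the right. -/
def rightObj (t : ℝ) (l : ℕ) : StarObj := (exists_right (S := S) (c := c) hsum t l).choose

/-- The limit of the category flow from the left. -/
def leftObj (t : ℝ) (l : ℕ) : StarObj := (exists_left (S := S) (c := c) hsum t l).choose

open Classical in
/-- The type of the arrow of the category flow. -/
def arrowType (t : ℝ) (l : ℕ) : ArrowType :=
  if S.HasVertex c t l then .transition else .null

theorem eventually_obj_eq_rightObj (t : ℝ) (l : ℕ) :
    ∀ᶠ s in 𝓝[>] t, S.obj c s l = S.rightObj c hsum t l :=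
  (exists_right (S := S) (c := c) hsum t l).choose_spec

theorem eventually_obj_eq_leftObj (t : ℝ) (l : ℕ) :
    ∀ᶠ s in 𝓝[<] t, S.obj c s l = S.leftObj c hsum t l :=
  (exists_left (S := S) (c := c) hsum t l).choose_spec

theorem rightObj_eq {t : ℝ} {l : ℕ} {v : StarObj} (h : ∀ᶠ s in 𝓝[>] t, S.obj c s l = v)
    :
    S.rightObj c hsum t l = v := by
  obtain ⟨s, h1, h2⟩ := (h.and (S.eventually_obj_eq_rightObj c hsum t l)).exists
  exact h2.symm.trans h1

theorem leftObj_eq {t : ℝ} {l : ℕ} {v : StarObj} (h : ∀ᶠ s in 𝓝[<] t, S.obj c s l = v)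
    :
    S.leftObj c hsum t l = v := by
  obtain ⟨s, h1, h2⟩ := (h.and (S.eventually_obj_eq_leftObj c hsum t l)).exists
  exact h2.symm.trans h1

theorem rightObj_of_hasVertex {t : ℝ} {l : ℕ} (h : S.HasVertex c t l) :
    S.rightObj c hsum t l = some (S.typ c ⌊t / c.len⌋ (S.vertex c t l)) :=
  S.rightObj_eq c hsum
    (h.eventually_obj_eq hsum nhdsWithin_le_nhds (eventually_floor_right (len_pos' c) t))

theorem leftObj_of_hasVertex {t : ℝ} {l : ℕ} (h : S.HasVertex c t l) :
    S.leftObj c hsum t l = some (S.typ c (⌈t / c.len⌉ - 1) (S.vertex c t l)) :=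
  S.leftObj_eq c hsum
    (h.eventually_obj_eq hsum nhdsWithin_le_nhds (eventually_floor_left (len_pos' c) t))

variable {S c} in
-- The sample time of an earlier window comes first, the mass above each r grows along the flow, and
-- rounding is accurate at both times.
theorem IsRelevant.dominated_typ {A : ι} {k k' : ℤ} (h : S.IsRelevant c (k * c.len) A)
    (h' : S.IsRelevant c (k' * c.len) A) (hk : k ≤ k') :
    Dominated (S.typ c k A) (S.typ c k' A) := by
  rcases hk.eq_or_lt with rfl | hk
  · exact fun r => le_rfl
  refine dominated_projType c.gap_pos c.gap_le (S.isProjMat A _) (S.isProjMat A _) (fun r => ?_)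
    h.two_div_mul_offBlock_lt h'.two_div_mul_offBlock_lt
  refine (S.isFlowProj A).monotone_sum_filter r ?_
  have h1 := S.sample_add_one_le c k
  have h2 := S.le_sample c k'
  have h3 : ((k : ℝ) + 1) * c.len ≤ k' * c.len := by
    refine mul_le_mul_of_nonneg_right ?_ (len_pos' c).le
    exact_mod_cast hk
  linarith

theorem ceil_sub_one_le_floor (x : ℝ) : ⌈x⌉ - 1 ≤ ⌊x⌋ := by
  have := Int.ceil_le_floor_add_one x
  omega

theorem abs_sub_ceil_mul_le (t : ℝ) : |t - ((⌈t / c.len⌉ - 1 : ℤ) : ℝ) * c.len| ≤ c.len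
    := by
  have h1 : t ≤ ⌈t / c.len⌉ * (c.len : ℝ) := (div_le_iff₀ (len_pos' c)).1 (Int.le_ceil _)
  have h2 : (⌈t / c.len⌉ - 1) * (c.len : ℝ) < t := by
    refine (lt_div_iff₀ (len_pos' c)).1 ?_
    linarith [Int.ceil_lt_add_one (t / c.len)]
  push_cast
  rw [abs_le]; constructor <;> linarith

variable {S c} in
theorem HasVertex.isRelevant_floor (hsum : ∑ i, η i = 0) {t : ℝ} {l : ℕ} (h : S.HasVertex c t l)
    :
    S.IsRelevant c (⌊t / c.len⌋ * c.len) (S.vertex c t l) :=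
  h.isRelevant hsum (by linarith [abs_sub_floor_mul_le c (s := t) rfl, len_pos' c])

/-- At a point s close to t on the given side, the flow is constant in a full neighbourhood of s, so
both limits equal the value at s. -/
theorem eventually_isIdArrow {F : Filter ℝ} {t : ℝ} (hF : F = 𝓝[>] t ∨ F = 𝓝[<] t) {l
    : ℕ}
    {v : StarObj} (h : ∀ᶠ s in F, S.obj c s l = v) :
    ∀ᶠ s in F, IsIdArrow (S.leftObj c hsum s l) (S.arrowType c s l) (S.rightObj c hsum s l) ∧
      S.obj c s l = v := by
  have hnear : ∀ᶠ s in F, ∀ᶠ u in 𝓝 s, S.obj c u l = v := by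
    rcases hF with rfl | rfl
    · have h1 := eventually_eventually_nhdsWithin.2 h
      filter_upwards [h1, self_mem_nhdsWithin] with s hs hst
      rwa [IsOpen.nhdsWithin_eq isOpen_Ioi hst] at hs
    · have h1 := eventually_eventually_nhdsWithin.2 h
      filter_upwards [h1, self_mem_nhdsWithin] with s hs hst
      rwa [IsOpen.nhdsWithin_eq isOpen_Iio hst] at hs
  filter_upwards [hnear] with s hs
  have hv := hs.self_of_nhds
  refine ⟨?_, hv⟩
  rw [S.leftObj_eq c hsum (hs.filter_mono nhdsWithin_le_nhds),
    S.rightObj_eq c hsum (hs.filter_mono nhdsWithin_le_nhds), arrowType]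
  by_cases hvx : S.HasVertex c s l
  · rw [if_pos hvx, ← hv, S.obj_of_hasVertex c hvx]
    rfl
  · rw [if_neg hvx, ← hv, S.obj_of_not_hasVertex c hvx]
    trivial

/-- The category flow of a family of flowing subspaces. -/
def categoryFlow : CategoryFlow η where
  obj := S.obj c
  left := S.leftObj c hsum
  right := S.rightObj c hsum
  arrow := S.arrowType c
  isArrow t l hl := by
    rw [arrowType]
    by_cases h : S.HasVertex c t l
    · rw [if_pos h, S.leftObj_of_hasVertex c hsum h, S.rightObj_of_hasVertex c hsum h]
      -- The two limits are types of the same vertex in the windows just before and just after t,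
      -- and this vertex is relevant at the start of each.
      refine IsRelevant.dominated_typ (h.isRelevant hsum ?_) (h.isRelevant_floor hsum)
        (ceil_sub_one_le_floor _)
      linarith [abs_sub_ceil_mul_le c t, len_pos' c]
    · rw [if_neg h]
      have h1 : 0 < l ∧ l < n := by
        constructor
        · exact Nat.pos_of_ne_zero fun h0 => h (Or.inl h0)
        · exact lt_of_le_of_ne hl fun hn => h (Or.inr (Or.inl hn))
      generalize S.leftObj c hsum t l = x
      generalize S.rightObj c hsum t l = y
      cases x <;> cases y <;> exact h1
  eventually_left t l _ :=
    S.eventually_isIdArrow c hsum (Or.inr rfl) (S.eventually_obj_eq_leftObj c hsum t l)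
  eventually_right t l _ :=
    S.eventually_isIdArrow c hsum (Or.inl rfl) (S.eventually_obj_eq_rightObj c hsum t l)
  obj_eq t l _ h := by
    rw [arrowType] at h
    by_cases hv : S.HasVertex c t l
    · rw [if_pos hv, S.rightObj_of_hasVertex c hsum hv] at h
      rw [S.obj_of_hasVertex c hv]
      generalize S.leftObj c hsum t l = x at h
      cases x with
      | none => exact h.elim
      | some E => exact congrArg some (Eq.symm h)
    · rw [if_neg hv] at h
      rw [S.obj_of_not_hasVertex c hv]
      generalize S.leftObj c hsum t l = x at h
      generalize S.rightObj c hsum t l = y at h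
      cases x <;> cases y <;> first | rfl | exact h.elim
  isDirectionFiltration t _ := by
    refine ⟨?_, ?_, fun l _ E hE => ?_, fun l l' hll' _ E E' hE hE' => ?_⟩
    · have h : S.HasVertex c t 0 := Or.inl rfl
      rw [S.obj_of_hasVertex c h, S.eq_bot (h.rk_vertex hsum), S.typ_bot]
    · have h : S.HasVertex c t n := Or.inr (Or.inl rfl)
      rw [S.obj_of_hasVertex c h, S.eq_top (h.rk_vertex hsum), S.typ_top]
    · have h := S.hasVertex_of_obj c hE
      rw [S.obj_of_hasVertex c h, Option.some_inj] at hE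
      rw [← hE]
      exact ⟨S.typ_le c _ _, by rw [(h.isRelevant_floor hsum).card_typ, h.rk_vertex hsum]⟩
    · have h := S.hasVertex_of_obj c hE
      have h' := S.hasVertex_of_obj c hE'
      rw [S.obj_of_hasVertex c h, Option.some_inj] at hE
      rw [S.obj_of_hasVertex c h', Option.some_inj] at hE'
      rw [← hE, ← hE']
      -- Vertices of different ranks are relevant at the start of the same window, hence nested, and
      -- so are their types.
      refine S.typ_mono c _ ((h.isRelevant_floor hsum).le (h'.isRelevant_floor hsum) ?_)
      rwa [h.rk_vertex hsum, h'.rk_vertex hsum]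

theorem not_nullAt_iff {t : ℝ} {l : ℕ} :
    ¬ (S.categoryFlow c hsum).NullAt t l ↔ S.HasVertex c t l := by
  have harrow : (S.categoryFlow c hsum).arrow t l = S.arrowType c t l := rfl
  have hobj : (S.categoryFlow c hsum).obj t l = S.obj c t l := rfl
  constructor
  · intro h
    by_contra hv
    refine h ?_
    by_cases hr : (S.categoryFlow c hsum).RegularAt t l
    · exact Or.inr ⟨hr, by rw [hobj, S.obj_of_not_hasVertex c hv]⟩
    · exact Or.inl ⟨hr, by rw [harrow, arrowType, if_neg hv]⟩
  · rintro hv (⟨_, h⟩ | ⟨_, h⟩)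
    · rw [harrow, arrowType, if_pos hv] at h
      exact ArrowType.noConfusion h
    · rw [hobj, S.obj_of_hasVertex c hv] at h
      exact Option.some_ne_none _ h

/-- The template of a family of flowing subspaces. -/
def template : Template η where
  flow := S.categoryFlow c hsum
  height := S.height c
  isHeightSequence t := ⟨S.height_bot c t, S.height_top c hsum t,
    fun _ h1 hn => (S.isRanked_val c t).secondDiff_nonneg h1 hn⟩
  continuous_height l hl := (S.isPL_height c hl).continuous
  compatible t l h1 hn := by rw [S.not_nullAt_iff c hsum, S.hasVertex_iff c h1 hn]
  hasDerivAt t l h1 hn hr E hE := by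
    have hv : S.HasVertex c t l := S.hasVertex_of_obj c hE
    have hE' : S.typ c ⌊t / c.len⌋ (S.vertex c t l) = E := by
      have : S.obj c t l = some E := hE
      rwa [S.obj_of_hasVertex c hv, Option.some_inj] at this
    have hr' : IsIdArrow (S.leftObj c hsum t l) (S.arrowType c t l) (S.rightObj c hsum t l) := hr
    rw [arrowType, if_pos hv, S.leftObj_of_hasVertex c hsum hv,
      S.rightObj_of_hasVertex c hsum hv] at hr'
    have hl : S.typ c (⌈t / c.len⌉ - 1) (S.vertex c t l) = E := Eq.trans hr' hE'
    have h1 := S.hasSlope_val_right c (S.vertex c t l) t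
    have h2 := S.hasSlope_val_left c (S.vertex c t l) t
    rw [hE'] at h1
    rw [hl] at h2
    -- Near t the height is the value of one fixed vertex; regularity says that its types before and
    -- after t coincide, so its one-sided slopes match.
    refine (h1.hasDerivAt h2).congr_of_eventuallyEq ?_
    filter_upwards [hv.eventually_vertex_eq hsum] with s hs
    rw [← hs.2, hs.1.val_vertex hsum]

end FlowSystem

end GTemplate

namespace GTemplate

/-! ### Matching with the abstract template -/

section Dominated

/-- With no element strictly between r and x, the multiplicity of x is the difference of two counts.
Hence the counts entering ≼ determine the multiset. -/
theorem card_filter_lt_eq {E : Multiset ℝ} {r x : ℝ} (hr : r < x)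
    (h : ∀ y ∈ E, y < x → y ≤ r) :
    (E.filter fun y => r < y).card = (E.filter fun y => x < y).card + E.count x := by
  induction E using Multiset.induction_on with
  | empty => simp
  | cons a E ih =>
    have ih' := ih fun y hy => h y (Multiset.mem_cons_of_mem hy)
    have ha := h a (Multiset.mem_cons_self a E)
    rw [Multiset.count_cons]
    rcases lt_trichotomy a x with hax | hax | hax
    · rw [Multiset.filter_cons_of_neg _ (ha hax).not_gt, Multiset.filter_cons_of_neg _ hax.not_gt,
        if_neg hax.ne', ih']
      rfl
    · subst hax
      rw [Multiset.filter_cons_of_pos _ hr, Multiset.filter_cons_of_neg _ (lt_irrefl a),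
        if_pos rfl, Multiset.card_cons, ih']
      rfl
    · rw [Multiset.filter_cons_of_pos _ (hr.trans hax), Multiset.filter_cons_of_pos _ hax,
        if_neg hax.ne, Multiset.card_cons, Multiset.card_cons, ih']
      exact Nat.add_right_comm _ _ _

theorem Dominated.antisymm {E F : Multiset ℝ} (h : Dominated E F) (h' : Dominated F E) :
    E = F := by
  ext x
  -- The threshold r is the largest element below x in either multiset; x - 1 is inserted so that a
  -- maximum exists.
  let T := insert (x - 1) ((E + F).toFinset.filter fun y => y < x)
  have hT : T.Nonempty := Finset.insert_nonempty _ _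
  set r := T.max' hT
  have hr : r < x := by
    rw [Finset.max'_lt_iff]
    intro y hy
    rcases Finset.mem_insert.1 hy with rfl | hy
    · linarith
    · exact (Finset.mem_filter.1 hy).2
  have hle : ∀ y ∈ E + F, y < x → y ≤ r := fun y hy hyx =>
    T.le_max' y (Finset.mem_insert_of_mem (Finset.mem_filter.2 ⟨Multiset.mem_toFinset.2 hy, hyx⟩))
  have h1 := card_filter_lt_eq hr fun y hy => hle y (Multiset.mem_add.2 (Or.inl hy))
  have h2 := card_filter_lt_eq hr fun y hy => hle y (Multiset.mem_add.2 (Or.inr hy))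
  have h3 := le_antisymm (h r) (h' r)
  have h4 := le_antisymm (h x) (h' x)
  omega

end Dominated

namespace FlowSystem

variable {n : ℕ} {η : Fin n → ℝ} {ι : Type*} [PartialOrder ι] [BoundedOrder ι]
  (S : FlowSystem η ι) (c : Scale η)

/-- If the type of a relevant element is the same in two windows, its subspace is almost
invariant in between, and of the same type. -/
theorem offBlock_lt_of_typ_eq {A : ι} {k k' : ℤ} {E : Multiset ℝ} {t δ : ℝ}
    (hA : S.IsRelevant c (k * c.len) A) (hA' : S.IsRelevant c (k' * c.len) A)
    (hE : S.typ c k A = E) (hE' : S.typ c k' A = E) (hkt : (k + 1) * c.len ≤ t)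
    (htk : t + 1 ≤ k' * c.len)
    (hδ : c.growth * (2 * (weightBound η * (2 / c.gap ^ 2 * c.small_bound))) < δ)
    (hδ' : 2 / c.gap ^ 2 * δ ≤ 1 / 2) :
    offBlock η (S.P A t) < δ ∧ projType η (S.P A t) = E := by
  have hg := c.gap_pos
  have h1 := S.sample_add_one_le c k
  have h2 := S.le_sample c k'
  -- At sample times of windows where A is relevant, the slope is near the sum of the type. With
  -- type E before and after t, monotonicity leaves almost no growth over [t, t + 1].
  have hclose : ∀ k : ℤ, S.IsRelevant c (k * c.len) A → |slope η (S.P A (S.sample c k)) -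
      (S.typ c k A).sum| ≤ weightBound η * (2 / c.gap ^ 2 * c.small_bound) := by
    intro k hk
    refine (abs_sub_sum_projType_le c.gap_pos c.gap_le (abs_le_weightBound η)
      (S.isProjMat A _)).trans ?_
    refine mul_le_mul_of_nonneg_left (mul_le_mul_of_nonneg_left hk.offBlock_sample_le ?_)
      (weightBound_nonneg η)
    positivity
  have h3 := abs_le.1 (hclose k hA)
  have h4 := abs_le.1 (hclose k' hA')
  rw [hE] at h3
  rw [hE'] at h4
  have hmono := (S.isFlowProj A).monotone_slope
  have h5 : slope η (S.P A (t + 1)) ≤ slope η (S.P A (S.sample c k')) := hmono (by linarith)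
  have h6 : slope η (S.P A (S.sample c k)) ≤ slope η (S.P A t) := hmono (by linarith)
  have hoff : offBlock η (S.P A t) < δ := by
    refine ((c.offBlock_le _ (S.isFlowProj A) t).trans
      (mul_le_mul_of_nonneg_left ?_ c.growth_nonneg)).trans_lt hδ
    linarith [h3.1, h3.2, h4.1, h4.2]
  refine ⟨hoff, ?_⟩
  have h7 : 2 / c.gap ^ 2 * offBlock η (S.P A t) < 1 / 2 :=
    (mul_lt_mul_of_pos_left hoff (by positivity)).trans_le hδ'
  -- The type at t lies between the types at the two sample times for ≼, and both are E.
  refine Dominated.antisymm ?_ ?_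
  · rw [← hE']
    exact dominated_projType c.gap_pos c.gap_le (S.isProjMat A _) (S.isProjMat A _)
      (fun r => (S.isFlowProj A).monotone_sum_filter r (by linarith)) h7
      hA'.two_div_mul_offBlock_lt
  · rw [← hE]
    exact dominated_projType c.gap_pos c.gap_le (S.isProjMat A _) (S.isProjMat A _)
      (fun r => (S.isFlowProj A).monotone_sum_filter r (by linarith)) hA.two_div_mul_offBlock_lt
      h7

/-- A vertex with a large second difference is a vertex for the true heights. -/
theorem HasVertex.exists_support (hsum : ∑ i, η i = 0) {t : ℝ} {l : ℕ} (h1 : 1 ≤ l) (hn : l < n)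
    (h : S.HasVertex c t l)
    (hC : 2 * (2 * c.dist + (c.tol + 1) * n ^ 2) < secondDiff (S.height c t) l) :
    ∃ m : ℝ, ∀ B, (S.rk B = l → S.ψ (S.vertex c t l) t ≤ S.ψ B t) ∧
      (S.rk B ≠ l → S.ψ (S.vertex c t l) t + m * ((S.rk B : ℝ) - l) < S.ψ B t) := by
  set A := S.vertex c t l
  have hA := h.rk_vertex hsum
  have hv := h.val_vertex hsum
  refine ⟨(S.height c t (l + 1) - S.height c t (l - 1)) / 2, fun B => ⟨fun hB => ?_, fun hB => ?_⟩⟩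
  · by_contra hlt
    rw [not_le] at hlt
    -- A competitor of rank l with smaller ψ would nearly realize the height, hence be relevant and
    -- equal to A.
    have h2 := abs_le.1 (S.abs_φ_sub_ψ_le c A t)
    have h3 := abs_le.1 (S.abs_φ_sub_ψ_le c B t)
    have h4 : S.val c B t ≤ S.height c t (S.rk B) + 2 * c.dist := by
      rw [hB, ← hv, val, val, hA, hB]
      linarith [h2.1, h3.2]
    have hlen := len_pos' c
    have h5 : S.IsRelevant c t B := S.isRelevant_of_val_le h4 (by simp)
    have h6 : S.IsRelevant c t A := h.isRelevant hsum (by simp)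
    rw [h5.eq h6 (hB.trans hA.symm)] at hlt
    exact lt_irrefl _ hlt
  -- In other ranks the gap of half the second difference outweighs 2 dist, lost in passing from φ
  -- to ψ, and the correction of B.
  · have h2 := abs_le.1 (S.abs_φ_sub_ψ_le c A t)
    have h3 := abs_le.1 (S.abs_φ_sub_ψ_le c B t)
    have h4 := (S.isRanked_val c t).tangent_add_le h1 hn hA hv hB
    have h5 := c.corr_le (S.rk_le B)
    have h6 := c.corr_nonneg (S.rk_le A)
    change S.val c A t + (S.height c t (l + 1) - S.height c t (l - 1)) / 2 *
      ((S.rk B : ℝ) - l) + secondDiff (S.height c t) l / 2 ≤ S.val c B t at h4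
    simp only [val] at h4
    linarith [h2.1, h3.2]

/-- The margin C ≥ 4 · `len` keeps the neighbouring windows inside [a, b], so one vertex has type E
in a window before t and in one after t; `offBlock_lt_of_typ_eq` then controls it at t. -/
theorem exists_matching_vertex (hsum : ∑ i, η i = 0) {δ C : ℝ}
    (hδ : c.growth * (2 * (weightBound η * (2 / c.gap ^ 2 * c.small_bound))) < δ)
    (hδ' : 2 / c.gap ^ 2 * δ ≤ 1 / 2) (hC1 : 4 * c.len ≤ C)
    (hC2 : 2 * (2 * c.dist + (c.tol + 1) * n ^ 2) < C) {l : ℕ} (h1 : 1 ≤ l) (hn : l < n)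
    {E : Multiset ℝ} {a b : ℝ}
    (hE : ∀ t ∈ Set.Icc a b, S.obj c t l = some E ∧ C ≤ secondDiff (S.height c t) l)
    {t : ℝ} (ht : t ∈ Set.Icc (a + C) (b - C)) :
    ∃ A, S.rk A = l ∧ offBlock η (S.P A t) < δ ∧ projType η (S.P A t) = E ∧
      ∃ m : ℝ, ∀ B, (S.rk B = l → S.ψ A t ≤ S.ψ B t) ∧
        (S.rk B ≠ l → S.ψ A t + m * ((S.rk B : ℝ) - l) < S.ψ B t) := by
  obtain ⟨ht1, ht2⟩ := ht
  have hlen := len_pos' c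
  have hlen1 : (1 : ℝ) ≤ c.len := by exact_mod_cast c.len_pos
  set k := ⌊t / c.len⌋
  have hk1 := floor_mul_le c t
  have hk2 := lt_floor_add_one_mul c t
  have htm : t ∈ Set.Icc a b := ⟨by linarith, by linarith⟩
  have hv := S.hasVertex_of_obj c (hE t htm).1
  have key : ∀ j : ℤ, |t - j * c.len| ≤ 4 * c.len →
      S.IsRelevant c (j * c.len) (S.vertex c t l) ∧ S.typ c j (S.vertex c t l) = E := by
    intro j hj
    refine ⟨hv.isRelevant hsum hj, ?_⟩
    have hj' := abs_le.1 hj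
    have h2 := (hE (j * c.len) ⟨by linarith [hj'.1, hj'.2], by linarith [hj'.1, hj'.2]⟩).1
    have hvj := S.hasVertex_of_obj c h2
    rw [S.obj_of_hasVertex c hvj, Option.some_inj, mul_div_cancel_right₀ _ hlen.ne',
      Int.floor_intCast] at h2
    rwa [hv.vertex_eq hsum hvj (u := (j : ℝ) * c.len) hj (by simp)]
  -- Window k - 1 is over by time t, and window k + 2 starts no earlier than t + `len` ≥ t + 1, as
  -- the unit-time growth estimate requires.
  obtain ⟨hr1, hE1⟩ := key (k - 1) (by push_cast; rw [abs_le]; constructor <;> linarith)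
  obtain ⟨hr2, hE2⟩ := key (k + 2) (by push_cast; rw [abs_le]; constructor <;> linarith)
  have h3 := S.offBlock_lt_of_typ_eq c (t := t) hr1 hr2 hE1 hE2 (by push_cast; linarith)
    (by push_cast; linarith) hδ hδ'
  exact ⟨_, hv.rk_vertex hsum, h3.1, h3.2,
    HasVertex.exists_support S c hsum h1 hn hv (hC2.trans_le (hE t htm).2)⟩

/-- The heights are close to a point above the convex hull. -/
theorem exists_interp_le {t : ℝ} {l : ℕ} (hl : l ≤ n) :
    ∃ (A B : ι) (θ : ℝ), 0 ≤ θ ∧ θ ≤ 1 ∧ θ * S.rk A + (1 - θ) * S.rk B = l ∧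
      θ * S.ψ A t + (1 - θ) * S.ψ B t ≤ S.height c t l + c.dist := by
  obtain ⟨p, hp⟩ := (S.isRanked_val c t).exists_lowerHull_eq hl
  obtain ⟨h1, h2⟩ := pairWeight_bounds S.rk_le p.2
  refine ⟨p.1.1, p.1.2, pairWeight S.rk l p.1, h1, h2, pairWeight_rank p.2, ?_⟩
  have key : ∀ A, S.ψ A t ≤ S.val c A t + c.dist := fun A => by
    have h3 := (abs_le.1 (S.abs_φ_sub_ψ_le c A t)).1
    have h4 := c.corr_nonneg (S.rk_le A)
    rw [val]; linarith
  rw [height, hp, interp]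
  nlinarith [mul_le_mul_of_nonneg_left (key p.1.1) h1,
    mul_le_mul_of_nonneg_left (key p.1.2) (sub_nonneg.2 h2)]

/-- The heights are close to a line below the convex hull. -/
theorem exists_line_le {t : ℝ} {l : ℕ} (hl : l ≤ n) :
    ∃ m q : ℝ, (∀ A, q + m * S.rk A ≤ S.ψ A t) ∧
      S.height c t l - (c.dist + (c.tol + 1) * n ^ 2) ≤ q + m * l := by
  obtain ⟨m, hm⟩ := (S.isRanked_val c t).exists_support hl
  refine ⟨m, S.height c t l - m * l - (c.dist + (c.tol + 1) * n ^ 2), fun A => ?_, by linarith⟩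
  have h1 := hm A
  have h3 := (abs_le.1 (S.abs_φ_sub_ψ_le c A t)).2
  have h4 := c.corr_le (S.rk_le A)
  simp only [val] at h1
  rw [height]
  simp only [val]
  linarith

end FlowSystem

/-! ### The Harder-Narasimhan filtration along the flow -/

section HarderNarasimhan

variable {n : ℕ} {η : Fin n → ℝ} {Λ : Submodule ℤ (EuclideanSpace ℝ (Fin n))}

theorem latticePoint_flowLattice (Γ : Submodule ℤ (EuclideanSpace ℝ (Fin n))) (t : ℝ) :
    latticePoint (flowLattice η t Γ) = ((Module.finrank ℤ Γ : ℝ), logCov η Γ t) := by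
  rw [latticePoint, finrank_flowLattice, logCov]

theorem latticePoint_mem_hnHull {Γ : Submodule ℤ (EuclideanSpace ℝ (Fin n))} (h : Γ ≤ Λ) (t : ℝ) :
    ((Module.finrank ℤ Γ : ℝ), logCov η Γ t) ∈ hnHull (flowLattice η t Λ) :=
  subset_convexHull ℝ _ ⟨flowLattice η t Γ, flowLattice_mono η t h,
    (latticePoint_flowLattice Γ t).symm⟩

/-- A convex set which contains the points of all primitive subgroups, and is closed upwards,
contains the convex hull. -/
theorem hnHull_subset [DiscreteTopology Λ] {t : ℝ} {W : Set (ℝ × ℝ)} (hW : Convex ℝ W)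
    (hup : ∀ x y y', (x, y) ∈ W → y ≤ y' → (x, y') ∈ W)
    (h : ∀ Γ, IsPrimitive Λ Γ → ((Module.finrank ℤ Γ : ℝ), logCov η Γ t) ∈ W) :
    hnHull (flowLattice η t Λ) ⊆ W := by
  refine convexHull_min ?_ hW
  rintro _ ⟨Γ, hΓ, rfl⟩
  have h1 : flowLattice η (-t) Γ ≤ Λ := by
    have := flowLattice_mono η (-t) hΓ
    rwa [flowLattice_neg_flowLattice] at this
  -- Saturation keeps the rank and does not increase the covolume, so the point of Γ lies above that
  -- of a primitive subgroup.
  have h2 := h _ (isPrimitive_saturation h1)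
  rw [finrank_saturation h1] at h2
  have h3 := hup _ _ _ h2 (logCov_saturation_le η h1 t)
  rw [← latticePoint_flowLattice, flowLattice_flowLattice_neg] at h3
  exact h3

/-- An open half plane together with a boundary point is convex. -/
theorem convex_halfPlane_insert (p : ℝ × ℝ) (m : ℝ) :
    Convex ℝ {q : ℝ × ℝ | p.2 + m * (q.1 - p.1) < q.2 ∨ q = p} := by
  intro x hx y hy a b ha hb hab
  have hb' : b = 1 - a := by linarith
  simp only [Set.mem_ofPred_eq, Prod.fst_add, Prod.snd_add, Prod.smul_fst, Prod.smul_snd,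
    smul_eq_mul]
  rcases ha.eq_or_lt with rfl | ha
  · have : b = 1 := by linarith
    subst this
    simpa using hy
  rcases hb.eq_or_lt with rfl | hb
  · have : a = 1 := by linarith
    subst this
    simpa using hx
  rcases hx with hx | rfl
  · left
    have hy' : p.2 + m * (y.1 - p.1) ≤ y.2 := by
      rcases hy with hy | rfl
      · exact hy.le
      · simp
    subst hb'
    nlinarith [mul_lt_mul_of_pos_left hx ha, mul_le_mul_of_nonneg_left hy' hb.le]
  · rcases hy with hy | rfl
    · left
      subst hb'
      nlinarith [mul_lt_mul_of_pos_left hy hb]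
    · right
      rw [← add_smul, hab, one_smul]

/-- The subgroup is in the filtration if its point is strictly below the other points. -/
theorem isHN_flowLattice [DiscreteTopology Λ] {t : ℝ}
    {A : Submodule ℤ (EuclideanSpace ℝ (Fin n))} (hA : IsPrimitive Λ A) {m : ℝ}
    (h : ∀ Γ, IsPrimitive Λ Γ →
      (Module.finrank ℤ Γ = Module.finrank ℤ A → logCov η A t ≤ logCov η Γ t) ∧
      (Module.finrank ℤ Γ ≠ Module.finrank ℤ A → logCov η A t +
        m * ((Module.finrank ℤ Γ : ℝ) - Module.finrank ℤ A) < logCov η Γ t)) :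
    IsHN (flowLattice η t Λ) (flowLattice η t A) := by
  refine ⟨flowLattice_mono η t hA.le, ?_⟩
  rw [latticePoint_flowLattice]
  set p : ℝ × ℝ := ((Module.finrank ℤ A : ℝ), logCov η A t) with hp
  set W : Set (ℝ × ℝ) := {q | p.2 + m * (q.1 - p.1) < q.2 ∨ q = p} with hW
  have hsub : hnHull (flowLattice η t Λ) ⊆ W := by
    refine hnHull_subset (convex_halfPlane_insert p m) ?_ fun Γ hΓ => ?_
    · rintro x y y' (hxy | hxy) hy
      · exact Or.inl (hxy.trans_le hy)
      · rcases hy.eq_or_lt with rfl | hy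
        · exact Or.inr hxy
        · left
          have h1 : x = p.1 := congrArg Prod.fst hxy
          have h2 : y = p.2 := congrArg Prod.snd hxy
          change p.2 + m * (x - p.1) < y'
          rw [h1, ← h2]; linarith
    · by_cases hr : Module.finrank ℤ Γ = Module.finrank ℤ A
      · rcases ((h Γ hΓ).1 hr).eq_or_lt with h1 | h1
        · right; rw [hr, ← h1]
        · left
          change logCov η A t + m * ((Module.finrank ℤ Γ : ℝ) - Module.finrank ℤ A) < logCov η Γ t
          rw [hr]; linarith
      · exact Or.inl ((h Γ hΓ).2 hr)
  -- The point is extreme in the larger set W, an open half plane with one boundary point added,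
  -- hence also in the hull.
  refine inter_extremePoints_subset_extremePoints_of_subset hsub
    ⟨latticePoint_mem_hnHull hA.le t, ?_⟩
  refine mem_extremePoints_iff_left.2 ⟨Or.inr rfl, ?_⟩
  rintro x hx y hy ⟨a, b, ha, hb, hab, hxy⟩
  rcases hx with hx | hx
  · exfalso
    have hy' : p.2 + m * (y.1 - p.1) ≤ y.2 := by
      rcases hy with hy | hy
      · exact hy.le
      · rw [hy]; simp
    have h1 : a * x.1 + b * y.1 = p.1 := congrArg Prod.fst hxy
    have h2 : a * x.2 + b * y.2 = p.2 := congrArg Prod.snd hxy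
    have hb' : b = 1 - a := by linarith
    subst hb'
    have h3 : m * (a * x.1 + (1 - a) * y.1) = m * p.1 := by rw [h1]
    nlinarith [mul_lt_mul_of_pos_left hx ha, mul_le_mul_of_nonneg_left hy' hb.le]
  · exact hx

variable (hsum : ∑ i, η i = 0) [DiscreteTopology Λ] [IsZLattice ℝ Λ]
  (hΛ : ZLattice.covolume Λ = 1) (c : Scale η)

/-- The infimum is squeezed between a line below all lattice points and a convex combination of two
of them, each within the stated distance of the template height at l. -/
theorem abs_hnHeight_sub_le {t : ℝ} {l : ℕ} (hl : l ≤ n) :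
    |hnHeight (flowLattice η t Λ) l - (latticeSystem hsum Λ hΛ).height c t l| ≤
      c.dist + (c.tol + 1) * n ^ 2 := by
  set S := latticeSystem hsum Λ hΛ
  obtain ⟨A, B, θ, h0, h1, h2, h3⟩ := S.exists_interp_le c (t := t) hl
  obtain ⟨m, q, h4, h5⟩ := S.exists_line_le c (t := t) hl
  have hsub : hnHull (flowLattice η t Λ) ⊆ {p : ℝ × ℝ | q + m * p.1 ≤ p.2} := by
    refine hnHull_subset ?_ (fun x y y' hxy hy => le_trans hxy hy) fun Γ hΓ => h4 ⟨Γ, hΓ⟩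
    intro x hx y hy a b ha hb hab
    have hb' : b = 1 - a := by linarith
    subst hb'
    simp only [Set.mem_ofPred_eq, Prod.fst_add, Prod.snd_add, Prod.smul_fst, Prod.smul_snd,
      smul_eq_mul] at hx hy ⊢
    nlinarith [mul_le_mul_of_nonneg_left hx ha, mul_le_mul_of_nonneg_left hy hb]
  have hmem : ((l : ℝ), θ * S.ψ A t + (1 - θ) * S.ψ B t) ∈ hnHull (flowLattice η t Λ) := by
    have hc : Convex ℝ (hnHull (flowLattice η t Λ)) := convex_convexHull ℝ _
    have := hc (latticePoint_mem_hnHull (η := η) A.2.le t) (latticePoint_mem_hnHull B.2.le t) h0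
      (sub_nonneg.2 h1) (by ring)
    rw [← h2]
    exact this
  have hbdd : ∀ y ∈ {y : ℝ | ((l : ℝ), y) ∈ hnHull (flowLattice η t Λ)}, q + m * l ≤ y :=
    fun y hy => hsub hy
  have hle : hnHeight (flowLattice η t Λ) l ≤ θ * S.ψ A t + (1 - θ) * S.ψ B t :=
    csInf_le ⟨_, hbdd⟩ hmem
  have hge : q + m * l ≤ hnHeight (flowLattice η t Λ) l := le_csInf ⟨_, hmem⟩ hbdd
  have h6 := c.tol_nonneg
  have h7 : 0 ≤ (c.tol + 1) * (n : ℝ) ^ 2 := by positivity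
  rw [abs_le]
  constructor <;> linarith

end HarderNarasimhan

/-! ### The existence of templates -/

/-- With gap and growth fixed, both quantities to be made small are proportional to 1/`len`, so a
long window suffices. -/
theorem exists_scale {n : ℕ} (η : Fin n → ℝ) {δ : ℝ} (hδ : 0 < δ) :
    ∃ c : Scale η, ∃ δ' ≤ δ,
      c.growth * (2 * (weightBound η * (2 / c.gap ^ 2 * c.small_bound))) < δ' ∧
      2 / c.gap ^ 2 * δ' ≤ 1 / 2 := by
  obtain ⟨g, hg, hgap⟩ := exists_gap η
  have hM := weightBound_nonneg η
  have hW : ∀ i j, |η i - η j| ≤ 2 * weightBound η := fun i j => by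
    have h1 := abs_sub (η i) (η j)
    linarith [abs_le_weightBound η i, abs_le_weightBound η j]
  set G := Real.exp (4 * n * (2 * weightBound η))
  have hG : 0 < G := Real.exp_pos _
  set X := G * (2 * (n + 1) * weightBound η) with hX
  have hX0 : 0 ≤ X := by positivity
  -- The bound g²/4 keeps rounding errors below 1/2 whenever the off-diagonal sum is below δ'.
  set δ' := min δ (g ^ 2 / 4) with hδ'
  have hδ'0 : 0 < δ' := by positivity
  set Y := G * (2 * (weightBound η * (2 / g ^ 2))) with hY
  have hY0 : 0 ≤ Y := by positivity
  obtain ⟨L, hL⟩ := exists_nat_gt (max (4 / g ^ 2 * X) (Y * X / δ'))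
  have hL1 := (le_max_left _ _).trans_lt hL
  have hL2 := (le_max_right _ _).trans_lt hL
  have hL0 : (0 : ℝ) < L := lt_of_le_of_lt (by positivity) hL1
  have hsmall : 2 / g ^ 2 * (G * (2 * (n + 1) * weightBound η / L)) < 1 / 2 := by
    have : 2 / g ^ 2 * (G * (2 * (n + 1) * weightBound η / L)) = (4 / g ^ 2 * X) / L / 2 := by
      rw [hX]; ring
    rw [this, div_lt_div_iff_of_pos_right two_pos, div_lt_one hL0]
    exact hL1
  refine ⟨⟨g, hg, hgap, G, hG.le, fun P hP t => hP.offBlock_le (by positivity) hW t, L,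
    by exact_mod_cast hL0, hsmall⟩, δ', min_le_left _ _, ?_, ?_⟩
  · have : G * (2 * (weightBound η * (2 / g ^ 2 * (G * (2 * (n + 1) * weightBound η / L))))) =
        Y * X / L := by
      rw [hX, hY]; ring
    refine lt_of_eq_of_lt this ?_
    rw [div_lt_iff₀ hL0]
    rw [div_lt_iff₀ hδ'0] at hL2
    linarith
  · have h1 : δ' ≤ g ^ 2 / 4 := min_le_right _ _
    have h2 : 2 / g ^ 2 * δ' ≤ 2 / g ^ 2 * (g ^ 2 / 4) :=
      mul_le_mul_of_nonneg_left h1 (by positivity)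
    refine h2.trans (le_of_eq ?_)
    field_simp
    norm_num

theorem exists_template_matches {n : ℕ} {η : Fin n → ℝ} (hsum : ∑ i, η i = 0) {ε : ℝ}
    (hε : 0 < ε) : ∃ C : ℝ, 0 < C ∧
      ∀ (Λ : Submodule ℤ (EuclideanSpace ℝ (Fin n))) [DiscreteTopology Λ] [IsZLattice ℝ Λ],
        ZLattice.covolume Λ = 1 → ∃ f : Template η, Matches η ε C Λ f := by
  obtain ⟨δ, hδ0, hδ⟩ := exists_mem_nhd_invGr η hε
  obtain ⟨c, δ', hδ', hc1, hc2⟩ := exists_scale η hδ0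
  have hD := c.dist_nonneg
  have hT : 0 ≤ (c.tol + 1) * (n : ℝ) ^ 2 := by
    have := c.tol_nonneg
    positivity
  have hlen := FlowSystem.len_pos' c
  -- The first summand is the time margin around t, the second the threshold making a vertex a
  -- Harder-Narasimhan member; the latter also dominates the height error. The final 1 makes the
  -- inequalities strict.
  set C : ℝ := 4 * c.len + 2 * (2 * c.dist + (c.tol + 1) * n ^ 2) + 1 with hC
  refine ⟨C, by positivity, fun Λ _ _ hΛ => ?_⟩
  set S := latticeSystem hsum Λ hΛ with hS
  refine ⟨S.template c hsum, fun t l _ hln => ?_, fun l hl1 hln E a b hE t ht => ?_⟩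
  · refine (abs_hnHeight_sub_le hsum hΛ c hln.le).trans_lt ?_
    linarith
  · obtain ⟨A, hA1, hA2, hA3, m, hm⟩ := S.exists_matching_vertex c hsum hc1 hc2 (C := C)
      (by linarith) (by linarith) hl1 hln (E := E) (a := a) (b := b)
      (fun u hu => ⟨(hE u hu).2.1, (hE u hu).2.2⟩) ht
    have := discreteTopology_of_le A.2.le
    have hA1' : Module.finrank ℤ A.1 = l := hA1
    refine ⟨flowLattice η t A.1, isHN_flowLattice A.2 (m := m) fun Γ hΓ => ?_,
      by rw [finrank_flowLattice, hA1'], ?_⟩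
    · rw [hA1']
      exact hm ⟨Γ, hΓ⟩
    · have hfin : Module.finrank ℝ (Submodule.span ℝ
          (flowLattice η t A.1 : Set (EuclideanSpace ℝ (Fin n)))) = l := by
        rw [finrank_span_eq, finrank_flowLattice, hA1']
      have h1 := hδ l ⟨_, hfin⟩ (hA2.trans_le hδ')
      have h2 : projType η (projOf (Submodule.span ℝ
        (flowLattice η t A.1 : Set (EuclideanSpace ℝ (Fin n))))) = E := hA3
      rw [h2] at h1
      exact ⟨_, h1, rfl⟩

end GTemplate

end

theorem mainTheorem2 (n : ℕ) (η : Fin n → ℝ) (hη : Monotone η) (hsum : ∑ i, η i = 0)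
    (ε : ℝ) (hε : 0 < ε) (hε0 : ENNReal.ofReal ε < GTemplate.eps0 η) :
    ∃ C : ℝ, 0 < C ∧
      ∀ (Λ : Submodule ℤ (EuclideanSpace ℝ (Fin n))) [DiscreteTopology Λ] [IsZLattice ℝ Λ],
        ZLattice.covolume Λ = 1 →
        ∃ f : GTemplate.Template η, GTemplate.Matches η ε C Λ f :=
  GTemplate.exists_template_matches hsum hε
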